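/- Conventions. For $d\ge 0$ let $\mathcal C_B(\mathbb E^d)$ be the finite-dimensional real vector space of algebraic curvature operators, i.e. self-adjoint endomorphisms of $\Lambda^2\mathbb E^d$ satisfying the Bianchi identity, with its action of $\mathrm O(d)$. A \emph{curvature condition} in dimension $d$ is an $\mathrm O(d)$-invariant subset $C_d\subset\mathcal C_B(\mathbb E^d)$; a Riemannian metric on a $d$-manifold \emph{satisfies} $C_d$ if at every point the curvature operator, expressed in an orthonormal basis of the tangent space, lies in $C_d$. A compact smooth manifold $M$ with $\partial M\neq\emptyset$ is always equipped with a collar, i.e. a smooth embedding $c\colon\partial M\times[0,1)\to M$ that is a diffeomorphism onto an open neighbourhood of $\partial M$ and identifies $\partial M\times\{0\}$ with $\partial M$. Let $\mathcal R(M)$ be the set of smooth Riemannian metrics $g$ on $M$ such that (if $\partial M\ne\emptyset$) $c^*g=g|_{\partial M}+dt^2$ on $\partial M\times[0,\varepsilon)$ for some $\varepsilon>0$, with the $C^\infty$-topology. Let $\mathrm{res}\colon\mathcal R(M)\to\mathcal R(\partial M)$, $g\mapsto g|_{\partial M}$, and, for $N$ closed, $\mathrm{stab}\colon\mathcal R(N)\to\mathcal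 R(N\times[0,1])$, $g\mapsto g+dt^2$. For an integer $d_C\ge0$ and a sequence $C=\{C_d\}_{d\ge d_C}$ of curvature conditions $C_d\subset\mathcal C_B(\mathbb E^d)$, let $\mathcal R_C(M)\subset\mathcal R(M)$ be the subspace of metrics that satisfy $C_d$ if $d=\dim M\ge d_C$, and $\mathcal R_C(M)=\emptyset$ if $\dim M<d_C$. Theorem. Let $C=\{C_d\}_{d\ge d_C}$ be a sequence of open curvature conditions. Assume that $\mathrm{stab}(\mathcal R_C(N))\subset\mathcal R_C(N\times[0,1])$ for all closed manifolds $N$, and that $\mathrm{res}(\mathcal R_C(M))\subset\mathcal R_C(\partial M)$ for all compact manifolds $M$ with $\partial M\neq\emptyset$. Then $\mathcal R_C$ is fibrant, i.e. for every compact manifold $M$ with $\partial M\ne\emptyset$ one has $\mathrm{res}(\mathcal R_C(M))\subset\mathcal R_C(\partial M)$ and the restriction map $\mathrm{res}\colon\mathcal R_C(M)\to\mathcal R_C(\partial M)$ is a Serre fibration. -/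

import Mathlib

open scoped Manifold ContDiff Topology

universe u

noncomputable section

/-! ### Smooth Riemannian metrics -/

section Metrics

variable {E : Type*} [NormedAddCommGroup E] [NormedSpace ℝ E]
  {H : Type*} [TopologicalSpace H] {I : ModelWithCorners ℝ E H}
  {M : Type*} [TopologicalSpace M] [ChartedSpace H M]
  {E' : Type*} [NormedAddCommGroup E'] [NormedSpace ℝ E']
  {H' : Type*} [TopologicalSpace H'] {I' : ModelWithCorners ℝ E' H'}
  {M' : Type*} [TopologicalSpace M'] [ChartedSpace H' M']

/-- Smooth Riemannian metrics on a smooth manifold (possibly with boundary). -/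
abbrev RiemMetric (I : ModelWithCorners ℝ E H) (M : Type*) [TopologicalSpace M]
    [ChartedSpace H M] [IsManifold I ∞ M] :=
  Bundle.ContMDiffRiemannianMetric I ∞ E (fun x : M => TangentSpace I x)

/-- The pull-back `(v, w) ↦ B (A v) (A w)` of a bilinear form along a linear map. -/
def pullbackBilin {V W : Type*} [AddCommGroup V] [Module ℝ V] [TopologicalSpace V]
    [AddCommGroup W] [Module ℝ W] [TopologicalSpace W]
    [IsTopologicalAddGroup W] [ContinuousSMul ℝ W]
    [IsTopologicalAddGroup V] [ContinuousSMul ℝ V]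
    (B : W →L[ℝ] W →L[ℝ] ℝ) (A : V →L[ℝ] W) : V →L[ℝ] V →L[ℝ] ℝ :=
  (ContinuousLinearMap.precomp ℝ A).comp (B.comp A)

@[simp] theorem pullbackBilin_apply {V W : Type*} [AddCommGroup V] [Module ℝ V]
    [TopologicalSpace V] [AddCommGroup W] [Module ℝ W] [TopologicalSpace W]
    [IsTopologicalAddGroup W] [ContinuousSMul ℝ W]
    [IsTopologicalAddGroup V] [ContinuousSMul ℝ V]
    (B : W →L[ℝ] W →L[ℝ] ℝ) (A : V →L[ℝ] W) (v w : V) :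
    pullbackBilin B A v w = B (A v) (A w) := rfl

theorem contMDiffAt_clm_of_apply [FiniteDimensional ℝ E] {F : Type*} [NormedAddCommGroup F]
    [NormedSpace ℝ F] {f : M → E →L[ℝ] F} {x₀ : M}
    (h : ∀ u, ContMDiffAt I 𝓘(ℝ, F) ∞ (fun x => f x u) x₀) :
    ContMDiffAt I 𝓘(ℝ, E →L[ℝ] F) ∞ f x₀ := by
  have hd : Module.finrank ℝ E = Module.finrank ℝ (Fin (Module.finrank ℝ E) → ℝ) := by simp
  let e₁ := ContinuousLinearEquiv.ofFinrankEq hd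
  let e₂ := (e₁.arrowCongr (ContinuousLinearEquiv.refl ℝ F)).trans
    (ContinuousLinearEquiv.piRing (Fin (Module.finrank ℝ E)))
  have h2 : ContMDiffAt I 𝓘(ℝ, Fin (Module.finrank ℝ E) → F) ∞ (fun x => e₂ (f x)) x₀ :=
    contMDiffAt_pi_space.2 fun i => h _
  have h3 := e₂.symm.contDiff (n := ∞).contMDiff.contMDiffAt (x := e₂ (f x₀)) |>.comp x₀ h2
  simpa [Function.comp_def] using h3

/-- A field of bilinear forms on the tangent spaces is smooth if all its coefficients with respect
to the trivializations of the tangent bundle are smooth. -/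
theorem contMDiff_bilin_of_apply [FiniteDimensional ℝ E] [IsManifold I ∞ M]
    (B : ∀ x : M, TangentSpace I x →L[ℝ] TangentSpace I x →L[ℝ] ℝ)
    (h : ∀ (x₀ : M) (u v : E), ContMDiffAt I 𝓘(ℝ) ∞
      (fun x => B x ((trivializationAt E (TangentSpace I) x₀).symm x u)
        ((trivializationAt E (TangentSpace I) x₀).symm x v)) x₀) :
    ContMDiff I (I.prod 𝓘(ℝ, E →L[ℝ] E →L[ℝ] ℝ)) ∞
      (fun x => Bundle.TotalSpace.mk' (E →L[ℝ] E →L[ℝ] ℝ)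
        (E := fun x : M => TangentSpace I x →L[ℝ] TangentSpace I x →L[ℝ] ℝ) x (B x)) := by
  intro x₀
  rw [contMDiffAt_hom_bundle]
  refine ⟨contMDiffAt_id, ?_⟩
  refine contMDiffAt_clm_of_apply fun u => contMDiffAt_clm_of_apply fun v => ?_
  refine (h x₀ u v).congr_of_eventuallyEq ?_
  have hmem : (trivializationAt E (TangentSpace I) x₀).baseSet ∈ 𝓝 x₀ :=
    (trivializationAt E (TangentSpace I) x₀).open_baseSet.mem_nhds
      (FiberBundle.mem_baseSet_trivializationAt' x₀)
  filter_upwards [hmem] with x hx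
  have := inCoordinates_apply_eq₂ (𝕜 := ℝ) (F₁ := E) (F₂ := E) (F₃ := ℝ)
    (E₁ := fun x : M => TangentSpace I x) (E₂ := fun x : M => TangentSpace I x)
    (E₃ := Bundle.Trivial M ℝ) (ϕ := B x) (v := u) (w := v) hx hx (Set.mem_univ _)
  simpa using this

theorem isVonNBounded_of_pos [FiniteDimensional ℝ E] (x : M)
    (B : TangentSpace I x →L[ℝ] TangentSpace I x →L[ℝ] ℝ)
    (hpos : ∀ v, v ≠ 0 → 0 < B v v) :
    Bornology.IsVonNBounded ℝ {v : TangentSpace I x | B v v < 1} := by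
  suffices ∀ B : E →L[ℝ] E →L[ℝ] ℝ, (∀ v, v ≠ 0 → 0 < B v v) →
    Bornology.IsVonNBounded ℝ {v : E | B v v < 1} from this B hpos
  clear hpos B
  intro B hpos
  rw [NormedSpace.isVonNBounded_iff']
  have := FiniteDimensional.proper ℝ E
  rcases (Metric.sphere (0 : E) 1).eq_empty_or_nonempty with he | hne
  · refine ⟨0, fun v _ => ?_⟩
    by_contra hv
    have hv' : ‖v‖ ≠ 0 := fun h => hv h.le
    have : (‖v‖⁻¹ • v) ∈ Metric.sphere (0 : E) 1 := by
      simp [norm_smul, hv']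
    rw [he] at this
    exact this
  · obtain ⟨m, hm, hmin⟩ := (isCompact_sphere (0 : E) 1).exists_isMinOn hne
      (f := fun v => B v v) (by fun_prop)
    have hm0 : m ≠ 0 := by
      rintro rfl
      simp at hm
    have hBm := hpos m hm0
    refine ⟨(B m m)⁻¹ + 1, fun v hv => ?_⟩
    rcases eq_or_ne v 0 with rfl | hv0
    · simp only [norm_zero]; positivity
    have hvn : 0 < ‖v‖ := norm_pos_iff.2 hv0
    have h1 := hmin (show (‖v‖⁻¹ • v) ∈ Metric.sphere (0 : E) 1 by
      simp [norm_smul, hvn.ne'])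
    simp only [Set.mem_ofPred_eq, map_smul, smul_apply, smul_eq_mul] at h1
    have hv : B v v < 1 := hv
    have h2 : B m m * ‖v‖ ^ 2 < 1 := by
      have : B m m * ‖v‖ ^ 2 ≤ B v v := by
        calc B m m * ‖v‖ ^ 2 ≤ (‖v‖⁻¹ * (‖v‖⁻¹ * B v v)) * ‖v‖ ^ 2 := by gcongr
          _ = B v v := by field_simp
      linarith
    have h3 : ‖v‖ ^ 2 < (B m m)⁻¹ := by
      rw [← one_div, lt_div_iff₀ hBm]
      linarith
    nlinarith [sq_nonneg (‖v‖ - 1)]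

theorem contMDiffAt_tangent_apply [IsManifold I ∞ M] [IsManifold I' ∞ M']
    {f : M' → M} (hf : ContMDiff I' I ∞ f) (x₀ : M') (u : E') :
    ContMDiffAt I' I.tangent ∞
      (fun x => (Bundle.TotalSpace.mk' E (f x)
        (mfderiv I' I f x ((trivializationAt E' (TangentSpace I') x₀).symm x u)) :
          TangentBundle I M)) x₀ := by
  have h1 : ContMDiff I'.tangent I.tangent ∞ (tangentMap I' I f) :=
    hf.contMDiff_tangentMap le_rfl
  have h2 : ContMDiffAt I' I'.tangent ∞ (fun x => (Bundle.TotalSpace.mk' E' x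
      ((trivializationAt E' (TangentSpace I') x₀).symm x u) : TangentBundle I' M')) x₀ := by
    have hx := FiberBundle.mem_baseSet_trivializationAt' (F := E')
      (E := fun x : M' => TangentSpace I' x) x₀
    have hb := (trivializationAt E' (TangentSpace I' : M' → Type _) x₀).open_baseSet.mem_nhds hx
    have h4 : ContMDiffAt I' (I'.prod 𝓘(ℝ, E')) ∞ (fun x : M' => (x, u)) x₀ :=
      contMDiffAt_id.prodMk contMDiffAt_const
    have h5 := ((trivializationAt E' (TangentSpace I' : M' → Type _) x₀).contMDiffOn_symm
      (n := ∞) (IB := I')).contMDiffAt (x := (x₀, u))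
      ((trivializationAt E' (TangentSpace I' : M' → Type _) x₀).open_target.mem_nhds
        ((trivializationAt E' (TangentSpace I' : M' → Type _) x₀).mem_target.2 hx))
    refine (h5.comp x₀ h4).congr_of_eventuallyEq ?_
    filter_upwards [hb] with x hx
    exact (trivializationAt E' (TangentSpace I' : M' → Type _) x₀).mk_symm hx u
  exact h1.contMDiffAt.comp x₀ h2

/-- The coefficients of the pull-back of a metric along a smooth map are smooth. -/
theorem contMDiffAt_pullback_apply [IsManifold I ∞ M] [IsManifold I' ∞ M']
    (g : RiemMetric I M) (f : M' → M) (hf : ContMDiff I' I ∞ f) (x₀ : M') (u v : E') :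
    ContMDiffAt I' 𝓘(ℝ) ∞
      (fun x => g.inner (f x)
        (mfderiv I' I f x ((trivializationAt E' (TangentSpace I') x₀).symm x u))
        (mfderiv I' I f x ((trivializationAt E' (TangentSpace I') x₀).symm x v))) x₀ := by
  have hs := contMDiffAt_tangent_apply hf x₀
  have h3 := ContMDiffAt.clm_bundle_apply₂ (IM := I') (IB := I) (n := ∞) (F₁ := E) (F₂ := E)
    (F₃ := ℝ) (E₁ := fun x : M => TangentSpace I x) (E₂ := fun x : M => TangentSpace I x)
    (E₃ := Bundle.Trivial M ℝ) (b := f) (x := x₀) (ψ := fun x => g.inner (f x))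
    (g.contMDiff.contMDiffAt.comp x₀ hf.contMDiffAt) (hs u) (hs v)
  simp only [Bundle.contMDiffAt_totalSpace] at h3
  exact h3.2

/-- The pull-back of a Riemannian metric along a smooth immersion. -/
def RiemMetric.pullback [FiniteDimensional ℝ E'] [IsManifold I ∞ M] [IsManifold I' ∞ M']
    (g : RiemMetric I M) (f : M' → M) (hf : ContMDiff I' I ∞ f)
    (hinj : ∀ x, Function.Injective (mfderiv I' I f x)) : RiemMetric I' M' where
  inner x := pullbackBilin (g.inner (f x)) (mfderiv I' I f x)
  symm _ _ _ := g.symm _ _ _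
  pos x v hv := g.pos _ (mfderiv I' I f x v) ((map_ne_zero_iff _ (hinj x)).2 hv)
  isVonNBounded x := isVonNBounded_of_pos x _ fun v hv =>
    g.pos _ (mfderiv I' I f x v) ((map_ne_zero_iff _ (hinj x)).2 hv)
  contMDiff := contMDiff_bilin_of_apply _ fun x₀ u v => contMDiffAt_pullback_apply g f hf x₀ u v

/-- The differential `dt` of the interval coordinate on `M × [0,1]`. -/
def intervalForm (I : ModelWithCorners ℝ E H) (q : M × Set.Icc (0 : ℝ) 1) :
    TangentSpace (I.prod (𝓡∂ 1)) q →L[ℝ] ℝ :=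
  mfderiv (I.prod (𝓡∂ 1)) 𝓘(ℝ) (fun q : M × Set.Icc (0 : ℝ) 1 => (q.2 : ℝ)) q

theorem eq_zero_of_intervalForm [IsManifold I ∞ M] (q : M × Set.Icc (0 : ℝ) 1)
    (v : TangentSpace (I.prod (𝓡∂ 1)) q)
    (h1 : mfderiv (I.prod (𝓡∂ 1)) I Prod.fst q v = 0) (h2 : intervalForm I q v = 0) :
    v = 0 := by
  rw [mfderiv_fst] at h1
  have hd : MDifferentiableAt (𝓡∂ 1) 𝓘(ℝ) (fun t : Set.Icc (0 : ℝ) 1 => (t : ℝ)) q.2 :=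
    (contMDiff_subtypeVal_Icc (n := 1) q.2).mdifferentiableAt one_ne_zero
  have hc : intervalForm I q v
      = mfderiv (𝓡∂ 1) 𝓘(ℝ) (fun t : Set.Icc (0 : ℝ) 1 => (t : ℝ)) q.2 v.2 := by
    have := mfderiv_comp (I := I.prod (𝓡∂ 1)) q hd (mdifferentiableAt_snd (I := I))
    rw [mfderiv_snd] at this
    exact congrArg (fun L => L v) this
  have key : ∀ (L : EuclideanSpace ℝ (Fin 1) →L[ℝ] ℝ) (e w : EuclideanSpace ℝ (Fin 1)),
      L e = 1 → L w = 0 → w = 0 := by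
    intro L e w he hw
    have hsurj : Function.Surjective (L : EuclideanSpace ℝ (Fin 1) →ₗ[ℝ] ℝ) := fun y =>
      ⟨y • e, by simp [he]⟩
    have hinj := (LinearMap.injective_iff_surjective_of_finrank_eq_finrank (by simp)).2 hsurj
    exact hinj (hw.trans (map_zero L).symm)
  have h3 : v.2 = 0 :=
    key (mfderiv (𝓡∂ 1) 𝓘(ℝ) (fun t : Set.Icc (0 : ℝ) 1 => (t : ℝ)) q.2) _ _
      (mfderiv_subtypeVal_Icc_one q.2) (hc.symm.trans h2)
  exact Prod.ext h1 h3

theorem contMDiffAt_intervalForm_apply [IsManifold I ∞ M] (x₀ : M × Set.Icc (0 : ℝ) 1)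
    (u : E × EuclideanSpace ℝ (Fin 1)) :
    ContMDiffAt (I.prod (𝓡∂ 1)) 𝓘(ℝ) ∞
      (fun x => intervalForm I x
        ((trivializationAt (E × EuclideanSpace ℝ (Fin 1))
          (TangentSpace (I.prod (𝓡∂ 1)) : M × Set.Icc (0 : ℝ) 1 → Type _) x₀).symm x u)) x₀ := by
  have hf : ContMDiff (I.prod (𝓡∂ 1)) 𝓘(ℝ) ∞
      (fun q : M × Set.Icc (0 : ℝ) 1 => (q.2 : ℝ)) :=
    contMDiff_subtypeVal_Icc.comp contMDiff_snd
  have := contMDiffAt_tangent_apply (I := 𝓘(ℝ)) hf x₀ u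
  rw [Bundle.contMDiffAt_totalSpace] at this
  refine ContMDiffAt.congr_of_eventuallyEq this.2 (Filter.Eventually.of_forall fun x => ?_)
  simp [intervalForm]
  rfl

theorem stab_pos_aux [IsManifold I ∞ M] (g : RiemMetric I M) (q : M × Set.Icc (0 : ℝ) 1)
    (v : TangentSpace (I.prod (𝓡∂ 1)) q) (hv : v ≠ 0) :
    0 < (pullbackBilin (g.inner q.1) (mfderiv (I.prod (𝓡∂ 1)) I Prod.fst q) +
      pullbackBilin (ContinuousLinearMap.mul ℝ ℝ) (intervalForm I q)) v v := by
  change 0 < g.inner q.1 (mfderiv (I.prod (𝓡∂ 1)) I Prod.fst q v)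
    (mfderiv (I.prod (𝓡∂ 1)) I Prod.fst q v) + intervalForm I q v * intervalForm I q v
  by_cases h1 : mfderiv (I.prod (𝓡∂ 1)) I Prod.fst q v = 0
  · have h2 : intervalForm I q v ≠ 0 := fun h2 => hv (eq_zero_of_intervalForm q v h1 h2)
    rw [h1, map_zero, zero_add]
    exact mul_self_pos.2 h2
  · exact add_pos_of_pos_of_nonneg (g.pos _ _ h1) (mul_self_nonneg _)

/-- The stabilization `g ↦ g + dt²` from metrics on `M` to metrics on `M × [0,1]`. -/
def RiemMetric.stab [FiniteDimensional ℝ E] [IsManifold I ∞ M] (g : RiemMetric I M) :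
    RiemMetric (I.prod (𝓡∂ 1)) (M × Set.Icc (0 : ℝ) 1) where
  inner q := pullbackBilin (g.inner q.1) (mfderiv (I.prod (𝓡∂ 1)) I Prod.fst q) +
    pullbackBilin (ContinuousLinearMap.mul ℝ ℝ) (intervalForm I q)
  symm _ _ _ := congrArg₂ (· + ·) (g.symm _ _ _) (mul_comm _ _)
  pos q v hv := stab_pos_aux g q v hv
  isVonNBounded q := isVonNBounded_of_pos q _ fun v hv => stab_pos_aux g q v hv
  contMDiff := contMDiff_bilin_of_apply _ fun x₀ u v =>
    (contMDiffAt_pullback_apply g Prod.fst contMDiff_fst x₀ u v).add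
      ((contMDiffAt_intervalForm_apply x₀ u).mul (contMDiffAt_intervalForm_apply x₀ v))

/-! ### The smooth topology on the space of metrics -/

/-- The coordinate expression of the metric `g` in the preferred chart around `p`, as a function on
the model vector space with values in bilinear forms. Only its values on the target of the chart
are meaningful. -/
def RiemMetric.coord [IsManifold I ∞ M] (g : RiemMetric I M) (p : M) (y : E) :
    E →L[ℝ] E →L[ℝ] ℝ :=
  pullbackBilin (V := E) (g.inner ((extChartAt I p).symm y))
    (mfderivWithin 𝓘(ℝ, E) I (extChartAt I p).symm (Set.range I) y)

/-- The `C^∞`-topology: uniform convergence, on compact subsets of charts, of the coordinate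
expressions of the metrics and of all their derivatives. -/
instance RiemMetric.instTopologicalSpace [IsManifold I ∞ M] :
    TopologicalSpace (RiemMetric I M) :=
  ⨅ (p : M) (k : ℕ), TopologicalSpace.induced
    (fun g => UniformOnFun.ofFun {K : Set E | IsCompact K ∧ K ⊆ (extChartAt I p).target}
      (iteratedFDerivWithin ℝ k (g.coord p) (Set.range I))) inferInstance

/-! ### The curvature tensor -/

/-- The Christoffel symbols `Γ(u, v)` at `y` of a metric `G` on a subset `s` of a vector space:
`G(Γ(u, v), w) = (D_u G(v, w) + D_v G(u, w) - D_w G(u, v)) / 2` for all `w`. -/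
def christoffel (s : Set E) (G : E → E →L[ℝ] E →L[ℝ] ℝ) (y u v : E) : E :=
  (G y).inverse ((1 / 2 : ℝ) • (fderivWithin ℝ G s y u v + fderivWithin ℝ G s y v u -
    ((fderivWithin ℝ G s y).flip u).flip v))

/-- The curvature endomorphism `R(u, v) w = ∇_u ∇_v w - ∇_v ∇_u w` (for constant vector fields
`u`, `v`, `w`) at `y` of a metric `G` on a subset `s` of a vector space. -/
def curvatureEndo (s : Set E) (G : E → E →L[ℝ] E →L[ℝ] ℝ) (y u v w : E) : E :=
  fderivWithin ℝ (fun z => christoffel s G z v w) s y u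
    - fderivWithin ℝ (fun z => christoffel s G z u w) s y v
    + christoffel s G y u (christoffel s G y v w)
    - christoffel s G y v (christoffel s G y u w)

/-- The Riemann curvature tensor `(u, v, w, z) ↦ g(R(u, v) z, w)` of `g` at the point `p`, computed
in the preferred chart at `p` (through which `T_p M` is identified with the model space). With this
convention, the sectional curvature of the plane spanned by orthonormal `u`, `v` is its value
at `(u, v, u, v)`. -/
def RiemMetric.riemann [IsManifold I ∞ M] (g : RiemMetric I M) (p : M)
    (u v w z : TangentSpace I p) : ℝ :=
  g.inner p (curvatureEndo (E := E) (Set.range I) (g.coord p) (extChartAt I p p) u v z) w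

end Metrics

/-! ### Curvature conditions -/

/-- The space of algebraic curvature operators on Euclidean `d`-space: self-adjoint endomorphisms
`R` of `Λ² 𝔼^d` that satisfy the Bianchi identity. Such an `R` is given by its coefficients
`R i j k l = ⟨R (e_i ∧ e_j), e_k ∧ e_l⟩` in the standard orthonormal basis. -/
def AlgCurvOp (d : ℕ) : Submodule ℝ (Fin d → Fin d → Fin d → Fin d → ℝ) where
  carrier := {R | (∀ i j k l, R j i k l = -R i j k l) ∧ (∀ i j k l, R i j l k = -R i j k l) ∧
    (∀ i j k l, R k l i j = R i j k l) ∧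
    (∀ i j k l, R i j k l + R j k i l + R k i j l = 0)}
  zero_mem' := by simp
  add_mem' := by
    rintro R S ⟨h1, h2, h3, h4⟩ ⟨h1', h2', h3', h4'⟩
    refine ⟨fun i j k l => ?_, fun i j k l => ?_, fun i j k l => ?_, fun i j k l => ?_⟩
    · simp only [Pi.add_apply, h1 i j k l, h1' i j k l]; ring
    · simp only [Pi.add_apply, h2 i j k l, h2' i j k l]; ring
    · simp only [Pi.add_apply, h3 i j k l, h3' i j k l]
    · simp only [Pi.add_apply]; linarith [h4 i j k l, h4' i j k l]
  smul_mem' := by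
    rintro c R ⟨h1, h2, h3, h4⟩
    refine ⟨fun i j k l => ?_, fun i j k l => ?_, fun i j k l => ?_, fun i j k l => ?_⟩
    · simp only [Pi.smul_apply, smul_eq_mul, h1 i j k l]; ring
    · simp only [Pi.smul_apply, smul_eq_mul, h2 i j k l]; ring
    · simp only [Pi.smul_apply, smul_eq_mul, h3 i j k l]
    · simp only [Pi.smul_apply, smul_eq_mul]; linear_combination c * h4 i j k l

theorem sum_rotate {d : ℕ} (f : Fin d → Fin d → Fin d → ℝ) :
    ∑ x, ∑ y, ∑ z, f x y z = ∑ z, ∑ x, ∑ y, f x y z := by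
  rw [Finset.sum_comm (γ := Fin d) (t := Finset.univ)
    (f := fun z x => ∑ y, f x y z)]
  exact Finset.sum_congr rfl fun x _ => Finset.sum_comm

/-- The action of a matrix `A` on coefficients: `(A ⬝ R)(x, y, z, w) = R(Aᵀx, Aᵀy, Aᵀz, Aᵀw)`, i.e.
`A ⬝ R = Λ²A ∘ R ∘ (Λ²A)ᵀ`. For `A ∈ O(d)` this is the action by change of orthonormal basis. -/
def AlgCurvOp.rotate {d : ℕ} (A : Matrix (Fin d) (Fin d) ℝ) (R : AlgCurvOp d) : AlgCurvOp d where
  val i j k l := ∑ a, ∑ b, ∑ c, ∑ e, A i a * A j b * A k c * A l e * R.1 a b c e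
  property := by
    obtain ⟨R, h1, h2, h3, h4⟩ := R
    refine ⟨fun i j k l => ?_, fun i j k l => ?_, fun i j k l => ?_, fun i j k l => ?_⟩
    · change (∑ a, ∑ b, ∑ c, ∑ e, A j a * A i b * A k c * A l e * R a b c e) =
        -∑ a, ∑ b, ∑ c, ∑ e, A i a * A j b * A k c * A l e * R a b c e
      rw [Finset.sum_comm]
      simp only [← Finset.sum_neg_distrib]
      refine Finset.sum_congr rfl fun a _ => Finset.sum_congr rfl fun b _ =>
        Finset.sum_congr rfl fun c _ => Finset.sum_congr rfl fun e _ => ?_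
      rw [h1 a b c e]; ring
    · change (∑ a, ∑ b, ∑ c, ∑ e, A i a * A j b * A l c * A k e * R a b c e) =
        -∑ a, ∑ b, ∑ c, ∑ e, A i a * A j b * A k c * A l e * R a b c e
      simp only [← Finset.sum_neg_distrib]
      refine Finset.sum_congr rfl fun a _ => Finset.sum_congr rfl fun b _ => ?_
      rw [Finset.sum_comm]
      refine Finset.sum_congr rfl fun c _ => Finset.sum_congr rfl fun e _ => ?_
      rw [h2 a b c e]; ring
    · change (∑ a, ∑ b, ∑ c, ∑ e, A k a * A l b * A i c * A j e * R a b c e) =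
        ∑ a, ∑ b, ∑ c, ∑ e, A i a * A j b * A k c * A l e * R a b c e
      rw [sum_rotate]
      refine Finset.sum_congr rfl fun a _ => ?_
      rw [sum_rotate]
      refine Finset.sum_congr rfl fun b _ =>
        Finset.sum_congr rfl fun c _ => Finset.sum_congr rfl fun e _ => ?_
      rw [h3 a b c e]; ring
    · change (∑ a, ∑ b, ∑ c, ∑ e, A i a * A j b * A k c * A l e * R a b c e) +
        (∑ a, ∑ b, ∑ c, ∑ e, A j a * A k b * A i c * A l e * R a b c e) +
        (∑ a, ∑ b, ∑ c, ∑ e, A k a * A i b * A j c * A l e * R a b c e) = 0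
      rw [sum_rotate fun a b c => ∑ e, A j a * A k b * A i c * A l e * R a b c e,
        ← sum_rotate fun b c a => ∑ e, A k a * A i b * A j c * A l e * R a b c e]
      simp only [← Finset.sum_add_distrib]
      refine Finset.sum_eq_zero fun a _ => Finset.sum_eq_zero fun b _ =>
        Finset.sum_eq_zero fun c _ => Finset.sum_eq_zero fun e _ => ?_
      linear_combination A i a * A j b * A k c * A l e * h4 a b c e

/-- A sequence of curvature conditions `C_d ⊆ AlgCurvOp d`, `d ≥ dmin`, i.e. of `O(d)`-invariant
subsets. (The value of `cond` in dimensions below `dmin` is irrelevant.) -/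
structure CurvatureConditions where
  dmin : ℕ
  cond : ∀ d : ℕ, Set (AlgCurvOp d)
  invariant : ∀ d, dmin ≤ d → ∀ A ∈ Matrix.orthogonalGroup (Fin d) ℝ,
    ∀ R ∈ cond d, AlgCurvOp.rotate A R ∈ cond d

/-- All the curvature conditions `C_d`, `d ≥ dmin`, are open. -/
def CurvatureConditions.Open (C : CurvatureConditions) : Prop :=
  ∀ d, C.dmin ≤ d → IsOpen (C.cond d)

/-- The metric `g` on the `d`-dimensional manifold `M` satisfies the curvature condition `S`: at
every point, the description of the curvature operator in terms of an orthonormal basis of the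
tangent space belongs to `S`. -/
def RiemMetric.Satisfies {E : Type*} [NormedAddCommGroup E] [NormedSpace ℝ E]
    {H : Type*} [TopologicalSpace H] {I : ModelWithCorners ℝ E H}
    {M : Type*} [TopologicalSpace M] [ChartedSpace H M] [IsManifold I ∞ M]
    (g : RiemMetric I M) {d : ℕ} (S : Set (AlgCurvOp d)) : Prop :=
  ∀ (p : M) (b : Module.Basis (Fin d) ℝ (TangentSpace I p)),
    (∀ i j, g.inner p (b i) (b j) = if i = j then 1 else 0) →
      ∃ R ∈ S, ∀ i j k l, R.1 i j k l = g.riemann p (b i) (b j) (b k) (b l)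

/-! ### Collared manifolds -/

/-- A collar of the `(n+1)`-dimensional manifold `M` with boundary `∂M = N`: a diffeomorphism `c`
from `N × [0,1)` onto an open subset of `M` that maps `N × {0}` onto the boundary of `M`. (It is
written as a partial map on `N × [0,1]`; its values outside of `N × [0,1)` are irrelevant.)
The manifold `N` is identified with `∂M` through `x ↦ c (x, 0)`. -/
structure Collar (n : ℕ)
    (N : Type u) [TopologicalSpace N] [ChartedSpace (EuclideanSpace ℝ (Fin n)) N]
    (M : Type u) [TopologicalSpace M] [ChartedSpace (EuclideanHalfSpace (n + 1)) M] where
  toMap : OpenPartialHomeomorph (N × Set.Icc (0 : ℝ) 1) M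
  source_eq : toMap.source = {q | (q.2 : ℝ) < 1}
  contMDiffOn_toMap : ContMDiffOn ((𝓡 n).prod (𝓡∂ 1)) (𝓡∂ (n + 1)) ∞ toMap toMap.source
  contMDiffOn_symm : ContMDiffOn (𝓡∂ (n + 1)) ((𝓡 n).prod (𝓡∂ 1)) ∞ toMap.symm toMap.target
  image_zero : toMap '' {q | (q.2 : ℝ) = 0} = (𝓡∂ (n + 1)).boundary M

namespace Collar

variable {n : ℕ}
  {N : Type u} [TopologicalSpace N] [ChartedSpace (EuclideanSpace ℝ (Fin n)) N]
  {M : Type u} [TopologicalSpace M] [ChartedSpace (EuclideanHalfSpace (n + 1)) M]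

/-- The inclusion of the boundary. -/
def incl (c : Collar n N M) (x : N) : M := c.toMap (x, 0)

theorem mem_source (c : Collar n N M) (x : N) : (x, (0 : Set.Icc (0 : ℝ) 1)) ∈ c.toMap.source := by
  rw [c.source_eq]; simp

theorem contMDiff_incl (c : Collar n N M) : ContMDiff (𝓡 n) (𝓡∂ (n + 1)) ∞ c.incl := by
  intro x
  have h := c.contMDiffOn_toMap.contMDiffAt (c.toMap.open_source.mem_nhds (c.mem_source x))
  exact h.comp x (contMDiffAt_id.prodMk contMDiffAt_const)

theorem mfderiv_incl_injective (c : Collar n N M) (x : N) :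
    Function.Injective (mfderiv (𝓡 n) (𝓡∂ (n + 1)) c.incl x) := by
  have h := (c.contMDiff_incl x).mdifferentiableAt (by simp)
  have h1 : MDifferentiableAt (𝓡∂ (n + 1)) (𝓡 n) (fun y => (c.toMap.symm y).1) (c.incl x) := by
    have := c.contMDiffOn_symm.contMDiffAt
      (c.toMap.open_target.mem_nhds (c.toMap.map_source (c.mem_source x)))
    exact (contMDiff_fst.contMDiffAt.comp _ this).mdifferentiableAt (by simp)
  have h2 : (fun y => (c.toMap.symm y).1) ∘ c.incl = id := by
    funext y
    exact congrArg Prod.fst (c.toMap.left_inv (c.mem_source y))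
  have h3 := mfderiv_comp x h1 h
  rw [h2, mfderiv_id] at h3
  intro v w hvw
  have h4 := congrArg (fun L => L v) h3
  have h5 := congrArg (fun L => L w) h3
  exact h4.trans ((congrArg _ hvw).trans h5.symm)

variable [IsManifold (𝓡 n) ∞ N] [IsManifold (𝓡∂ (n + 1)) ∞ M]

/-- The restriction of metrics from `M` to `∂M`. -/
def res (c : Collar n N M) (g : RiemMetric (𝓡∂ (n + 1)) M) : RiemMetric (𝓡 n) N :=
  g.pullback c.incl c.contMDiff_incl c.mfderiv_incl_injective

/-- The space `R(M)` of metrics on `M` that are of product form on a collar of the boundary: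
`c^* g = g|_{∂M} + dt²` on `∂M × [0, ε)` for some `ε > 0`. -/
def metrics (c : Collar n N M) : Set (RiemMetric (𝓡∂ (n + 1)) M) :=
  {g | ∃ ε : ℝ, 0 < ε ∧ ∀ q : N × Set.Icc (0 : ℝ) 1, (q.2 : ℝ) < ε →
    pullbackBilin (g.inner (c.toMap q))
      (mfderiv ((𝓡 n).prod (𝓡∂ 1)) (𝓡∂ (n + 1)) c.toMap q) = (c.res g).stab.inner q}

end Collar

/-! ### The Riemannian functor of a sequence of curvature conditions -/

namespace CurvatureConditions

/-- `R_C(N)` for a closed `n`-manifold `N`; it is empty if `n` is less than `dmin`. -/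
def closedMetrics (C : CurvatureConditions) (n : ℕ)
    (N : Type u) [TopologicalSpace N] [ChartedSpace (EuclideanSpace ℝ (Fin n)) N]
    [IsManifold (𝓡 n) ∞ N] : Set (RiemMetric (𝓡 n) N) :=
  {g | C.dmin ≤ n ∧ g.Satisfies (C.cond n)}

/-- `R_C(M)` for an `(n+1)`-manifold `M` with boundary `N` and collar `c`; it is empty if `n + 1`
is less than `dmin`. -/
def collaredMetrics (C : CurvatureConditions) {n : ℕ}
    {N : Type u} [TopologicalSpace N] [ChartedSpace (EuclideanSpace ℝ (Fin n)) N]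
    {M : Type u} [TopologicalSpace M] [ChartedSpace (EuclideanHalfSpace (n + 1)) M]
    [IsManifold (𝓡 n) ∞ N] [IsManifold (𝓡∂ (n + 1)) ∞ M] (c : Collar n N M) :
    Set (RiemMetric (𝓡∂ (n + 1)) M) :=
  {g | g ∈ c.metrics ∧ C.dmin ≤ n + 1 ∧ g.Satisfies (C.cond (n + 1))}

/-- `R_C(N × [0,1])` for a closed `n`-manifold `N`: metrics that satisfy `C_{n+1}` and are of
product form near both ends, for the standard collars of `N × {0}` and `N × {1}`. -/
def cylinderMetrics (C : CurvatureConditions) (n : ℕ)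
    (N : Type u) [TopologicalSpace N] [ChartedSpace (EuclideanSpace ℝ (Fin n)) N]
    [IsManifold (𝓡 n) ∞ N] :
    Set (RiemMetric ((𝓡 n).prod (𝓡∂ 1)) (N × Set.Icc (0 : ℝ) 1)) :=
  {g | (∃ (h₀ h₁ : RiemMetric (𝓡 n) N) (ε : ℝ), 0 < ε ∧ ∀ q : N × Set.Icc (0 : ℝ) 1,
      ((q.2 : ℝ) < ε → g.inner q = h₀.stab.inner q) ∧
      (1 - ε < (q.2 : ℝ) → g.inner q = h₁.stab.inner q)) ∧
    C.dmin ≤ n + 1 ∧ g.Satisfies (C.cond (n + 1))}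

/-- `stab(R_C(N)) ⊆ R_C(N × [0,1])` for all closed manifolds `N`. -/
def StabPreserves (C : CurvatureConditions) : Prop :=
  ∀ (n : ℕ) (N : Type u) [TopologicalSpace N] [ChartedSpace (EuclideanSpace ℝ (Fin n)) N]
    [IsManifold (𝓡 n) ∞ N] [T2Space N] [CompactSpace N],
    ∀ g ∈ C.closedMetrics n N, g.stab ∈ C.cylinderMetrics n N

/-- `res(R_C(M)) ⊆ R_C(∂M)` for all compact manifolds `M` with non-empty boundary. -/
def ResPreserves (C : CurvatureConditions) : Prop :=
  ∀ (n : ℕ)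
    (N : Type u) [TopologicalSpace N] [ChartedSpace (EuclideanSpace ℝ (Fin n)) N]
    [IsManifold (𝓡 n) ∞ N] [T2Space N] [CompactSpace N] [Nonempty N]
    (M : Type u) [TopologicalSpace M] [ChartedSpace (EuclideanHalfSpace (n + 1)) M]
    [IsManifold (𝓡∂ (n + 1)) ∞ M] [T2Space M] [CompactSpace M] (c : Collar n N M),
    Set.MapsTo c.res (C.collaredMetrics c) (C.closedMetrics n N)

end CurvatureConditions

/-- A Serre fibration: a continuous map with the homotopy lifting property for all cubes. -/
def IsSerreFibration {X Y : Type*} [TopologicalSpace X] [TopologicalSpace Y] (p : X → Y) : Prop :=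
  Continuous p ∧ ∀ (k : ℕ) (h : C(Fin k → unitInterval, X))
    (G : C((Fin k → unitInterval) × unitInterval, Y)), (∀ a, G (a, 0) = p (h a)) →
    ∃ L : C((Fin k → unitInterval) × unitInterval, X),
      (∀ a, L (a, 0) = h a) ∧ ∀ z, p (L z) = G z

/-- `R_C` is fibrant: for all compact manifolds `M` with non-empty boundary, `res` maps `R_C(M)` to
`R_C(∂M)`, and `res : R_C(M) → R_C(∂M)` is a Serre fibration. -/
def CurvatureConditions.Fibrant (C : CurvatureConditions) : Prop :=
  ∀ (n : ℕ)
    (N : Type u) [TopologicalSpace N] [ChartedSpace (EuclideanSpace ℝ (Fin n)) N]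
    [IsManifold (𝓡 n) ∞ N] [T2Space N] [CompactSpace N] [Nonempty N]
    (M : Type u) [TopologicalSpace M] [ChartedSpace (EuclideanHalfSpace (n + 1)) M]
    [IsManifold (𝓡∂ (n + 1)) ∞ M] [T2Space M] [CompactSpace M] (c : Collar n N M),
    ∃ h : Set.MapsTo c.res (C.collaredMetrics c) (C.closedMetrics n N),
      IsSerreFibration h.restrict

end

/-! The heart of the matter is to change the boundary value `b₀` of a metric `g` in R_C(M) to a
nearby `b`, where the meaning of "nearby" must not depend on `g`. Glue a cylinder N × [-1/2, 0] with
the metric b₀ + dt² to the boundary, and replace it there by b₀ + χ(t)(b - b₀) + dt², with a cut-off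
χ that is 0 near t = 0 and 1 near t = -1/2. The metric b₀ + dt² satisfies the condition because
stabilization preserves it. The condition is open and only sees 2-jets, so the modified cylinder
satisfies it as soon as `b` is close to `b₀`. How close depends on the boundary metrics alone, not
on `g` or on the width of its product collar (`eventually_cylinder_add_blend_goodAt`). Stretching
the collar identifies M with M plus the cylinder and transports the result to a metric on M
(`Collar.deform`).

A lift must moreover start at the given metrics, which are not stretched, so the amount of
stretching is a parameter `s` running from 0 to 1. For s < 1 the cut-off region may reach into M,
where nothing is known about `g`. But for b = b₀ the cut-off term vanishes and every stretched
metric satisfies the condition. By openness and compactness there is a time t₀, depending on the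
initial metrics, before which all `s` are allowed (`Collar.eventually_deform_goodAt`). So `s` is
driven from 0 to 1 within time t₀ / 2, and the uniform estimate takes over afterwards
(`exists_short_lift`). The resulting lifts exist over time intervals of a length that depends only
on the homotopy in the base, hence finitely many of them cover [0, 1]
(`exists_lift_of_short_lifts`).

Two analytic facts support this. A map into the space of metrics is continuous exactly if all chart
derivatives are jointly continuous in the parameter and the point
(`RiemMetric.smoothFamAt_of_continuous`, `RiemMetric.continuous_of_smoothFamAt`). And gluing on the
cylinder is continuous in `g`, although the width of the product collar need not be bounded below in
a family: the difference of `g` and its product model vanishes to infinite order at the boundary, so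
its extension by zero is still a continuous family (`FamCk.extend_zero`,
`smoothFamAt_extTensor_zero`). Openness and naturality of the condition are proved for 2-jets
(`GoodJet.eventually`, `jetCurvature_pullback`). -/

/-! ### Continuous families of `C^k` functions -/

set_option linter.unusedSectionVars false
set_option maxSynthPendingDepth 3

section Families

open Set Filter

variable {P : Type*} [TopologicalSpace P] {E : Type} [NormedAddCommGroup E] [NormedSpace ℝ E]

/-- The family `p ↦ F p` of functions on `S` is, near the point `z` of `P × S`, a continuous family
of `C^k` functions: all derivatives up to order `k` are jointly continuous. -/
def FamCk (S : Set E) : ℕ → ∀ {V : Type} [NormedAddCommGroup V] [NormedSpace ℝ V],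
    (P → E → V) → P × E → Prop
  | 0, _, _, _, F, z => ContinuousWithinAt (fun z : P × E => F z.1 z.2) (univ ×ˢ S) z
  | k + 1, _, _, _, F, z => ContinuousWithinAt (fun z : P × E => F z.1 z.2) (univ ×ˢ S) z ∧
      (∀ᶠ z' in 𝓝[univ ×ˢ S] z, DifferentiableWithinAt ℝ (F z'.1) S z'.2) ∧
      FamCk S k (fun p y => fderivWithin ℝ (F p) S y) z

/-- A continuous family of smooth functions near `z`. -/
def FamSmooth (S : Set E) {V : Type} [NormedAddCommGroup V] [NormedSpace ℝ V]
    (F : P → E → V) (z : P × E) : Prop := ∀ k, FamCk S k F z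

variable {V W X : Type} [NormedAddCommGroup V] [NormedSpace ℝ V]
  [NormedAddCommGroup W] [NormedSpace ℝ W] [NormedAddCommGroup X] [NormedSpace ℝ X]
  {S : Set E} {z : P × E} {k : ℕ} {F F' : P → E → V}

theorem FamCk.continuousWithinAt (h : FamCk S k F z) :
    ContinuousWithinAt (fun z : P × E => F z.1 z.2) (univ ×ˢ S) z := by
  cases k with
  | zero => exact h
  | succ k => exact h.1

theorem FamCk.of_succ (h : FamCk S (k + 1) F z) : FamCk S k F z := by
  induction k generalizing V with
  | zero => exact h.1
  | succ k ih => exact ⟨h.1, h.2.1, ih h.2.2⟩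

theorem FamSmooth.fderivWithin (h : FamSmooth S F z) :
    FamSmooth S (fun p y => fderivWithin ℝ (F p) S y) z := fun k => (h (k + 1)).2.2

/-- This is what allows an identity that holds near `z` to be differentiated in the fibre direction,
with the parameter fixed, at every nearby point. -/
theorem eventually_nhdsWithin_fiber {q : P × E → Prop} {z : P × E}
    (h : ∀ᶠ z' in 𝓝[univ ×ˢ S] z, q z') :
    ∀ᶠ z' in 𝓝[univ ×ˢ S] z, ∀ᶠ y in 𝓝[S] z'.2, q (z'.1, y) := by
  filter_upwards [eventually_eventually_nhdsWithin.2 h] with z' hz'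
  have hc : Tendsto (fun y => (z'.1, y)) (𝓝[S] z'.2) (𝓝[univ ×ˢ S] z') := by
    refine tendsto_nhdsWithin_iff.2 ⟨?_, ?_⟩
    · exact ((Continuous.prodMk_right z'.1).tendsto z'.2).mono_left nhdsWithin_le_nhds
    · filter_upwards [self_mem_nhdsWithin] with y hy
      exact ⟨mem_univ _, hy⟩
  exact hc.eventually hz'

theorem eventually_mem_fiber (z : P × E) : ∀ᶠ z' in 𝓝[(univ : Set P) ×ˢ S] z, z'.2 ∈ S := by
  filter_upwards [self_mem_nhdsWithin] with z' hz'
  exact hz'.2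

theorem mem_prod_of_snd (hz : z.2 ∈ S) : z ∈ (univ : Set P) ×ˢ S := ⟨mem_univ _, hz⟩

theorem FamCk.congr (h : FamCk S k F z) (hz : z.2 ∈ S)
    (he : ∀ᶠ z' in 𝓝[univ ×ˢ S] z, F' z'.1 z'.2 = F z'.1 z'.2) : FamCk S k F' z := by
  induction k generalizing V with
  | zero =>
    exact ContinuousWithinAt.congr_of_eventuallyEq (f := fun z : P × E => F z.1 z.2) h he
      (he.self_of_nhdsWithin (mem_prod_of_snd hz))
  | succ k ih =>
    refine ⟨ContinuousWithinAt.congr_of_eventuallyEq (f := fun z : P × E => F z.1 z.2) h.1 he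
      (he.self_of_nhdsWithin (mem_prod_of_snd hz)), ?_, ?_⟩
    · filter_upwards [h.2.1, eventually_nhdsWithin_fiber he, eventually_mem_fiber z] with z' h1 h2 h3
      exact h1.congr_of_eventuallyEq h2 (h2.self_of_nhdsWithin h3)
    · refine ih h.2.2 ?_
      filter_upwards [eventually_nhdsWithin_fiber he, eventually_mem_fiber z] with z' h2 h3
      exact Filter.EventuallyEq.fderivWithin_eq h2 (h2.self_of_nhdsWithin h3)

theorem FamSmooth.congr (h : FamSmooth S F z) (hz : z.2 ∈ S)
    (he : ∀ᶠ z' in 𝓝[univ ×ˢ S] z, F' z'.1 z'.2 = F z'.1 z'.2) : FamSmooth S F' z :=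
  fun k => (h k).congr hz he

theorem FamCk.add (hS : UniqueDiffOn ℝ S) (hz : z.2 ∈ S) (h : FamCk S k F z)
    (h' : FamCk S k F' z) : FamCk S k (fun p y => F p y + F' p y) z := by
  induction k generalizing V with
  | zero => exact ContinuousWithinAt.add h h'
  | succ k ih =>
    refine ⟨ContinuousWithinAt.add h.1 h'.1, ?_, ?_⟩
    · filter_upwards [h.2.1, h'.2.1] with z' h1 h2
      exact h1.add h2
    · refine (ih h.2.2 h'.2.2).congr hz ?_
      filter_upwards [h.2.1, h'.2.1, eventually_mem_fiber z] with z' h1 h2 h3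
      exact fderivWithin_fun_add (hS _ h3) h1 h2

/-- By the Leibniz rule the derivative is a sum of two bilinear expressions, formed with `B.precompR
E` and `B.precompL E`; hence the induction is over all target spaces at once. -/
theorem FamCk.bilin (hS : UniqueDiffOn ℝ S) (hz : z.2 ∈ S) (B : V →L[ℝ] W →L[ℝ] X)
    {G : P → E → W} (h : FamCk S k F z) (h' : FamCk S k G z) :
    FamCk S k (fun p y => B (F p y) (G p y)) z := by
  induction k generalizing V W X with
  | zero => exact (B.isBoundedBilinearMap.continuous.tendsto (_, _)).comp (h.prodMk_nhds h')
  | succ k ih =>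
    refine ⟨(B.isBoundedBilinearMap.continuous.tendsto (_, _)).comp (h.1.prodMk_nhds h'.1), ?_, ?_⟩
    · filter_upwards [h.2.1, h'.2.1] with z' h1 h2
      exact (B.hasFDerivWithinAt_of_bilinear h1.hasFDerivWithinAt
        h2.hasFDerivWithinAt).differentiableWithinAt
    · refine (FamCk.add hS hz (ih (B.precompR E) h.of_succ h'.2.2)
        (ih (B.precompL E) h.2.2 h'.of_succ)).congr hz ?_
      filter_upwards [h.2.1, h'.2.1, eventually_mem_fiber z] with z' h1 h2 h3
      exact B.fderivWithin_of_bilinear h1 h2 (hS _ h3)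

theorem FamCk.of_param {σ : P → V} (hσ : ContinuousAt σ z.1) (hz : z.2 ∈ S) :
    FamCk S k (fun p _ => σ p) z := by
  have h0 : ContinuousWithinAt (fun z : P × E => σ z.1) (univ ×ˢ S) z :=
    (ContinuousAt.comp (f := Prod.fst) (x := z) hσ continuousAt_fst).continuousWithinAt
  have hc : ∀ (k : ℕ) {V : Type} [NormedAddCommGroup V] [NormedSpace ℝ V],
      FamCk S k (fun (_ : P) (_ : E) => (0 : V)) z := by
    intro k
    induction k with
    | zero => intro V _ _; exact continuousWithinAt_const
    | succ k ih =>
      intro V _ _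
      refine ⟨continuousWithinAt_const, .of_forall fun _ => differentiableWithinAt_const _,
        (ih (V := E →L[ℝ] V)).congr hz (.of_forall fun _ => ?_)⟩
      simp
  cases k with
  | zero => exact h0
  | succ k =>
    refine ⟨h0, .of_forall fun _ => differentiableWithinAt_const _,
        (hc k (V := E →L[ℝ] V)).congr hz (.of_forall fun _ => ?_)⟩
    simp

theorem FamCk.clm (hS : UniqueDiffOn ℝ S) (hz : z.2 ∈ S) (A : V →L[ℝ] W)
    (h : FamCk S k F z) : FamCk S k (fun p y => A (F p y)) z :=
  FamCk.bilin hS hz (ContinuousLinearMap.id ℝ (V →L[ℝ] W))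
    (FamCk.of_param (σ := fun _ => A) continuousAt_const hz) h

theorem FamCk.of_contDiffWithinAt (hS : UniqueDiffOn ℝ S) (hz : z.2 ∈ S) {f : E → V}
    (h : ContDiffWithinAt ℝ k f S z.2) : FamCk S k (fun (_ : P) => f) z := by
  have h0 : ContinuousWithinAt (fun z : P × E => f z.2) (univ ×ˢ S) z :=
    h.continuousWithinAt.comp continuousWithinAt_snd fun z hz => hz.2
  have htend : Tendsto Prod.snd (𝓝[(univ : Set P) ×ˢ S] z) (𝓝[S] z.2) :=
    continuousWithinAt_snd.tendsto_nhdsWithin fun z hz => hz.2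
  induction k generalizing V with
  | zero => exact h0
  | succ k ih =>
    have hd : ContDiffWithinAt ℝ k (fderivWithin ℝ f S) S z.2 :=
      h.fderivWithin_right hS (by norm_cast) hz
    refine ⟨h0, ?_, ih hd (hd.continuousWithinAt.comp continuousWithinAt_snd fun z hz => hz.2)⟩
    have h1 : ∀ᶠ y in 𝓝[S] z.2, DifferentiableWithinAt ℝ f S y := by
      obtain ⟨u, hu, -, hd⟩ := (contDiffWithinAt_succ_iff_hasFDerivWithinAt' (n := (k : ℕ∞ω))
        (by simp)).1 (by exact_mod_cast h)
      obtain ⟨-, f', hf', -⟩ := hd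
      rw [insert_eq_of_mem hz] at hu
      filter_upwards [hu] with y hy
      exact (hf' y hy).differentiableWithinAt
    exact htend.eventually h1

theorem FamSmooth.of_contDiffWithinAt (hS : UniqueDiffOn ℝ S) (hz : z.2 ∈ S) {f : E → V}
    (h : ContDiffWithinAt ℝ ∞ f S z.2) : FamSmooth S (fun (_ : P) => f) z :=
  fun k => FamCk.of_contDiffWithinAt hS hz (h.of_le (by exact_mod_cast le_top))

theorem FamSmooth.contDiffWithinAt (h : FamSmooth S F z) (hz : z.2 ∈ S) :
    ContDiffWithinAt ℝ ∞ (F z.1) S z.2 := by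
  -- One order is lost: `FamCk` of order 0 is continuity at a single point, whereas
  -- `ContDiffWithinAt` of order 0 needs continuity nearby, which comes from the differentiability
  -- in order 1.
  have key : ∀ (k : ℕ) {V : Type} [NormedAddCommGroup V] [NormedSpace ℝ V] {F : P → E → V},
      FamCk S (k + 1) F z → ContDiffWithinAt ℝ k (F z.1) S z.2 := by
    have hev : ∀ {V : Type} [NormedAddCommGroup V] [NormedSpace ℝ V] {F : P → E → V} (k : ℕ),
        FamCk S (k + 1) F z → {y | y ∈ S ∧ DifferentiableWithinAt ℝ (F z.1) S y} ∈ 𝓝[S] z.2 := by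
      intro V _ _ F k hF
      have := (eventually_nhdsWithin_fiber hF.2.1).self_of_nhdsWithin (mem_prod_of_snd hz)
      filter_upwards [this, self_mem_nhdsWithin] with y h1 h2
      exact ⟨h2, h1⟩
    intro k
    induction k with
    | zero =>
      intro V _ _ F hF
      refine contDiffWithinAt_zero hz |>.2 ⟨_, hev _ hF, fun y hy => ?_⟩
      exact hy.2.2.continuousWithinAt.mono inter_subset_left
    | succ k ih =>
      intro V _ _ F hF
      have := (contDiffWithinAt_succ_iff_hasFDerivWithinAt' (n := (k : ℕ∞ω)) (f := F z.1)
        (s := S) (x := z.2) (by simp)).2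
        ⟨_, by rw [insert_eq_of_mem hz]; exact hev _ hF,
          by rw [insert_eq_of_mem hz]; exact fun y (hy : _ ∧ _) => hy.1, by simp, _root_.fderivWithin ℝ (F z.1) S,
          fun y hy => DifferentiableWithinAt.hasFDerivWithinAt (And.right hy), ih hF.2.2⟩
      exact_mod_cast this
  exact contDiffWithinAt_infty.2 fun k => key k (h (k + 1))

/-- Composition of families. -/
theorem FamCk.comp {E' : Type} [NormedAddCommGroup E'] [NormedSpace ℝ E'] {S' : Set E'}
    (hS' : UniqueDiffOn ℝ S') {z : P × E'} (hz : z.2 ∈ S')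
    {φ : P → E' → E} (hφ : FamCk S' k φ z)
    (hmaps : ∀ᶠ z' in 𝓝[univ ×ˢ S'] z, φ z'.1 z'.2 ∈ S)
    (h : FamCk S k F (z.1, φ z.1 z.2)) : FamCk S' k (fun p y => F p (φ p y)) z := by
  have htend : Tendsto (fun z' : P × E' => (z'.1, φ z'.1 z'.2)) (𝓝[univ ×ˢ S'] z)
      (𝓝[univ ×ˢ S] (z.1, φ z.1 z.2)) := by
    refine tendsto_nhdsWithin_iff.2 ⟨?_, ?_⟩
    · exact (continuousWithinAt_fst.prodMk hφ.continuousWithinAt)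
    · filter_upwards [hmaps] with z' hz'
      exact ⟨mem_univ _, hz'⟩
  have hc : ContinuousWithinAt (fun z : P × E' => F z.1 (φ z.1 z.2)) (univ ×ˢ S') z :=
    h.continuousWithinAt.tendsto.comp htend
  have hmem : φ z.1 z.2 ∈ S := hmaps.self_of_nhdsWithin (mem_prod_of_snd hz)
  induction k generalizing V with
  | zero => exact hc
  | succ k ih =>
    have hD : ∀ᶠ z' in 𝓝[univ ×ˢ S'] z, HasFDerivWithinAt (fun y => F z'.1 (φ z'.1 y))
        ((fderivWithin ℝ (F z'.1) S (φ z'.1 z'.2)).comp (fderivWithin ℝ (φ z'.1) S' z'.2))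
        S' z'.2 := by
      filter_upwards [htend.eventually h.2.1, hφ.2.1, eventually_nhdsWithin_fiber hmaps]
        with z' h1 h2 h3
      exact h1.hasFDerivWithinAt.comp_of_tendsto _ h2.hasFDerivWithinAt
        (tendsto_nhdsWithin_iff.2 ⟨h2.continuousWithinAt, h3⟩)
    refine ⟨hc, hD.mono fun _ h => h.differentiableWithinAt, ?_⟩
    have h1 := ih hφ.of_succ h.2.2 (h.2.2.continuousWithinAt.tendsto.comp htend)
    refine (FamCk.bilin hS' hz (ContinuousLinearMap.compL ℝ E' E V) h1 hφ.2.2).congr hz ?_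
    filter_upwards [hD, eventually_mem_fiber z] with z' h1 h2
    exact h1.fderivWithin (hS' _ h2)

/-- Reparametrization of families. -/
theorem FamCk.reparam {Q : Type*} [TopologicalSpace Q] {u : Q → P} {z : Q × E}
    (hu : ContinuousAt u z.1) (h : FamCk S k F (u z.1, z.2)) :
    FamCk S k (fun q => F (u q)) z := by
  have htend : Tendsto (fun z' : Q × E => (u z'.1, z'.2)) (𝓝[univ ×ˢ S] z)
      (𝓝[univ ×ˢ S] (u z.1, z.2)) := by
    refine tendsto_nhdsWithin_iff.2 ⟨?_, ?_⟩
    · exact (ContinuousAt.comp (f := Prod.fst) (x := z) hu continuousAt_fst).continuousWithinAt.prodMk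
        continuousWithinAt_snd
    · filter_upwards [self_mem_nhdsWithin] with z' hz'
      exact ⟨mem_univ _, hz'.2⟩
  induction k generalizing V with
  | zero => exact Tendsto.comp h htend
  | succ k ih => exact ⟨h.1.tendsto.comp htend, htend.eventually h.2.1, ih h.2.2⟩

/-- At a frontier point the limit from inside `O` is the value of `F` there, which is zero, and the
limit from outside is zero as well. Joint continuity of `F` on the larger set is what makes the
first limit uniform in the parameter. -/
theorem continuousWithinAt_extend_zero {O : Set E} [DecidablePred (· ∈ O)] (hO : IsOpen O)
    (hOS : O ⊆ S) (hz : z.2 ∈ closure O)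
    (hvan : z.2 ∈ frontier O → F z.1 z.2 = 0)
    (hF : ContinuousWithinAt (fun z : P × E => F z.1 z.2) (univ ×ˢ S) z) :
    ContinuousWithinAt (fun z : P × E => if z.2 ∈ O then F z.1 z.2 else 0) (univ ×ˢ univ) z := by
  rw [univ_prod_univ, continuousWithinAt_univ]
  by_cases hzO : z.2 ∈ O
  · have hn : univ ×ˢ S ∈ 𝓝 z :=
      mem_of_superset ((hO.preimage continuous_snd).mem_nhds hzO) fun z' h => ⟨trivial, hOS h⟩
    refine (hF.continuousAt hn).congr ?_
    filter_upwards [(hO.preimage continuous_snd).mem_nhds hzO] with z' h1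
    exact (if_pos h1).symm
  · have hfr : z.2 ∈ frontier O := ⟨hz, fun h => hzO (interior_subset h)⟩
    have h0 : F z.1 z.2 = 0 := hvan hfr
    have hF' : Tendsto (fun z : P × E => F z.1 z.2) (𝓝[univ ×ˢ S] z) (𝓝 0) := by
      have := hF.tendsto; rwa [h0] at this
    have h2 : Tendsto (fun z : P × E => if z.2 ∈ O then F z.1 z.2 else 0)
        (𝓝[univ ×ˢ O] z ⊔ 𝓝[(univ ×ˢ O)ᶜ] z) (𝓝 0) := by
      refine Tendsto.sup ?_ ?_
      · refine (hF'.mono_left (nhdsWithin_mono _ (prod_mono le_rfl hOS))).congr' ?_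
        filter_upwards [self_mem_nhdsWithin] with z' h1
        exact (if_pos h1.2).symm
      · refine tendsto_const_nhds.congr' ?_
        filter_upwards [self_mem_nhdsWithin] with z' h1
        exact (if_neg fun h => h1 ⟨trivial, h⟩).symm
    rw [← nhdsWithin_union, union_compl_self, nhdsWithin_univ] at h2
    show Tendsto _ _ _
    simpa [hzO] using h2

/-- If every member of a family on a set `S` vanishes near the part of `S` outside of `O`, then
its extension by zero from `S ∩ O` is a continuous family of `C^k` functions on the whole space. -/
theorem FamCk.extend_zero {O : Set E} [DecidablePred (· ∈ O)] (hO : IsOpen O) (hOS : O ⊆ S)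
    (hcl : closure O ⊆ S) (h : FamCk S k F z) (hz : z.2 ∈ closure O)
    (hvan : ∀ᶠ z' in 𝓝 z, z'.2 ∈ frontier O → ∀ᶠ y in 𝓝[S] z'.2, F z'.1 y = 0) :
    FamCk univ k (fun p y => if y ∈ O then F p y else 0) z := by
  have hnotin : ∀ y, y ∉ closure O → ∀ᶠ y' in 𝓝 y, y' ∉ O := fun y hy => by
    filter_upwards [isClosed_closure.isOpen_compl.mem_nhds hy] with y' h1 h2
    exact h1 (subset_closure h2)
  induction k generalizing V with
  | zero =>
    exact continuousWithinAt_extend_zero hO hOS hz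
      (fun hfr => (hvan.self_of_nhds hfr).self_of_nhdsWithin (hcl hz)) h
  | succ k ih =>
    -- At a frontier point the extension vanishes on a whole neighbourhood, inside `O` by `hvan` and
    -- outside by construction, so it has derivative zero. The neighbourhood may shrink arbitrarily
    -- as the parameter varies.
    have hD : ∀ᶠ z' in 𝓝 z, HasFDerivAt (fun y => if y ∈ O then F z'.1 y else 0)
        (if z'.2 ∈ O then fderivWithin ℝ (F z'.1) S z'.2 else 0) z'.2 := by
      have h1 := eventually_nhdsWithin_iff.1 h.2.1
      filter_upwards [h1, hvan] with z' h1 h2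
      by_cases hzO : z'.2 ∈ O
      · rw [if_pos hzO]
        have hn : S ∈ 𝓝 z'.2 := mem_of_superset (hO.mem_nhds hzO) hOS
        refine ((h1 ⟨trivial, hOS hzO⟩).hasFDerivWithinAt.hasFDerivAt hn).congr_of_eventuallyEq ?_
        filter_upwards [hO.mem_nhds hzO] with y hy
        exact if_pos hy
      · rw [if_neg hzO]
        refine (hasFDerivAt_const (0 : V) z'.2).congr_of_eventuallyEq ?_
        by_cases hcO : z'.2 ∈ closure O
        · have h3 := h2 ⟨hcO, fun h => hzO (interior_subset h)⟩
          filter_upwards [eventually_nhdsWithin_iff.1 h3] with y hy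
          split_ifs with hyO
          · exact hy (hOS hyO)
          · rfl
        · filter_upwards [hnotin _ hcO] with y hy
          exact if_neg hy
    refine ⟨continuousWithinAt_extend_zero hO hOS hz
      (fun hfr => (hvan.self_of_nhds hfr).self_of_nhdsWithin (hcl hz)) h.1, ?_, ?_⟩
    · exact (hD.mono fun z' h => h.differentiableAt.differentiableWithinAt).filter_mono
        nhdsWithin_le_nhds
    -- Vanishing near a frontier point is inherited by the derivative, so the induction hypothesis
    -- applies to it.
    · have hv' : ∀ᶠ z' in 𝓝 z, z'.2 ∈ frontier O →
          ∀ᶠ y in 𝓝[S] z'.2, fderivWithin ℝ (F z'.1) S y = 0 := by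
        filter_upwards [hvan] with z' h1 h2
        filter_upwards [eventually_eventually_nhdsWithin.2 (h1 h2), self_mem_nhdsWithin]
          with y h3 h4
        have h5 : F z'.1 =ᶠ[𝓝[S] y] fun _ => 0 := h3
        rw [h5.fderivWithin_eq (h3.self_of_nhdsWithin h4)]
        simp
      refine (ih h.2.2 hv').congr (mem_univ _) ?_
      rw [univ_prod_univ, nhdsWithin_univ]
      filter_upwards [hD] with z' h1
      rw [fderivWithin_univ]
      exact h1.fderiv

/-- The topology on metrics is phrased with iterated derivatives, `FamCk` with derivatives of
derivatives; the recursion that splits off the innermost derivative translates between them. -/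
theorem FamCk.iteratedFDerivWithin (hS : UniqueDiffOn ℝ S) (hz : z.2 ∈ S) (h : FamCk S k F z) :
    ContinuousWithinAt (fun z : P × E => iteratedFDerivWithin ℝ k (F z.1) S z.2)
      (univ ×ˢ S) z := by
  induction k generalizing V with
  | zero =>
    simp only [iteratedFDerivWithin_zero_eq_comp]
    exact (LinearIsometryEquiv.continuous _).continuousAt.comp_continuousWithinAt h
  | succ k ih =>
    have h1 := (continuousMultilinearCurryRightEquiv' ℝ k E V).symm.continuous.continuousAt
      |>.comp_continuousWithinAt (ih h.2.2)
    refine h1.congr (fun z' hz' => ?_) ?_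
    · exact iteratedFDerivWithin_succ_eq_comp_right hS hz'.2
    · exact iteratedFDerivWithin_succ_eq_comp_right hS hz

/-- Smoothness of the members is a separate hypothesis because continuity of the iterated
derivatives does not imply it: they take the value zero where a derivative does not exist. -/
theorem FamSmooth.of_iteratedFDerivWithin (hS : UniqueDiffOn ℝ S) (hz : z.2 ∈ S)
    (hd : ∀ᶠ z' in 𝓝[univ ×ˢ S] z, ContDiffWithinAt ℝ ∞ (F z'.1) S z'.2)
    (h : ∀ k, ContinuousWithinAt (fun z : P × E => iteratedFDerivWithin ℝ k (F z.1) S z.2)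
      (univ ×ˢ S) z) : FamSmooth S F z := by
  intro k
  have h0 : ∀ {V : Type} [NormedAddCommGroup V] [NormedSpace ℝ V] {F : P → E → V},
      ContinuousWithinAt (fun z : P × E => iteratedFDerivWithin ℝ 0 (F z.1) S z.2)
        (univ ×ˢ S) z → ContinuousWithinAt (fun z : P × E => F z.1 z.2) (univ ×ˢ S) z := by
    intro V _ _ F h
    simp only [iteratedFDerivWithin_zero_eq_comp] at h
    have := (continuousMultilinearCurryFin0 ℝ E V).continuous.continuousAt
      |>.comp_continuousWithinAt h
    simpa [Function.comp_def] using this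
  induction k generalizing V with
  | zero => exact h0 (h 0)
  | succ k ih =>
    refine ⟨h0 (h 0), hd.mono fun z' h => h.differentiableWithinAt (by simp), ih ?_ fun k => ?_⟩
    · filter_upwards [hd, eventually_mem_fiber z] with z' h1 h2
      exact h1.fderivWithin_right hS (by simp) h2
    · have h1 := (continuousMultilinearCurryRightEquiv' ℝ k E V).continuous.continuousAt
        |>.comp_continuousWithinAt (h (k + 1))
      refine h1.congr (fun z' hz' => ?_) ?_
      · simp only [Function.comp_apply, iteratedFDerivWithin_succ_eq_comp_right hS hz'.2,
          LinearIsometryEquiv.apply_symm_apply]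
      · simp only [Function.comp_apply, iteratedFDerivWithin_succ_eq_comp_right hS hz,
          LinearIsometryEquiv.apply_symm_apply]

end Families

noncomputable section

/-! ### The curvature tensor in terms of the 2-jet of a metric -/

section JetCurvature

open Set Filter

variable {E : Type} [NormedAddCommGroup E] [NormedSpace ℝ E]
  {E' : Type} [NormedAddCommGroup E'] [NormedSpace ℝ E']

/-- The Christoffel symbols of a metric with value `G` and first derivative `A`. -/
def jetChristoffel (G : E →L[ℝ] E →L[ℝ] ℝ) (A : E →L[ℝ] E →L[ℝ] E →L[ℝ] ℝ) (u v : E) : E :=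
  G.inverse ((1 / 2 : ℝ) • (A u v + A v u - (A.flip u).flip v))

/-- The curvature tensor of a metric with value `G`, first derivative `A` and second
derivative `B`. -/
def jetCurvature (G : E →L[ℝ] E →L[ℝ] ℝ) (A : E →L[ℝ] E →L[ℝ] E →L[ℝ] ℝ)
    (B : E →L[ℝ] E →L[ℝ] E →L[ℝ] E →L[ℝ] ℝ) (u v w z : E) : ℝ :=
  1 / 2 * (B u z v w - B u w v z - B v z u w + B v w u z)
    + G (jetChristoffel G A u z) (jetChristoffel G A v w)
    - G (jetChristoffel G A v z) (jetChristoffel G A u w)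

theorem isInvertible_of_pos [FiniteDimensional ℝ E] {G : E →L[ℝ] E →L[ℝ] ℝ}
    (hpos : ∀ v, v ≠ 0 → 0 < G v v) : G.IsInvertible := by
  have hinj : Function.Injective (G : E →ₗ[ℝ] E →L[ℝ] ℝ) := by
    rw [← LinearMap.ker_eq_bot, LinearMap.ker_eq_bot']
    intro v hv
    by_contra h
    have h1 := hpos v h
    have h2 : G v v = 0 := by
      have : G v = 0 := hv
      rw [this]; rfl
    exact h1.ne' h2
  have hd : Module.finrank ℝ E = Module.finrank ℝ (E →L[ℝ] ℝ) := by
    have h1 := (LinearMap.toContinuousLinearMap (𝕜 := ℝ) (E := E) (F' := ℝ)).finrank_eq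
    rw [← h1]
    exact (Subspace.dual_finrank_eq (K := ℝ) (V := E)).symm
  exact ⟨(LinearEquiv.ofInjectiveOfFinrankEq (G : E →ₗ[ℝ] E →L[ℝ] ℝ) hinj hd).toContinuousLinearEquiv, by
    ext; rfl⟩

theorem apply_inverse_of_isInvertible {F F' : Type} [NormedAddCommGroup F] [NormedSpace ℝ F]
    [NormedAddCommGroup F'] [NormedSpace ℝ F'] {G : F →L[ℝ] F'} (h : G.IsInvertible) (x : F') :
    G (G.inverse x) = x := by
  obtain ⟨e, rfl⟩ := h
  simp

theorem jetChristoffel_apply {G : E →L[ℝ] E →L[ℝ] ℝ} (hG : G.IsInvertible)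
    (A : E →L[ℝ] E →L[ℝ] E →L[ℝ] ℝ) (u v w : E) :
    G (jetChristoffel G A u v) w = 1 / 2 * (A u v w + A v u w - A w u v) := by
  rw [jetChristoffel, apply_inverse_of_isInvertible hG]
  simp [ContinuousLinearMap.flip_apply]

/-- The curvature tensor of a 2-jet has the symmetries of an algebraic curvature operator. -/
theorem jetCurvature_mem {d : ℕ} {G : E →L[ℝ] E →L[ℝ] ℝ} {A : E →L[ℝ] E →L[ℝ] E →L[ℝ] ℝ}
    {B : E →L[ℝ] E →L[ℝ] E →L[ℝ] E →L[ℝ] ℝ} (hG : ∀ u v, G u v = G v u)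
    (hA : ∀ a u v, A a u v = A a v u) (hB : ∀ a b u v, B a b u v = B a b v u)
    (hB' : ∀ a b, B a b = B b a) (b : Fin d → E) :
    (fun i j k l => jetCurvature G A B (b i) (b j) (b k) (b l)) ∈ AlgCurvOp d := by
  have hΓ : ∀ u v, jetChristoffel G A u v = jetChristoffel G A v u := fun u v => by
    unfold jetChristoffel
    congr 2
    ext w
    simp [ContinuousLinearMap.flip_apply, hA w u v]
    ring
  have hB2 : ∀ a b u v, B a b u v = B b a u v := fun a b u v => by rw [hB']
  refine ⟨fun i j k l => ?_, fun i j k l => ?_, fun i j k l => ?_, fun i j k l => ?_⟩ <;>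
    simp only [jetCurvature]
  · ring
  · linarith [hG (jetChristoffel G A (b i) (b k)) (jetChristoffel G A (b j) (b l)),
      hG (jetChristoffel G A (b j) (b k)) (jetChristoffel G A (b i) (b l))]
  · rw [hΓ (b k) (b j), hΓ (b l) (b i), hΓ (b l) (b j), hΓ (b k) (b i),
      hG (jetChristoffel G A (b j) (b k))]
    linarith [hB (b k) (b j) (b l) (b i), hB2 (b k) (b j) (b l) (b i), hB (b j) (b k) (b l) (b i),
      hB2 (b k) (b i) (b l) (b j), hB (b i) (b k) (b l) (b j), hB2 (b l) (b j) (b k) (b i),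
      hB (b j) (b l) (b k) (b i), hB2 (b l) (b i) (b k) (b j), hB (b i) (b l) (b k) (b j)]
  · rw [hΓ (b k) (b j), hΓ (b k) (b i), hΓ (b j) (b i)]
    linarith [hB2 (b k) (b j) (b i) (b l), hB2 (b k) (b i) (b j) (b l),
      hB2 (b i) (b j) (b k) (b l), hB (b i) (b l) (b j) (b k), hB (b j) (b l) (b i) (b k),
      hB (b k) (b l) (b i) (b j),
      hG (jetChristoffel G A (b i) (b j)) (jetChristoffel G A (b k) (b l)),
      hG (jetChristoffel G A (b i) (b k)) (jetChristoffel G A (b j) (b l)),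
      hG (jetChristoffel G A (b j) (b k)) (jetChristoffel G A (b i) (b l))]

/-- The curvature tensor in the definition of `RiemMetric.riemann` is that of the 2-jet. -/
theorem curvatureEndo_eq_jetCurvature [FiniteDimensional ℝ E] {S : Set E}
    (hS : UniqueDiffOn ℝ S) {F : E → E →L[ℝ] E →L[ℝ] ℝ} {y : E} (hy : y ∈ S)
    (hyc : y ∈ closure (interior S)) (hF : ContDiffWithinAt ℝ ∞ F S y)
    (hsymm : ∀ᶠ x in 𝓝[S] y, ∀ u v, F x u v = F x v u)
    (hpos : ∀ v, v ≠ 0 → 0 < F y v v) (u v w z : E) :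
    F y (curvatureEndo S F y u v z) w =
      jetCurvature (F y) (fderivWithin ℝ F S y) (fderivWithin ℝ (fderivWithin ℝ F S) S y)
        u v w z := by
  have hinv := isInvertible_of_pos hpos
  have hF0 : DifferentiableWithinAt ℝ F S y := hF.differentiableWithinAt (by simp)
  have hF1 : ContDiffWithinAt ℝ ∞ (fderivWithin ℝ F S) S y :=
    hF.fderivWithin_right hS (by simp) hy
  have hF1' : DifferentiableWithinAt ℝ (fderivWithin ℝ F S) S y :=
    hF1.differentiableWithinAt (by simp)
  set A := fderivWithin ℝ F S y with hA
  set B := fderivWithin ℝ (fderivWithin ℝ F S) S y with hB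
  -- symmetries
  have hBs : ∀ a b, B a b = B b a := fun a b =>
    (hF.isSymmSndFDerivWithinAt (by simpa using ENat.LEInfty.out) hS hyc hy) a b
  have hGs : ∀ u v, F y u v = F y v u := hsymm.self_of_nhdsWithin hy
  -- invertibility nearby
  have hinv' : ∀ᶠ x in 𝓝[S] y, (F x).IsInvertible := by
    obtain ⟨e, he⟩ := hinv
    have h1 : ∀ᶠ G in 𝓝 (F y), G.IsInvertible := by
      rw [← he]
      filter_upwards [ContinuousLinearEquiv.nhds e] with G hG
      obtain ⟨e', rfl⟩ := hG
      exact ⟨e', rfl⟩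
    exact hF.continuousWithinAt.eventually h1
  -- The derivative of the inverse of `F` is avoided by differentiating the Koszul identity, in
  -- which `F` applied to the Christoffel symbol is the first-order expression `low`; the product
  -- rule then isolates the wanted term.
  have key : ∀ a b c w, F y (fderivWithin ℝ (fun x => christoffel S F x b c) S y a) w =
      1 / 2 * (B a b c w + B a c b w - B a w b c)
        - A a (jetChristoffel (F y) A b c) w := by
    intro a b c w
    let low : E → E →L[ℝ] ℝ := fun x => (1 / 2 : ℝ) • (fderivWithin ℝ F S x b c +
      fderivWithin ℝ F S x c b - ((fderivWithin ℝ F S x).flip b).flip c)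
    have hlow : DifferentiableWithinAt ℝ low S y := by
      have h1 : ∀ p q, DifferentiableWithinAt ℝ (fun x => fderivWithin ℝ F S x p q) S y :=
        fun p q => (hF1'.clm_apply (differentiableWithinAt_const p)).clm_apply
          (differentiableWithinAt_const q)
      have h2 : DifferentiableWithinAt ℝ
          (fun x => ((fderivWithin ℝ F S x).flip b).flip c) S y := by
        have e1 := (ContinuousLinearMap.flipₗᵢ ℝ E E (E →L[ℝ] ℝ)).toContinuousLinearEquiv
          |>.differentiableAt.comp_differentiableWithinAt y hF1'
        have e2 := e1.clm_apply (differentiableWithinAt_const b)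
        have e3 := (ContinuousLinearMap.flipₗᵢ ℝ E E ℝ).toContinuousLinearEquiv
          |>.differentiableAt.comp_differentiableWithinAt y e2
        exact e3.clm_apply (differentiableWithinAt_const c)
      exact ((((h1 b c).add (h1 c b)).sub h2).const_smul (1 / 2 : ℝ))
    have hchr : DifferentiableWithinAt ℝ (fun x => christoffel S F x b c) S y := by
      have h1 : DifferentiableAt ℝ
          (ContinuousLinearMap.inverse : (E →L[ℝ] E →L[ℝ] ℝ) → ((E →L[ℝ] ℝ) →L[ℝ] E)) (F y) := by
        obtain ⟨e, he⟩ := hinv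
        rw [← he]
        exact (contDiffAt_map_inverse (n := 1) e).differentiableAt (by simp)
      exact (h1.comp_differentiableWithinAt y hF0).clm_apply hlow
    have h3 : (fun x => F x (christoffel S F x b c) w) =ᶠ[𝓝[S] y] fun x => low x w := by
      filter_upwards [hinv'] with x hx
      rw [christoffel, apply_inverse_of_isInvertible hx]
    have h4 := ((hF0.hasFDerivWithinAt.clm_apply hchr.hasFDerivWithinAt).clm_apply
      (hasFDerivWithinAt_const w y S)).congr_of_eventuallyEq h3.symm (h3.self_of_nhdsWithin hy).symm
    have h5 : ∀ p q r, HasFDerivWithinAt (fun x => fderivWithin ℝ F S x p q r)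
        (((B.flip p).flip q).flip r) S y := by
      intro p q r
      have := (((hF1'.hasFDerivWithinAt.clm_apply (hasFDerivWithinAt_const p y S)).clm_apply
        (hasFDerivWithinAt_const q y S)).clm_apply (hasFDerivWithinAt_const r y S))
      refine this.congr_fderiv ?_
      ext h
      simp [hB, ContinuousLinearMap.flip_apply]
    have h6 : HasFDerivWithinAt (fun x => low x w) ((1 / 2 : ℝ) • (((B.flip b).flip c).flip w +
        ((B.flip c).flip b).flip w - ((B.flip w).flip b).flip c)) S y := by
      refine ((((h5 b c w).add (h5 c b w)).sub (h5 w b c)).const_smul (1 / 2 : ℝ)).congr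
        (fun x _ => ?_) ?_ <;> simp [low, ContinuousLinearMap.flip_apply]
    have h7 := congrArg (fun L => L a) ((hS y hy).eq h4 h6)
    simp only [ContinuousLinearMap.comp_apply, add_apply,
      ContinuousLinearMap.flip_apply, smul_apply, smul_eq_mul,
      sub_apply, zero_apply, map_zero, zero_add] at h7
    have h8 : christoffel S F y b c = jetChristoffel (F y) A b c := rfl
    rw [h8] at h7
    linarith
  have hΓ : ∀ p q, christoffel S F y p q = jetChristoffel (F y) A p q := fun _ _ => rfl
  have hAs : ∀ a p q, A a p q = A a q p := by
    intro a p q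
    have h1 : (fun x => F x p q) =ᶠ[𝓝[S] y] fun x => F x q p := by
      filter_upwards [hsymm] with x hx using hx p q
    have h2 : ∀ p q, HasFDerivWithinAt (fun x => F x p q) ((A.flip p).flip q) S y := by
      intro p q
      refine ((hF0.hasFDerivWithinAt.clm_apply (hasFDerivWithinAt_const p y S)).clm_apply
        (hasFDerivWithinAt_const q y S)).congr_fderiv ?_
      ext h
      simp [hA, ContinuousLinearMap.flip_apply]
    have h3 := (h2 q p).congr_of_eventuallyEq h1 (h1.self_of_nhdsWithin hy)
    have h4 := congrArg (fun L => L a) ((hS y hy).eq (h2 p q) h3)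
    simpa [ContinuousLinearMap.flip_apply] using h4
  simp only [curvatureEndo, map_add, map_sub, add_apply,
    sub_apply, key, hΓ, jetCurvature, hBs v u]
  have e : ∀ a b c, F y (jetChristoffel (F y) A a b) c = 1 / 2 * (A a b c + A b a c - A c a b) :=
    jetChristoffel_apply hinv A
  -- Every term quadratic in the Christoffel symbols is rewritten so that exactly one symbol
  -- remains, as an argument of `A`; after that the two sides agree as polynomials.
  rw [hGs (jetChristoffel (F y) A u z) (jetChristoffel (F y) A v w),
    hGs (jetChristoffel (F y) A v z) (jetChristoffel (F y) A u w), e, e, e, e,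
    hAs u w, hAs v w, hAs w u, hAs w v]
  ring

end JetCurvature

/-! ### Naturality of the curvature of a 2-jet under coordinate changes -/

section Naturality

open Set Filter

variable {E : Type} [NormedAddCommGroup E] [NormedSpace ℝ E]
  {E' : Type} [NormedAddCommGroup E'] [NormedSpace ℝ E']

/-- `pullbackBilin` as a continuous bilinear operation. -/
theorem pullbackBilin_eq_compL (B : E →L[ℝ] E →L[ℝ] ℝ) (A : E' →L[ℝ] E) :
    pullbackBilin B A = ContinuousLinearMap.compL ℝ E' (E →L[ℝ] ℝ) (E' →L[ℝ] ℝ)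
      ((ContinuousLinearMap.compL ℝ E' E ℝ).flip A) (B.comp A) := by
  ext; rfl

theorem hasFDerivWithinAt_pullbackBilin {X : Type} [NormedAddCommGroup X] [NormedSpace ℝ X]
    {S : Set X} {y : X} {b : X → E →L[ℝ] E →L[ℝ] ℝ} {a : X → E' →L[ℝ] E}
    {b' : X →L[ℝ] E →L[ℝ] E →L[ℝ] ℝ} {a' : X →L[ℝ] E' →L[ℝ] E}
    (hb : HasFDerivWithinAt b b' S y) (ha : HasFDerivWithinAt a a' S y) :
    ∃ D : X →L[ℝ] E' →L[ℝ] E' →L[ℝ] ℝ,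
      HasFDerivWithinAt (fun x => pullbackBilin (b x) (a x)) D S y ∧
      ∀ h u v, D h u v = b' h (a y u) (a y v) + b y (a' h u) (a y v) + b y (a y u) (a' h v) := by
  have h1 := ((ContinuousLinearMap.compL ℝ E' E ℝ).flip).hasFDerivAt.comp_hasFDerivWithinAt y ha
  have h2 := (ContinuousLinearMap.compL ℝ E' E (E →L[ℝ] ℝ)).hasFDerivWithinAt_of_bilinear hb ha
  have h3 := (ContinuousLinearMap.compL ℝ E' (E →L[ℝ] ℝ) (E' →L[ℝ] ℝ)).hasFDerivWithinAt_of_bilinear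
    h1 h2
  refine ⟨_, h3.congr (fun x _ => pullbackBilin_eq_compL _ _) (pullbackBilin_eq_compL _ _), ?_⟩
  intro h u v
  simp [ContinuousLinearMap.precompR, ContinuousLinearMap.precompL, ContinuousLinearMap.compL_apply]
  ring

set_option maxHeartbeats 1000000 in
/-- The curvature tensor of a 2-jet is natural with respect to changes of coordinates. -/
theorem jetCurvature_pullback [FiniteDimensional ℝ E] [FiniteDimensional ℝ E']
    {S : Set E} {S' : Set E'} (hS : UniqueDiffOn ℝ S) (hS' : UniqueDiffOn ℝ S')
    {F : E → E →L[ℝ] E →L[ℝ] ℝ} {F' : E' → E' →L[ℝ] E' →L[ℝ] ℝ} {φ : E' → E} {y : E'}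
    (hy : y ∈ S') (hS'c : S' ⊆ closure (interior S')) (hφ : ContDiffWithinAt ℝ ∞ φ S' y)
    (hmaps : ∀ᶠ x in 𝓝[S'] y, φ x ∈ S) (hF : ContDiffWithinAt ℝ ∞ F S (φ y))
    (heq : ∀ᶠ x in 𝓝[S'] y, F' x = pullbackBilin (F (φ x)) (fderivWithin ℝ φ S' x))
    (hsymm : ∀ᶠ x in 𝓝[S] φ y, ∀ u v, F x u v = F x v u)
    (hpos : ∀ v, v ≠ 0 → 0 < F (φ y) v v) (hpos' : ∀ v, v ≠ 0 → 0 < F' y v v)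
    (hL : Function.Surjective (fderivWithin ℝ φ S' y)) (u v w z : E') :
    jetCurvature (F' y) (fderivWithin ℝ F' S' y) (fderivWithin ℝ (fderivWithin ℝ F' S') S' y)
        u v w z =
      jetCurvature (F (φ y)) (fderivWithin ℝ F S (φ y))
        (fderivWithin ℝ (fderivWithin ℝ F S) S (φ y)) (fderivWithin ℝ φ S' y u)
        (fderivWithin ℝ φ S' y v) (fderivWithin ℝ φ S' y w) (fderivWithin ℝ φ S' y z) := by
  have htend : Tendsto φ (𝓝[S'] y) (𝓝[S] φ y) :=
    tendsto_nhdsWithin_iff.2 ⟨hφ.continuousWithinAt, hmaps⟩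
  have hφy : φ y ∈ S := hmaps.self_of_nhdsWithin hy
  have hev : ∀ {Y Z : Type} [NormedAddCommGroup Y] [NormedSpace ℝ Y] [NormedAddCommGroup Z]
      [NormedSpace ℝ Z] {f : Y → Z} {s : Set Y} {x : Y}, x ∈ s → ContDiffWithinAt ℝ ∞ f s x →
      ∀ᶠ x' in 𝓝[s] x, DifferentiableWithinAt ℝ f s x' := by
    intro Y Z _ _ _ _ f s x hx hf
    have h1 := (hf.of_le (m := 1) (by simp)).eventually (by simp)
    rw [insert_eq_of_mem hx] at h1
    exact h1.mono fun x' h => h.differentiableWithinAt (by simp)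
  have hA : ContDiffWithinAt ℝ ∞ (fderivWithin ℝ F S) S (φ y) := hF.fderivWithin_right hS (by simp) hφy
  have hL1 : ContDiffWithinAt ℝ ∞ (fderivWithin ℝ φ S') S' y :=
    hφ.fderivWithin_right hS' (by simp) hy
  have hQ : ContDiffWithinAt ℝ ∞ (fderivWithin ℝ (fderivWithin ℝ φ S') S') S' y :=
    hL1.fderivWithin_right hS' (by simp) hy
  set L := fderivWithin ℝ φ S' with hLdef
  set Q := fderivWithin ℝ L S' with hQdef
  set T := fderivWithin ℝ Q S' y with hTdef
  set A := fderivWithin ℝ F S with hAdef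
  set B := fderivWithin ℝ A S (φ y) with hBdef
  -- the first derivative of `F'`
  have hD1 : ∀ᶠ x in 𝓝[S'] y, ∀ a p q, fderivWithin ℝ F' S' x a p q =
      A (φ x) (L x a) (L x p) (L x q) + F (φ x) (Q x a p) (L x q) + F (φ x) (L x p) (Q x a q) := by
    filter_upwards [eventually_eventually_nhdsWithin.2 heq, htend.eventually (hev hφy hF),
      eventually_eventually_nhdsWithin.2 hmaps, hev hy hφ, hev hy hL1, self_mem_nhdsWithin]
      with x h1 h2 h3 h4 h5 h6 a p q
    have h7 : HasFDerivWithinAt (fun x => F (φ x)) ((A (φ x)).comp (L x)) S' x :=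
      h2.hasFDerivWithinAt.comp_of_tendsto x h4.hasFDerivWithinAt
        (tendsto_nhdsWithin_iff.2 ⟨h4.continuousWithinAt, h3⟩)
    obtain ⟨D, hD, hD'⟩ := hasFDerivWithinAt_pullbackBilin h7 h5.hasFDerivWithinAt
    rw [Filter.EventuallyEq.fderivWithin_eq h1 (h1.self_of_nhdsWithin h6), hD.fderivWithin (hS' x h6),
      hD']
    rfl
  have hF'c : ContDiffWithinAt ℝ ∞ F' S' y := by
    have h1 : ContDiffWithinAt ℝ ∞ (fun x => F (φ x)) S' y := by
      have hn : S' ∩ φ ⁻¹' S ∈ 𝓝[S'] y := inter_mem self_mem_nhdsWithin hmaps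
      exact (hF.comp (s := S' ∩ φ ⁻¹' S) y (hφ.mono inter_subset_left) (fun x hx => hx.2)).mono_of_mem_nhdsWithin hn
    have h2 : ContDiffWithinAt ℝ ∞ (fun x => pullbackBilin (F (φ x)) (L x)) S' y := by
      simp only [pullbackBilin_eq_compL]
      exact (((ContinuousLinearMap.compL ℝ E' E ℝ).flip.contDiff.contDiffAt.comp_contDiffWithinAt y
        hL1).clm_comp (h1.clm_comp hL1))
    exact h2.congr_of_eventuallyEq heq (heq.self_of_nhdsWithin hy)
  have hA' : ContDiffWithinAt ℝ ∞ (fderivWithin ℝ F' S') S' y :=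
    hF'c.fderivWithin_right hS' (by simp) hy
  have hdF := (hF.differentiableWithinAt (by simp)).hasFDerivWithinAt
  have hdA := (hA.differentiableWithinAt (by simp)).hasFDerivWithinAt
  have hdφ := (hφ.differentiableWithinAt (by simp)).hasFDerivWithinAt
  have hdL := (hL1.differentiableWithinAt (by simp)).hasFDerivWithinAt
  have hdQ := (hQ.differentiableWithinAt (by simp)).hasFDerivWithinAt
  have hdFφ := hdF.comp_of_tendsto y hdφ htend
  have hdAφ := hdA.comp_of_tendsto y hdφ htend
  -- the second derivative of `F'`
  have hD2 : ∀ a b p q, fderivWithin ℝ (fderivWithin ℝ F' S') S' y a b p q =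
      B (L y a) (L y b) (L y p) (L y q) + A (φ y) (Q y a b) (L y p) (L y q)
      + A (φ y) (L y b) (Q y a p) (L y q) + A (φ y) (L y b) (L y p) (Q y a q)
      + A (φ y) (L y a) (Q y b p) (L y q) + F (φ y) (T a b p) (L y q)
      + F (φ y) (Q y b p) (Q y a q)
      + A (φ y) (L y a) (L y p) (Q y b q) + F (φ y) (Q y a p) (Q y b q)
      + F (φ y) (L y p) (T a b q) := by
    intro a b p q
    have hc : ∀ w : E', HasFDerivWithinAt (fun _ : E' => w) (0 : E' →L[ℝ] E') S' y :=
      fun w => hasFDerivWithinAt_const w y S'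
    have hLv := fun w => hdL.clm_apply (hc w)
    have hQv := fun w w' => (hdQ.clm_apply (hc w)).clm_apply (hc w')
    have e1 := ((hdAφ.clm_apply (hLv b)).clm_apply (hLv p)).clm_apply (hLv q)
    have e2 := (hdFφ.clm_apply (hQv b p)).clm_apply (hLv q)
    have e3 := (hdFφ.clm_apply (hLv p)).clm_apply (hQv b q)
    have e4 := (e1.add e2).add e3
    have e5 := (((hA'.differentiableWithinAt (by simp)).hasFDerivWithinAt.clm_apply
      (hc b)).clm_apply (hc p)).clm_apply (hc q)
    have e6 := e4.congr_of_eventuallyEq (hD1.mono fun x hx => hx b p q)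
      (hD1.self_of_nhdsWithin hy b p q)
    have e7 := congrArg (fun D => D a) ((hS' y hy).eq e5 e6)
    simp only [ContinuousLinearMap.comp_apply, add_apply, ContinuousLinearMap.flip_apply,
      zero_apply, map_zero, zero_add, Function.comp_apply] at e7
    rw [e7, hTdef, hBdef]
    ring
  have hQs : ∀ᶠ x in 𝓝[S'] y, ∀ a b, Q x a b = Q x b a := by
    have h1 := (hφ.of_le (m := 2) (by simpa using ENat.LEInfty.out)).eventually (by simp)
    rw [insert_eq_of_mem hy] at h1
    filter_upwards [h1, self_mem_nhdsWithin] with x h2 h3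
    exact h2.isSymmSndFDerivWithinAt (by simp) hS' (hS'c h3) h3
  have hTs1 : ∀ a b c, T a b c = T b a c := fun a b c => congrArg (fun D => D c)
    ((hL1.isSymmSndFDerivWithinAt (by simpa using ENat.LEInfty.out) hS' (hS'c hy) hy) a b)
  have hTs2 : ∀ a b c, T a b c = T a c b := by
    intro a b c
    have h2 : ∀ p q, HasFDerivWithinAt (fun x => Q x p q) ((T.flip p).flip q) S' y := by
      intro p q
      refine ((hdQ.clm_apply (hasFDerivWithinAt_const p y S')).clm_apply
        (hasFDerivWithinAt_const q y S')).congr_fderiv ?_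
      ext h
      simp [hTdef, ContinuousLinearMap.flip_apply]
    have h3 := (h2 c b).congr_of_eventuallyEq (hQs.mono fun x h => h b c)
      (hQs.self_of_nhdsWithin hy b c)
    simpa [ContinuousLinearMap.flip_apply] using
      congrArg (fun D => D a) ((hS' y hy).eq (h2 b c) h3)
  have hQy := hQs.self_of_nhdsWithin hy
  have hGs : ∀ u v, F (φ y) u v = F (φ y) v u := hsymm.self_of_nhdsWithin hφy
  have hAs : ∀ a p q, A (φ y) a p q = A (φ y) a q p := by
    intro a p q
    have h2 : ∀ p q, HasFDerivWithinAt (fun x => F x p q) (((A (φ y)).flip p).flip q) S (φ y) := by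
      intro p q
      refine ((hdF.clm_apply (hasFDerivWithinAt_const p _ S)).clm_apply
        (hasFDerivWithinAt_const q _ S)).congr_fderiv ?_
      ext h
      simp [hAdef, ContinuousLinearMap.flip_apply]
    have h3 := (h2 q p).congr_of_eventuallyEq (hsymm.mono fun x h => h p q) (hGs p q)
    simpa [ContinuousLinearMap.flip_apply] using
      congrArg (fun D => D a) ((hS _ hφy).eq (h2 p q) h3)
  have hy' := heq.self_of_nhdsWithin hy
  have hD1y := hD1.self_of_nhdsWithin hy
  have hinv := isInvertible_of_pos hpos
  have hinv' := isInvertible_of_pos hpos'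
  have hpb : ∀ a b, F' y a b = F (φ y) (L y a) (L y b) := fun a b => by rw [hy']; rfl
  -- The transformation law of the Christoffel symbols, with the second derivative `Q` of the
  -- coordinate change as inhomogeneous term. It is tested against the vectors `L y c`, which are
  -- all vectors because `L y` is onto.
  have hΓ : ∀ a b, L y (jetChristoffel (F' y) (fderivWithin ℝ F' S' y) a b) =
      jetChristoffel (F (φ y)) (A (φ y)) (L y a) (L y b) + Q y a b := by
    intro a b
    have h1 : F (φ y) (L y (jetChristoffel (F' y) (fderivWithin ℝ F' S' y) a b)) =
        F (φ y) (jetChristoffel (F (φ y)) (A (φ y)) (L y a) (L y b) + Q y a b) := by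
      ext c
      obtain ⟨c, rfl⟩ := hL c
      have h2 := jetChristoffel_apply hinv' (fderivWithin ℝ F' S' y) a b c
      rw [hD1y, hD1y, hD1y] at h2
      rw [map_add, add_apply, jetChristoffel_apply hinv]
      rw [← hpb, h2]
      rw [hQy b a, hQy c a, hQy c b, hGs (Q y a c) (L y b)]
      ring
    obtain ⟨e, he⟩ := hinv
    have h2 : Function.Injective (F (φ y)) := by
      rw [← he]
      exact e.injective
    exact h2 h1
  have e : ∀ a b c, F (φ y) (jetChristoffel (F (φ y)) (A (φ y)) a b) c =
      1 / 2 * (A (φ y) a b c + A (φ y) b a c - A (φ y) c a b) := jetChristoffel_apply hinv _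
  have e' : ∀ a b c, F (φ y) c (jetChristoffel (F (φ y)) (A (φ y)) a b) =
      1 / 2 * (A (φ y) a b c + A (φ y) b a c - A (φ y) c a b) := fun a b c => by rw [hGs, e]
  simp only [jetCurvature, hpb, hΓ, hD2, map_add, add_apply]
  -- These two terms occur on both sides. They are made opaque so that `e` and `e'` only expand the
  -- pairings of a Christoffel symbol with `Q`.
  generalize F (φ y) (jetChristoffel (F (φ y)) (A (φ y)) (L y u) (L y z))
    (jetChristoffel (F (φ y)) (A (φ y)) (L y v) (L y w)) = r1
  generalize F (φ y) (jetChristoffel (F (φ y)) (A (φ y)) (L y v) (L y z))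
    (jetChristoffel (F (φ y)) (A (φ y)) (L y u) (L y w)) = r2
  simp only [e, e']
  rw [hQy z u, hQy z v, hQy w u, hQy w v, hQy w z, hQy v u]
  -- By the symmetry of the third derivative `T`, its contributions cancel in pairs.
  rw [hTs2 u z v, hTs2 u z w, hTs2 u w v, hTs2 v z u, hTs2 v w u, hTs2 v z w, hTs1 v u z, hTs1 v u w]
  rw [hGs (Q y u w) (Q y v z), hGs (Q y u z) (Q y v w)]
  linarith [hAs (L y u) (L y w) (Q y v z), hAs (L y u) (L y z) (Q y v w),
    hAs (L y v) (L y z) (Q y u w), hAs (L y v) (L y w) (Q y u z)]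

end Naturality

/-! ### Openness and naturality of a curvature condition on 2-jets -/

section GoodJets

open Set Filter

variable {E : Type} [NormedAddCommGroup E] [NormedSpace ℝ E]
  {E' : Type} [NormedAddCommGroup E'] [NormedSpace ℝ E'] {d : ℕ}

/-- The 2-jet `(G, A, B)` is that of a positive definite form whose curvature satisfies `C`. -/
def GoodJet (C : Set (AlgCurvOp d)) (G : E →L[ℝ] E →L[ℝ] ℝ) (A : E →L[ℝ] E →L[ℝ] E →L[ℝ] ℝ)
    (B : E →L[ℝ] E →L[ℝ] E →L[ℝ] E →L[ℝ] ℝ) : Prop :=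
  (∀ v, v ≠ 0 → 0 < G v v) ∧ ∀ b : Fin d → E, (∀ i j, G (b i) (b j) = if i = j then 1 else 0) →
    ∃ R ∈ C, ∀ i j k l, R.1 i j k l = jetCurvature G A B (b i) (b j) (b k) (b l)

/-- The field `F` of bilinear forms on `S` is positive definite and satisfies `C` at `y`. -/
def GoodCoordAt (C : Set (AlgCurvOp d)) (S : Set E) (F : E → E →L[ℝ] E →L[ℝ] ℝ) (y : E) : Prop :=
  GoodJet C (F y) (fderivWithin ℝ F S y) (fderivWithin ℝ (fderivWithin ℝ F S) S y)

theorem exists_lower_bound_of_pos [FiniteDimensional ℝ E] {G : E →L[ℝ] E →L[ℝ] ℝ}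
    (hpos : ∀ v, v ≠ 0 → 0 < G v v) : ∃ c : ℝ, 0 < c ∧ ∀ v, c * ‖v‖ ^ 2 ≤ G v v := by
  have := FiniteDimensional.proper ℝ E
  rcases (Metric.sphere (0 : E) 1).eq_empty_or_nonempty with he | hne
  · refine ⟨1, one_pos, fun v => ?_⟩
    have hv : v = 0 := by
      by_contra hv
      have : (‖v‖⁻¹ • v) ∈ Metric.sphere (0 : E) 1 := by
        simp [norm_smul, hv]
      rw [he] at this
      exact this
    simp [hv]
  · obtain ⟨m, hm, hmin⟩ := (isCompact_sphere (0 : E) 1).exists_isMinOn hne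
      (f := fun v => G v v) (by fun_prop)
    have hm0 : m ≠ 0 := by
      rintro rfl
      simp at hm
    refine ⟨G m m, hpos m hm0, fun v => ?_⟩
    rcases eq_or_ne v 0 with rfl | hv0
    · simp
    have hvn : 0 < ‖v‖ := norm_pos_iff.2 hv0
    have h1 := hmin (show (‖v‖⁻¹ • v) ∈ Metric.sphere (0 : E) 1 by
      simp [norm_smul, hvn.ne'])
    simp only [Set.mem_ofPred_eq, map_smul, smul_apply, smul_eq_mul] at h1
    calc G m m * ‖v‖ ^ 2 ≤ (‖v‖⁻¹ * (‖v‖⁻¹ * G v v)) * ‖v‖ ^ 2 := by gcongr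
      _ = G v v := by field_simp

/-- A common lower bound for all forms near `G` confines their orthonormal frames to one compact
set. -/
theorem eventually_lower_bound_of_pos [FiniteDimensional ℝ E] {G : E →L[ℝ] E →L[ℝ] ℝ}
    (hpos : ∀ v, v ≠ 0 → 0 < G v v) :
    ∃ c : ℝ, 0 < c ∧ ∀ᶠ G' in 𝓝 G, ∀ v, c * ‖v‖ ^ 2 ≤ G' v v := by
  obtain ⟨c, hc, h⟩ := exists_lower_bound_of_pos hpos
  refine ⟨c / 2, half_pos hc, ?_⟩
  filter_upwards [Metric.ball_mem_nhds G (half_pos hc)] with G' hG' v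
  have h1 : ‖G' - G‖ < c / 2 := by simpa [dist_eq_norm] using hG'
  have h2 : |(G' - G) v v| ≤ ‖G' - G‖ * ‖v‖ * ‖v‖ := (G' - G).le_opNorm₂ v v
  have h3 := (abs_le.1 h2).1
  have h4 := h v
  simp only [sub_apply] at h3
  nlinarith [mul_self_nonneg ‖v‖]

theorem continuousAt_jetChristoffel [FiniteDimensional ℝ E] {Y : Type*} [TopologicalSpace Y]
    {G : Y → E →L[ℝ] E →L[ℝ] ℝ} {A : Y → E →L[ℝ] E →L[ℝ] E →L[ℝ] ℝ} {u v : Y → E} {y : Y}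
    (hG : ContinuousAt G y) (hA : ContinuousAt A y) (hu : ContinuousAt u y) (hv : ContinuousAt v y)
    (hpos : ∀ v, v ≠ 0 → 0 < G y v v) :
    ContinuousAt (fun y => jetChristoffel (G y) (A y) (u y) (v y)) y := by
  have h1 : ContinuousAt (ContinuousLinearMap.inverse :
      (E →L[ℝ] E →L[ℝ] ℝ) → ((E →L[ℝ] ℝ) →L[ℝ] E)) (G y) := by
    obtain ⟨e, he⟩ := isInvertible_of_pos hpos
    rw [← he]
    exact (contDiffAt_map_inverse (n := 1) e).continuousAt
  have h2 : ContinuousAt (fun y => (G y).inverse) y := ContinuousAt.comp h1 hG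
  have h3 : ContinuousAt (fun y => (A y).flip) y :=
    (ContinuousLinearMap.flipₗᵢ ℝ E E (E →L[ℝ] ℝ)).continuous.continuousAt.comp hA
  have h4 : ContinuousAt (fun y => ((A y).flip (u y)).flip) y :=
    (ContinuousLinearMap.flipₗᵢ ℝ E E ℝ).continuous.continuousAt.comp (h3.clm_apply hu)
  exact h2.clm_apply (((((hA.clm_apply hu).clm_apply hv).add
    ((hA.clm_apply hv).clm_apply hu)).sub (h4.clm_apply hv)).const_smul (1 / 2 : ℝ))

theorem continuousAt_jetCurvature [FiniteDimensional ℝ E] {Y : Type*} [TopologicalSpace Y]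
    {G : Y → E →L[ℝ] E →L[ℝ] ℝ} {A : Y → E →L[ℝ] E →L[ℝ] E →L[ℝ] ℝ}
    {B : Y → E →L[ℝ] E →L[ℝ] E →L[ℝ] E →L[ℝ] ℝ} {u v w z : Y → E} {y : Y}
    (hG : ContinuousAt G y) (hA : ContinuousAt A y) (hB : ContinuousAt B y)
    (hu : ContinuousAt u y) (hv : ContinuousAt v y) (hw : ContinuousAt w y) (hz : ContinuousAt z y)
    (hpos : ∀ v, v ≠ 0 → 0 < G y v v) :
    ContinuousAt (fun y => jetCurvature (G y) (A y) (B y) (u y) (v y) (w y) (z y)) y := by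
  have hΓ : ∀ {a b : Y → E}, ContinuousAt a y → ContinuousAt b y →
      ContinuousAt (fun y => jetChristoffel (G y) (A y) (a y) (b y)) y :=
    fun ha hb => continuousAt_jetChristoffel hG hA ha hb hpos
  have hB' : ∀ {a b c e : Y → E}, ContinuousAt a y → ContinuousAt b y → ContinuousAt c y →
      ContinuousAt e y → ContinuousAt (fun y => B y (a y) (b y) (c y) (e y)) y :=
    fun ha hb hc he => (((hB.clm_apply ha).clm_apply hb).clm_apply hc).clm_apply he
  have hG' : ∀ {a b : Y → E}, ContinuousAt a y → ContinuousAt b y →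
      ContinuousAt (fun y => G y (a y) (b y)) y :=
    fun ha hb => (hG.clm_apply ha).clm_apply hb
  exact ((continuousAt_const.mul ((((hB' hu hz hv hw).sub (hB' hu hw hv hz)).sub
    (hB' hv hz hu hw)).add (hB' hv hw hu hz))).add (hG' (hΓ hu hz) (hΓ hv hw))).sub
    (hG' (hΓ hv hz) (hΓ hu hw))

/-- For open `C`, being a good 2-jet is an open condition among 2-jets with the symmetries of the
2-jet of a metric. -/
theorem GoodJet.eventually [FiniteDimensional ℝ E] {C : Set (AlgCurvOp d)} (hC : IsOpen C)
    {G : E →L[ℝ] E →L[ℝ] ℝ} {A : E →L[ℝ] E →L[ℝ] E →L[ℝ] ℝ}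
    {B : E →L[ℝ] E →L[ℝ] E →L[ℝ] E →L[ℝ] ℝ} (h : GoodJet C G A B) :
    ∀ᶠ J : (E →L[ℝ] E →L[ℝ] ℝ) × (E →L[ℝ] E →L[ℝ] E →L[ℝ] ℝ) ×
        (E →L[ℝ] E →L[ℝ] E →L[ℝ] E →L[ℝ] ℝ) in 𝓝 (G, A, B),
      (∀ b : Fin d → E, (fun i j k l => jetCurvature J.1 J.2.1 J.2.2 (b i) (b j) (b k) (b l)) ∈
        AlgCurvOp d) → GoodJet C J.1 J.2.1 J.2.2 := by
  obtain ⟨c, hc, hlow⟩ := eventually_lower_bound_of_pos h.1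
  have hlow' : ∀ᶠ J : (E →L[ℝ] E →L[ℝ] ℝ) × (E →L[ℝ] E →L[ℝ] E →L[ℝ] ℝ) ×
        (E →L[ℝ] E →L[ℝ] E →L[ℝ] E →L[ℝ] ℝ) in 𝓝 (G, A, B), ∀ v, c * ‖v‖ ^ 2 ≤ J.1 v v :=
    (continuous_fst.tendsto (G, A, B)).eventually hlow
  have := FiniteDimensional.proper ℝ E
  -- `C` is the trace of an open set `U` of arbitrary 4-index arrays, so membership can be tested
  -- before the curvature symmetries of the perturbed jet are known.
  obtain ⟨U, hU, rfl⟩ := isOpen_induced_iff.1 hC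
  -- A vector of unit length for a nearby form satisfies ‖v‖² ≤ c⁻¹, hence ‖v‖ ≤ c⁻¹ + 1, so this
  -- ball contains every orthonormal frame in question.
  have hK : IsCompact (Metric.closedBall (0 : Fin d → E) (c⁻¹ + 1)) := isCompact_closedBall _ _
  have hmain := hK.eventually_forall_of_forall_eventually (x₀ := (G, A, B))
    (P := fun J b => (∀ i j, J.1 (b i) (b j) = if i = j then 1 else 0) →
      (fun i j k l => jetCurvature J.1 J.2.1 J.2.2 (b i) (b j) (b k) (b l)) ∈ U) (by
    intro b _
    have hcb : ∀ i, ContinuousAt (fun z : ((E →L[ℝ] E →L[ℝ] ℝ) × (E →L[ℝ] E →L[ℝ] E →L[ℝ] ℝ) ×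
        (E →L[ℝ] E →L[ℝ] E →L[ℝ] E →L[ℝ] ℝ)) × (Fin d → E) => z.2 i) ((G, A, B), b) := fun i =>
      (continuous_apply i).continuousAt.comp continuousAt_snd
    by_cases hb : ∀ i j, G (b i) (b j) = if i = j then 1 else 0
    · obtain ⟨R, hR, hR'⟩ := h.2 b hb
      have hcont : ContinuousAt (fun z : ((E →L[ℝ] E →L[ℝ] ℝ) × (E →L[ℝ] E →L[ℝ] E →L[ℝ] ℝ) ×
        (E →L[ℝ] E →L[ℝ] E →L[ℝ] E →L[ℝ] ℝ)) × (Fin d → E) =>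
          (fun i j k l => jetCurvature z.1.1 z.1.2.1 z.1.2.2 (z.2 i) (z.2 j) (z.2 k) (z.2 l)))
          ((G, A, B), b) := by
        refine continuousAt_pi.2 fun i => continuousAt_pi.2 fun j => continuousAt_pi.2 fun k =>
          continuousAt_pi.2 fun l => ?_
        refine continuousAt_jetCurvature (by fun_prop) (by fun_prop) (by fun_prop) (hcb i) (hcb j)
          (hcb k) (hcb l) h.1
      have hmem : (fun i j k l => jetCurvature G A B (b i) (b j) (b k) (b l)) ∈ U := by
        have : (fun i j k l => jetCurvature G A B (b i) (b j) (b k) (b l)) = R.1 := by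
          funext i j k l
          exact (hR' i j k l).symm
        rw [this]
        exact hR
      filter_upwards [hcont.eventually (hU.mem_nhds hmem)] with z hz _ using hz
    -- A frame that violates an orthonormality relation still violates it after a small change of
    -- form and frame, and there is nothing to prove for it.
    · push Not at hb
      obtain ⟨i, j, hij⟩ := hb
      have hcont : ContinuousAt (fun z : ((E →L[ℝ] E →L[ℝ] ℝ) × (E →L[ℝ] E →L[ℝ] E →L[ℝ] ℝ) ×
        (E →L[ℝ] E →L[ℝ] E →L[ℝ] E →L[ℝ] ℝ)) × (Fin d → E) => z.1.1 (z.2 i) (z.2 j))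
          ((G, A, B), b) :=
        ((continuousAt_fst.comp continuousAt_fst).clm_apply (hcb i)).clm_apply (hcb j)
      filter_upwards [hcont.eventually (isOpen_ne.mem_nhds hij)] with z hz hz'
      exact absurd (hz' i j) hz)
  filter_upwards [hlow', hmain] with J h1 h2 h3
  refine ⟨fun v hv => ?_, fun b hb => ?_⟩
  · have : 0 < ‖v‖ := norm_pos_iff.2 hv
    exact lt_of_lt_of_le (by positivity) (h1 v)
  · refine ⟨⟨_, h3 b⟩, ?_, fun _ _ _ _ => rfl⟩
    refine h2 b ?_ hb
    rw [mem_closedBall_zero_iff, pi_norm_le_iff_of_nonneg (by positivity)]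
    intro i
    have h4 := h1 (b i)
    rw [hb i i, if_pos rfl] at h4
    have h5 : ‖b i‖ ^ 2 ≤ c⁻¹ := by
      rw [← one_div, le_div_iff₀ hc]
      linarith
    nlinarith [sq_nonneg (‖b i‖ - 1), norm_nonneg (b i)]

variable {P : Type*} [TopologicalSpace P]

/-- A smooth symmetric field of bilinear forms near `y`. -/
structure SymmSmoothAt (S : Set E) (F : E → E →L[ℝ] E →L[ℝ] ℝ) (y : E) : Prop where
  smooth : ContDiffWithinAt ℝ ∞ F S y
  symm : ∀ᶠ x in 𝓝[S] y, ∀ u v, F x u v = F x v u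

/-- Supplies the algebraic hypothesis of `GoodJet.eventually`: symmetry in the last two slots comes
from differentiating the symmetry of `F`, symmetry in the first two slots of the second derivative
from Schwarz's theorem. -/
theorem SymmSmoothAt.jetCurvature_mem {S : Set E} (hS : UniqueDiffOn ℝ S)
    (hSc : S ⊆ closure (interior S)) {F : E → E →L[ℝ] E →L[ℝ] ℝ} {y : E}
    (hy : y ∈ S) (h : SymmSmoothAt S F y) (b : Fin d → E) :
    (fun i j k l => jetCurvature (F y) (fderivWithin ℝ F S y)
      (fderivWithin ℝ (fderivWithin ℝ F S) S y) (b i) (b j) (b k) (b l)) ∈ AlgCurvOp d := by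
  have hsym1 : ∀ᶠ x in 𝓝[S] y, ∀ a p q, fderivWithin ℝ F S x a p q = fderivWithin ℝ F S x a q p := by
    have h1 := (h.smooth.of_le (m := 1) (by simp)).eventually (by simp)
    rw [insert_eq_of_mem hy] at h1
    filter_upwards [h1, eventually_eventually_nhdsWithin.2 h.symm, self_mem_nhdsWithin]
      with x h1 h2 h3 a p q
    have hdF := (h1.differentiableWithinAt (by simp)).hasFDerivWithinAt
    have h4 : ∀ p q, HasFDerivWithinAt (fun x => F x p q)
        (((fderivWithin ℝ F S x).flip p).flip q) S x := by
      intro p q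
      refine ((hdF.clm_apply (hasFDerivWithinAt_const p _ S)).clm_apply
        (hasFDerivWithinAt_const q _ S)).congr_fderiv ?_
      ext h
      simp [ContinuousLinearMap.flip_apply]
    have h5 := (h4 q p).congr_of_eventuallyEq (h2.mono fun x h => h p q)
      (h2.self_of_nhdsWithin h3 p q)
    simpa [ContinuousLinearMap.flip_apply] using
      congrArg (fun D => D a) ((hS _ h3).eq (h4 p q) h5)
  have hd := (h.smooth.fderivWithin_right (m := ∞) hS (by simp) hy).differentiableWithinAt (by simp)
    |>.hasFDerivWithinAt
  refine _root_.jetCurvature_mem (h.symm.self_of_nhdsWithin hy) (hsym1.self_of_nhdsWithin hy) ?_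
    (fun a b => (h.smooth.isSymmSndFDerivWithinAt (by simpa using ENat.LEInfty.out) hS
      (hSc hy) hy) a b) b
  intro a c p q
  have h4 : ∀ p q, HasFDerivWithinAt (fun x => fderivWithin ℝ F S x c p q)
        ((((fderivWithin ℝ (fderivWithin ℝ F S) S y).flip c).flip p).flip q) S y := by
    intro p q
    refine (((hd.clm_apply (hasFDerivWithinAt_const c _ S)).clm_apply
      (hasFDerivWithinAt_const p _ S)).clm_apply
        (hasFDerivWithinAt_const q _ S)).congr_fderiv ?_
    ext h
    simp [ContinuousLinearMap.flip_apply]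
  have h5 := (h4 q p).congr_of_eventuallyEq (hsym1.mono fun x h => h c p q)
    (hsym1.self_of_nhdsWithin hy c p q)
  simpa [ContinuousLinearMap.flip_apply] using
    congrArg (fun D => D a) ((hS _ hy).eq (h4 p q) h5)

theorem GoodCoordAt.eventually [FiniteDimensional ℝ E] {C : Set (AlgCurvOp d)} (hC : IsOpen C)
    {S : Set E} (hS : UniqueDiffOn ℝ S) (hSc : S ⊆ closure (interior S))
    {F : P → E → E →L[ℝ] E →L[ℝ] ℝ} {z : P × E}
    (hF : FamCk S 2 F z) (hF' : ∀ᶠ z' in 𝓝[univ ×ˢ S] z, SymmSmoothAt S (F z'.1) z'.2)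
    (h : GoodCoordAt C S (F z.1) z.2) :
    ∀ᶠ z' in 𝓝[univ ×ˢ S] z, GoodCoordAt C S (F z'.1) z'.2 := by
  have h1 := hF.continuousWithinAt
  have h2 := hF.2.2.continuousWithinAt
  have h3 := hF.2.2.2.2.continuousWithinAt
  filter_upwards [(h1.prodMk (h2.prodMk h3)).eventually (GoodJet.eventually hC h), hF',
    eventually_mem_fiber z] with z' h4 h5 h6
  exact h4 (h5.jetCurvature_mem hS hSc h6)

/-- The derivative of `φ` carries orthonormal frames of `F'` to orthonormal frames of `F`, with the
same curvature components, so the witness in `C` is the same. -/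
theorem GoodCoordAt.pullback [FiniteDimensional ℝ E] [FiniteDimensional ℝ E']
    {C : Set (AlgCurvOp d)} {S : Set E} {S' : Set E'} (hS : UniqueDiffOn ℝ S)
    (hS' : UniqueDiffOn ℝ S') {F : E → E →L[ℝ] E →L[ℝ] ℝ} {F' : E' → E' →L[ℝ] E' →L[ℝ] ℝ}
    {φ : E' → E} {y : E'} (hy : y ∈ S') (hS'c : S' ⊆ closure (interior S'))
    (hφ : ContDiffWithinAt ℝ ∞ φ S' y) (hmaps : ∀ᶠ x in 𝓝[S'] y, φ x ∈ S)
    (hF : SymmSmoothAt S F (φ y))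
    (heq : ∀ᶠ x in 𝓝[S'] y, F' x = pullbackBilin (F (φ x)) (fderivWithin ℝ φ S' x))
    (hL : Function.Injective (fderivWithin ℝ φ S' y))
    (hdim : Module.finrank ℝ E' = Module.finrank ℝ E) (h : GoodCoordAt C S F (φ y)) :
    GoodCoordAt C S' F' y := by
  have hy' := heq.self_of_nhdsWithin hy
  have hpos' : ∀ v, v ≠ 0 → 0 < F' y v v := by
    intro v hv
    rw [hy']
    exact h.1 _ ((map_ne_zero_iff _ hL).2 hv)
  have hsurj : Function.Surjective (fderivWithin ℝ φ S' y) :=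
    (LinearMap.injective_iff_surjective_of_finrank_eq_finrank (f := (fderivWithin ℝ φ S' y : E' →ₗ[ℝ] E)) hdim).1 hL
  refine ⟨hpos', fun b hb => ?_⟩
  obtain ⟨R, hR, hR'⟩ := h.2 (fun i => fderivWithin ℝ φ S' y (b i)) (fun i j => by
    rw [← hb i j, hy']; rfl)
  refine ⟨R, hR, fun i j k l => ?_⟩
  rw [hR', jetCurvature_pullback hS hS' hy hS'c hφ hmaps hF.smooth heq hF.symm h.1 hpos' hsurj]

end GoodJets

/-! ### Families of tensor fields on manifolds and their coordinate expressions -/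

section TensorFields

open Set Filter

variable {E : Type} [NormedAddCommGroup E] [NormedSpace ℝ E]
  {H : Type*} [TopologicalSpace H] {I : ModelWithCorners ℝ E H}
  {M : Type*} [TopologicalSpace M] [ChartedSpace H M]
  {E' : Type} [NormedAddCommGroup E'] [NormedSpace ℝ E']
  {H' : Type*} [TopologicalSpace H'] {I' : ModelWithCorners ℝ E' H'}
  {M' : Type*} [TopologicalSpace M'] [ChartedSpace H' M']
  {X : Type} [NormedAddCommGroup X] [NormedSpace ℝ X]
  {Y : Type} [NormedAddCommGroup Y] [NormedSpace ℝ Y]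
  {P : Type*} [TopologicalSpace P]

/-- Fields of bilinear forms on the tangent spaces of `M`. -/
abbrev TensorField (I : ModelWithCorners ℝ E H) (M : Type*) [TopologicalSpace M]
    [ChartedSpace H M] :=
  ∀ x : M, TangentSpace I x →L[ℝ] TangentSpace I x →L[ℝ] ℝ

namespace TensorField

/-- The expression of a tensor field in terms of a parametrization `κ` of `M`, defined on `S`. -/
def coordOn (κ : X → M) (S : Set X) (T : TensorField I M) (y : X) : X →L[ℝ] X →L[ℝ] ℝ :=
  pullbackBilin (V := X) (T (κ y)) (mfderivWithin 𝓘(ℝ, X) I κ S y)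

/-- The expression of a tensor field in the preferred chart at `x`. -/
def coord (T : TensorField I M) (x : M) : E → E →L[ℝ] E →L[ℝ] ℝ :=
  T.coordOn (extChartAt I x).symm (range I)

/-- The pull-back of a tensor field. -/
def pullback (f : M' → M) (T : TensorField I M) : TensorField I' M' :=
  fun x => pullbackBilin (T (f x)) (mfderiv I' I f x)

/-- The tensor field `dρ²` of a function `ρ`. -/
def dsq (I : ModelWithCorners ℝ E H) (ρ : M → ℝ) : TensorField I M :=
  fun x => pullbackBilin (V := TangentSpace I x) (W := ℝ) (ContinuousLinearMap.mul ℝ ℝ) (mfderiv I 𝓘(ℝ) ρ x)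

theorem coordOn_apply (κ : X → M) (S : Set X) (T : TensorField I M) (y u v : X) :
    T.coordOn κ S y u v =
      T (κ y) (mfderivWithin 𝓘(ℝ, X) I κ S y u) (mfderivWithin 𝓘(ℝ, X) I κ S y v) := rfl

/-- The rule for a change of parametrization. The parametrizations need not be inverse charts: a
collar on a half-space is used later. -/
theorem coordOn_comp (T : TensorField I M) {κ : X → M} {S : Set X} {κ' : Y → M} {S' : Set Y}
    {φ : X → Y} {y : X} (hS : UniqueDiffOn ℝ S) (hy : y ∈ S)
    (hκ : ∀ᶠ x in 𝓝[S] y, κ x = κ' (φ x)) (hmaps : ∀ᶠ x in 𝓝[S] y, φ x ∈ S')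
    (hφ : DifferentiableWithinAt ℝ φ S y)
    (hκ' : MDifferentiableWithinAt 𝓘(ℝ, Y) I κ' S' (φ y)) :
    T.coordOn κ S y = pullbackBilin (T.coordOn κ' S' (φ y)) (fderivWithin ℝ φ S y) := by
  have h1 : HasMFDerivWithinAt 𝓘(ℝ, X) 𝓘(ℝ, Y) φ S y (fderivWithin ℝ φ S y) :=
    hφ.hasFDerivWithinAt.hasMFDerivWithinAt
  have h2 : HasMFDerivWithinAt 𝓘(ℝ, X) I (κ' ∘ φ) (S ∩ φ ⁻¹' S') y
      ((mfderivWithin 𝓘(ℝ, Y) I κ' S' (φ y)).comp (fderivWithin ℝ φ S y)) :=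
    hκ'.hasMFDerivWithinAt.comp y (h1.mono inter_subset_left) fun x hx => hx.2
  have h3 : HasMFDerivWithinAt 𝓘(ℝ, X) I (κ' ∘ φ) S y
      ((mfderivWithin 𝓘(ℝ, Y) I κ' S' (φ y)).comp (fderivWithin ℝ φ S y)) :=
    (hasMFDerivWithinAt_inter' hmaps).1 h2
  have h4 := h3.congr_of_eventuallyEq hκ (hκ.self_of_nhdsWithin hy)
  have h5 := h4.mfderivWithin (hS.uniqueMDiffOn y hy)
  have h6 := hκ.self_of_nhdsWithin hy
  -- All tangent spaces are the model space, so vectors can be kept fixed while the base point is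
  -- replaced by an equal one.
  have h7 : ∀ (x x' : M), x = x' → ∀ a b : E, T x a b = T x' a b := by
    rintro x _ rfl a b; rfl
  ext u v
  have e : ∀ u, mfderivWithin 𝓘(ℝ, X) I κ S y u =
      mfderivWithin 𝓘(ℝ, Y) I κ' S' (φ y) (fderivWithin ℝ φ S y u) := fun u =>
    congrArg (fun D : X →L[ℝ] E => D u) h5
  rw [coordOn_apply, pullbackBilin_apply, coordOn_apply]
  refine (h7 _ _ h6 _ _).trans ?_
  exact congrArg₂ (fun a b : E => T (κ' (φ y)) a b) (e u) (e v)

theorem coordOn_pullback {T : TensorField I M} {f : M' → M} {κ : X → M'} {S : Set X} {y : X}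
    (hS : UniqueDiffOn ℝ S) (hy : y ∈ S) (hκ : MDifferentiableWithinAt 𝓘(ℝ, X) I' κ S y)
    (hf : MDifferentiableAt I' I f (κ y)) :
    (T.pullback (I' := I') f).coordOn κ S y = T.coordOn (f ∘ κ) S y := by
  have h1 : HasMFDerivWithinAt 𝓘(ℝ, X) I (f ∘ κ) S y
      ((mfderiv I' I f (κ y)).comp (mfderivWithin 𝓘(ℝ, X) I' κ S y)) :=
    hf.hasMFDerivAt.comp_hasMFDerivWithinAt y hκ.hasMFDerivWithinAt
  have h2 := h1.mfderivWithin (hS.uniqueMDiffOn y hy)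
  ext u v
  rw [coordOn_apply, coordOn_apply, h2]
  rfl

theorem coordOn_dsq {ρ : M → ℝ} {κ : X → M} {S : Set X} {y : X}
    (hS : UniqueDiffOn ℝ S) (hy : y ∈ S) (hκ : MDifferentiableWithinAt 𝓘(ℝ, X) I κ S y)
    (hf : MDifferentiableAt I 𝓘(ℝ) ρ (κ y)) :
    (dsq I ρ).coordOn κ S y = pullbackBilin (ContinuousLinearMap.mul ℝ ℝ)
      (fderivWithin ℝ (fun x => ρ (κ x)) S y) := by
  have h1 : HasMFDerivWithinAt 𝓘(ℝ, X) 𝓘(ℝ) (ρ ∘ κ) S y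
      ((mfderiv I 𝓘(ℝ) ρ (κ y)).comp (mfderivWithin 𝓘(ℝ, X) I κ S y)) :=
    hf.hasMFDerivAt.comp_hasMFDerivWithinAt y hκ.hasMFDerivWithinAt
  have h2 := h1.mfderivWithin (hS.uniqueMDiffOn y hy)
  rw [mfderivWithin_eq_fderivWithin] at h2
  have h3 : fderivWithin ℝ (fun x => ρ (κ x)) S y = _ := h2
  rw [h3]
  rfl

end TensorField

variable {S : Set X} {S' : Set Y}

theorem FamCk.pullbackBilin {k : ℕ} {z : P × X} (hS : UniqueDiffOn ℝ S) (hz : z.2 ∈ S)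
    {b : P → X → E →L[ℝ] E →L[ℝ] ℝ} {a : P → X → E' →L[ℝ] E} (hb : FamCk S k b z)
    (ha : FamCk S k a z) : FamCk S k (fun p y => pullbackBilin (b p y) (a p y)) z := by
  simp only [pullbackBilin_eq_compL]
  exact FamCk.bilin hS hz _ (FamCk.clm hS hz _ ha)
    (FamCk.bilin hS hz (ContinuousLinearMap.compL ℝ E' E (E →L[ℝ] ℝ)) hb ha)

theorem FamSmooth.pullback {F : P → Y → Y →L[ℝ] Y →L[ℝ] ℝ} {φ : P → X → Y} {z : P × X}
    (hS : UniqueDiffOn ℝ S) (hz : z.2 ∈ S)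
    (hφ : FamSmooth S φ z) (hmaps : ∀ᶠ z' in 𝓝[univ ×ˢ S] z, φ z'.1 z'.2 ∈ S')
    (hF : FamSmooth S' F (z.1, φ z.1 z.2)) :
    FamSmooth S (fun p y => _root_.pullbackBilin (F p (φ p y)) (_root_.fderivWithin ℝ (φ p) S y)) z :=
  fun k => FamCk.pullbackBilin hS hz (FamCk.comp hS hz (hφ k) hmaps (hF k)) (hφ.fderivWithin k)

theorem FamSmooth.eventually_differentiable {V : Type} [NormedAddCommGroup V] [NormedSpace ℝ V]
    {F : P → X → V} {z : P × X} (h : FamSmooth S F z) :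
    ∀ᶠ z' in 𝓝[univ ×ˢ S] z, DifferentiableWithinAt ℝ (F z'.1) S z'.2 := (h 1).2.1

theorem tendsto_snd_fiber (z : P × X) :
    Tendsto Prod.snd (𝓝[(univ : Set P) ×ˢ S] z) (𝓝[S] z.2) :=
  continuousWithinAt_snd.tendsto_nhdsWithin fun _ hz => hz.2

namespace TensorField

/-- The family `p ↦ T p` of tensor fields is, near the point `z` of `P × M`, a continuous family of
smooth tensor fields. -/
def SmoothFamAt (T : P → TensorField I M) (z : P × M) : Prop :=
  FamSmooth (range I) (fun p => (T p).coord z.2) (z.1, extChartAt I z.2 z.2)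

/-- The family `p ↦ ψ p` of functions is, near the point `z` of `P × M`, a continuous family of
smooth functions. -/
def _root_.SmoothFunFamAt (I : ModelWithCorners ℝ E H) (ψ : P → M → ℝ) (z : P × M) : Prop :=
  FamSmooth (range I) (fun p y => ψ p ((extChartAt I z.2).symm y)) (z.1, extChartAt I z.2 z.2)

theorem _root_.mdifferentiableWithinAt_extChartAt_symm' [IsManifold I ∞ M] {x x' : M}
    (h : x' ∈ (extChartAt I x).source) :
    MDifferentiableWithinAt 𝓘(ℝ, E) I (extChartAt I x).symm (range I) (extChartAt I x x') :=
  have : IsManifold I 1 M := IsManifold.of_le (n := ∞) (by simp)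
  mdifferentiableWithinAt_extChartAt_symm ((extChartAt I x).map_source h)

theorem _root_.contMDiffWithinAt_extChartAt_symm_self [IsManifold I ∞ M] (x : M) :
    ContMDiffWithinAt 𝓘(ℝ, E) I ∞ (extChartAt I x).symm (range I) (extChartAt I x x) :=
  contMDiffWithinAt_extChartAt_symm_range x (mem_extChartAt_target x)

theorem _root_.eventually_mdifferentiableWithinAt_extChartAt_symm [IsManifold I ∞ M] (x : M) :
    ∀ᶠ y in 𝓝[range I] (extChartAt I x x),
      MDifferentiableWithinAt 𝓘(ℝ, E) I (extChartAt I x).symm (range I) y := by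
  have : IsManifold I 1 M := IsManifold.of_le (n := ∞) (by simp)
  filter_upwards [extChartAt_target_mem_nhdsWithin x] with y hy
  exact mdifferentiableWithinAt_extChartAt_symm hy

/-- The coordinate expressions of a smooth family in smooth parametrizations are smooth. -/
theorem SmoothFamAt.coordOn [IsManifold I ∞ M] {T : P → TensorField I M} {z : P × X} {κ : X → M}
    (h : SmoothFamAt T (z.1, κ z.2)) (hS : UniqueDiffOn ℝ S) (hz : z.2 ∈ S)
    (hκ : ContMDiffWithinAt 𝓘(ℝ, X) I ∞ κ S z.2) :
    FamSmooth S (fun p => (T p).coordOn κ S) z := by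
  set x₀ := κ z.2
  set φ : X → E := fun y => extChartAt I x₀ (κ y) with hφdef
  have hφ : ContDiffWithinAt ℝ ∞ φ S z.2 := by
    have := (contMDiffAt_extChartAt (I := I) (n := ∞) (x := x₀)).comp_contMDiffWithinAt z.2 hκ
    exact contMDiffWithinAt_iff_contDiffWithinAt.1 this
  have hsrc : ∀ᶠ y in 𝓝[S] z.2, κ y ∈ (extChartAt I x₀).source :=
    hκ.continuousWithinAt.eventually (extChartAt_source_mem_nhds x₀)
  have hmaps : ∀ᶠ y in 𝓝[S] z.2, φ y ∈ range I := .of_forall fun y => mem_range_self _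
  have hd : ∀ᶠ y in 𝓝[S] z.2, DifferentiableWithinAt ℝ φ S y := by
    have h1 := (hφ.of_le (m := 1) (by simp)).eventually (by simp)
    rw [insert_eq_of_mem hz] at h1
    exact h1.mono fun x' h => h.differentiableWithinAt (by simp)
  have h1 : FamSmooth S (fun p y => pullbackBilin ((T p).coord x₀ (φ y))
      (fderivWithin ℝ φ S y)) z :=
    FamSmooth.pullback (S' := range I) (φ := fun _ => φ) hS hz
      (FamSmooth.of_contDiffWithinAt hS hz hφ) ((tendsto_snd_fiber z).eventually hmaps) h
  refine h1.congr hz ?_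
  filter_upwards [(tendsto_snd_fiber z).eventually (eventually_eventually_nhdsWithin.2 hsrc),
    (tendsto_snd_fiber z).eventually hd, eventually_mem_fiber z] with z' h2 h3 h4
  refine coordOn_comp (T z'.1) hS h4 ?_ (.of_forall fun y => mem_range_self _) h3 ?_
  · filter_upwards [h2] with y hy
    exact ((extChartAt I x₀).left_inv hy).symm
  · exact mdifferentiableWithinAt_extChartAt_symm' (h2.self_of_nhdsWithin h4)

theorem SmoothFamAt.congr {T T' : P → TensorField I M} {z : P × M} (h : SmoothFamAt T z)
    (he : ∀ᶠ z' in 𝓝 z, T' z'.1 z'.2 = T z'.1 z'.2) : SmoothFamAt T' z := by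
  refine FamSmooth.congr h (mem_range_self _) ?_
  have hc : Tendsto (fun z' : P × E => (z'.1, (extChartAt I z.2).symm z'.2))
      (𝓝[univ ×ˢ range I] (z.1, extChartAt I z.2 z.2)) (𝓝 z) := by
    have h1 := (continuousAt_extChartAt_symm (I := I) z.2).tendsto
    rw [extChartAt_to_inv] at h1
    have h2 : Tendsto (fun z' : P × E => (extChartAt I z.2).symm z'.2)
      (𝓝 (z.1, extChartAt I z.2 z.2)) (𝓝 z.2) := h1.comp continuousAt_snd
    exact ((continuous_fst.tendsto _).prodMk_nhds h2).mono_left nhdsWithin_le_nhds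
  filter_upwards [hc.eventually he] with z' h1
  simp only [coord, TensorField.coordOn]
  rw [h1]

theorem SmoothFamAt.add {T T' : P → TensorField I M} {z : P × M} (h : SmoothFamAt T z)
    (h' : SmoothFamAt T' z) : SmoothFamAt (fun p x => T p x + T' p x) z := fun k =>
  (FamCk.add I.uniqueDiffOn (mem_range_self _) (h k) (h' k)).congr (mem_range_self _)
    (.of_forall fun _ => rfl)

theorem SmoothFamAt.smul {T : P → TensorField I M} {ψ : P → M → ℝ} {z : P × M}
    (hψ : SmoothFunFamAt I ψ z) (h : SmoothFamAt T z) :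
    SmoothFamAt (fun p x => ψ p x • T p x) z := fun k =>
  (FamCk.bilin I.uniqueDiffOn (mem_range_self _)
    (ContinuousLinearMap.lsmul ℝ ℝ (E := E →L[ℝ] E →L[ℝ] ℝ)) (hψ k) (h k)).congr (mem_range_self _)
    (.of_forall fun _ => rfl)

theorem _root_.SmoothFunFamAt.add {ψ ψ' : P → M → ℝ} {z : P × M} (h : SmoothFunFamAt I ψ z)
    (h' : SmoothFunFamAt I ψ' z) : SmoothFunFamAt I (fun p x => ψ p x + ψ' p x) z := fun k =>
  FamCk.add I.uniqueDiffOn (mem_range_self _) (h k) (h' k)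

theorem _root_.SmoothFunFamAt.mul {ψ ψ' : P → M → ℝ} {z : P × M} (h : SmoothFunFamAt I ψ z)
    (h' : SmoothFunFamAt I ψ' z) : SmoothFunFamAt I (fun p x => ψ p x * ψ' p x) z := fun k =>
  FamCk.bilin I.uniqueDiffOn (mem_range_self _) (ContinuousLinearMap.mul ℝ ℝ) (h k) (h' k)

theorem _root_.SmoothFunFamAt.of_param {σ : P → ℝ} {z : P × M} (h : ContinuousAt σ z.1) :
    SmoothFunFamAt I (fun p (_ : M) => σ p) z := fun _ =>
  FamCk.of_param h (mem_range_self _)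

theorem _root_.SmoothFunFamAt.of_contMDiffAt [IsManifold I ∞ M] {ψ : M → ℝ} {z : P × M}
    (h : ContMDiffAt I 𝓘(ℝ) ∞ ψ z.2) : SmoothFunFamAt I (fun (_ : P) => ψ) z := by
  refine FamSmooth.of_contDiffWithinAt I.uniqueDiffOn (mem_range_self _) ?_
  have h1 : ContMDiffAt I 𝓘(ℝ) ∞ ψ ((extChartAt I z.2).symm (extChartAt I z.2 z.2)) := by
    rwa [extChartAt_to_inv]
  exact contMDiffWithinAt_iff_contDiffWithinAt.1
    (h1.comp_contMDiffWithinAt _ (contMDiffWithinAt_extChartAt_symm_self z.2))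

theorem _root_.tendsto_extChartAt_symm (z : P × M) :
    Tendsto (fun z' : P × E => (z'.1, (extChartAt I z.2).symm z'.2))
      (𝓝[univ ×ˢ range I] (z.1, extChartAt I z.2 z.2)) (𝓝 z) := by
  have h1 := (continuousAt_extChartAt_symm (I := I) z.2).tendsto
  rw [extChartAt_to_inv] at h1
  have h2 : Tendsto (fun z' : P × E => (extChartAt I z.2).symm z'.2)
    (𝓝 (z.1, extChartAt I z.2 z.2)) (𝓝 z.2) := h1.comp continuousAt_snd
  exact ((continuous_fst.tendsto _).prodMk_nhds h2).mono_left nhdsWithin_le_nhds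

theorem SmoothFamAt.dsq [IsManifold I ∞ M] {ρ : P → M → ℝ} {z : P × M} (h : SmoothFunFamAt I ρ z)
    (hd : ∀ᶠ z' in 𝓝 z, MDifferentiableAt I 𝓘(ℝ) (ρ z'.1) z'.2) :
    SmoothFamAt (fun p => dsq I (ρ p)) z := by
  have h1 : FamSmooth (range I) (fun p y => pullbackBilin (ContinuousLinearMap.mul ℝ ℝ)
      (fderivWithin ℝ (fun y => ρ p ((extChartAt I z.2).symm y)) (range I) y))
      (z.1, extChartAt I z.2 z.2) := fun k =>
    FamCk.pullbackBilin I.uniqueDiffOn (mem_range_self _)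
      (FamCk.of_param (σ := fun _ => ContinuousLinearMap.mul ℝ ℝ) continuousAt_const
        (mem_range_self _)) (h.fderivWithin k)
  refine h1.congr (mem_range_self _) ?_
  filter_upwards [(tendsto_extChartAt_symm z).eventually hd, eventually_mem_fiber _,
    (tendsto_snd_fiber (P := P) (z.1, extChartAt I z.2 z.2)).eventually
      (eventually_mdifferentiableWithinAt_extChartAt_symm z.2)] with z' h2 h3 h4
  exact coordOn_dsq I.uniqueDiffOn h3 h4 h2

theorem SmoothFamAt.pullback [IsManifold I ∞ M] [IsManifold I' ∞ M'] {T : P → TensorField I M}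
    {f : M' → M} {z : P × M'} (h : SmoothFamAt T (z.1, f z.2)) (hf : ContMDiffAt I' I ∞ f z.2) :
    SmoothFamAt (fun p => (T p).pullback (I' := I') f) z := by
  have hd : ∀ᶠ x in 𝓝 z.2, MDifferentiableAt I' I f x := by
    have h1 : ContMDiffAt I' I 1 f z.2 := hf.of_le (by simp)
    have : IsManifold I 1 M := IsManifold.of_le (n := ∞) (by simp)
    have : IsManifold I' 1 M' := IsManifold.of_le (n := ∞) (by simp)
    filter_upwards [(contMDiffAt_iff_contMDiffAt_nhds (by simp)).1 h1] with x hx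
    exact hx.mdifferentiableAt (by simp)
  have hinv := extChartAt_to_inv (I := I') z.2
  have h1 : FamSmooth (range I')
      (fun p => (T p).coordOn (f ∘ (extChartAt I' z.2).symm) (range I'))
      (z.1, extChartAt I' z.2 z.2) := by
    refine SmoothFamAt.coordOn ?_ I'.uniqueDiffOn (mem_range_self _) ?_
    · simpa [hinv] using h
    · have h2 : ContMDiffAt I' I ∞ f ((extChartAt I' z.2).symm (extChartAt I' z.2 z.2)) := by
        rwa [hinv]
      exact h2.comp_contMDiffWithinAt _ (contMDiffWithinAt_extChartAt_symm_self z.2)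
  refine h1.congr (mem_range_self _) ?_
  have hd' : ∀ᶠ z' in 𝓝 z, MDifferentiableAt I' I f z'.2 := (continuous_snd.tendsto z).eventually hd
  filter_upwards [(tendsto_extChartAt_symm z).eventually hd', eventually_mem_fiber _,
    (tendsto_snd_fiber (P := P) (z.1, extChartAt I' z.2 z.2)).eventually
      (eventually_mdifferentiableWithinAt_extChartAt_symm z.2)] with z' h2 h3 h4
  exact coordOn_pullback I'.uniqueDiffOn h3 h4 h2

theorem SmoothFamAt.reparam {Q : Type*} [TopologicalSpace Q] {u : Q → P} {z : Q × M}
    {T : P → TensorField I M} (hu : ContinuousAt u z.1) (h : SmoothFamAt T (u z.1, z.2)) :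
    SmoothFamAt (fun q => T (u q)) z := fun k =>
  FamCk.reparam (F := fun p => (T p).coord z.2) hu (h k)

end TensorField

end TensorFields

/-! ### The smooth topology on metrics as joint continuity of derivatives -/

section MetricFamilies

open Set Filter

variable {E : Type} [NormedAddCommGroup E] [NormedSpace ℝ E]
  {H : Type*} [TopologicalSpace H] {I : ModelWithCorners ℝ E H}
  {M : Type*} [TopologicalSpace M] [ChartedSpace H M]
  {E' : Type} [NormedAddCommGroup E'] [NormedSpace ℝ E']
  {H' : Type*} [TopologicalSpace H'] {I' : ModelWithCorners ℝ E' H'}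
  {M' : Type*} [TopologicalSpace M'] [ChartedSpace H' M']
  {P : Type*} [TopologicalSpace P]

open TensorField

/-- The frames of the tangent bundle trivialization are the coordinate frames of the chart; this
links smoothness of a metric as a bundle section to smoothness of `TensorField.coord`. -/
theorem trivializationAt_symm_eq [IsManifold I ∞ M] {x₀ x : M} (hx : x ∈ (chartAt H x₀).source)
    (u : E) : (trivializationAt E (TangentSpace I) x₀).symm x u =
      mfderivWithin 𝓘(ℝ, E) I (extChartAt I x₀).symm (range I) (extChartAt I x₀ x) u := by
  have : IsManifold I 1 M := IsManifold.of_le (n := ∞) (by simp)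
  have h1 := TangentBundle.symmL_trivializationAt (𝕜 := ℝ) (I := I) hx
  have hb : x ∈ (trivializationAt E (TangentSpace I) x₀).baseSet := by simpa using hx
  exact ((Bundle.Trivialization.symmL_apply (R := ℝ) _ hb u).symm).trans
    (congrArg (fun D : E →L[ℝ] E => D u) h1)

theorem TensorField.coord_extChartAt_apply [IsManifold I ∞ M] (T : TensorField I M) {x₀ x : M}
    (hx : x ∈ (chartAt H x₀).source) (u v : E) :
    T.coord x₀ (extChartAt I x₀ x) u v =
      T x ((trivializationAt E (TangentSpace I) x₀).symm x u)
        ((trivializationAt E (TangentSpace I) x₀).symm x v) := by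
  have hx' : x ∈ (extChartAt I x₀).source := by simpa using hx
  have hcongr : ∀ x' : M, x' = x → ∀ a b : E, T x' a b = T x a b := by
    rintro x' rfl a b; rfl
  rw [trivializationAt_symm_eq hx, trivializationAt_symm_eq hx]
  exact hcongr _ ((extChartAt I x₀).left_inv hx') _ _

theorem TensorField.coord_self [IsManifold I ∞ M] (T : TensorField I M) (x : M) (u v : E) :
    T.coord x (extChartAt I x x) u v = T x u v := by
  have : IsManifold I 1 M := IsManifold.of_le (n := ∞) (by simp)
  have hcongr : ∀ x' : M, x' = x → ∀ a b : E, T x' a b = T x a b := by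
    rintro x' rfl a b; rfl
  have h1 : mfderivWithin 𝓘(ℝ, E) I (extChartAt I x).symm (range I) (extChartAt I x x) =
    ContinuousLinearMap.id ℝ E := mfderivWithin_range_extChartAt_symm (𝕜 := ℝ) (I := I)
  have h2 : ∀ w : E, mfderivWithin 𝓘(ℝ, E) I (extChartAt I x).symm (range I) (extChartAt I x x) w =
    w := fun w => congrArg (fun D : E →L[ℝ] E => D w) h1
  rw [TensorField.coord, coordOn_apply]
  refine (hcongr _ (extChartAt_to_inv x) _ _).trans ?_
  exact congrArg₂ (fun a b : E => T x a b) (h2 u) (h2 v)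

/-- A metric is smooth in coordinates. -/
theorem RiemMetric.smoothFamAt_const [FiniteDimensional ℝ E] [IsManifold I ∞ M]
    (g : RiemMetric I M) (z : P × M) : SmoothFamAt (fun _ : P => g.inner) z := by
  refine FamSmooth.of_contDiffWithinAt I.uniqueDiffOn (mem_range_self _) ?_
  set x₀ := z.2
  let b : M → E →L[ℝ] E →L[ℝ] ℝ := fun x => TensorField.coord (I := I) g.inner x₀ (extChartAt I x₀ x)
  have hb : ContMDiffAt I 𝓘(ℝ, E →L[ℝ] E →L[ℝ] ℝ) ∞ b x₀ := by
    refine contMDiffAt_clm_of_apply fun u => contMDiffAt_clm_of_apply fun v => ?_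
    have h1 := contMDiffAt_pullback_apply (I := I) (I' := I) g id contMDiff_id x₀ u v
    refine h1.congr_of_eventuallyEq ?_
    filter_upwards [chart_source_mem_nhds H x₀] with x hx
    simp only [mfderiv_id]
    exact TensorField.coord_extChartAt_apply g.inner hx u v
  have h2 : ContMDiffAt I 𝓘(ℝ, E →L[ℝ] E →L[ℝ] ℝ) ∞ b
      ((extChartAt I x₀).symm (extChartAt I x₀ x₀)) := by rwa [extChartAt_to_inv]
  have h3 := contMDiffWithinAt_iff_contDiffWithinAt.1
    (h2.comp_contMDiffWithinAt _ (contMDiffWithinAt_extChartAt_symm_self x₀))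
  have h4 : ∀ᶠ y in 𝓝[range I] (extChartAt I x₀ x₀), TensorField.coord (I := I) g.inner x₀ y =
      (b ∘ (extChartAt I x₀).symm) y := by
    filter_upwards [extChartAt_target_mem_nhdsWithin x₀] with y hy
    simp only [b, Function.comp_apply, (extChartAt I x₀).right_inv hy]
  exact h3.congr_of_eventuallyEq h4 (h4.self_of_nhdsWithin (mem_range_self _))

theorem contMDiff_of_smoothFamAt [FiniteDimensional ℝ E] [IsManifold I ∞ M] {T : TensorField I M}
    (h : ∀ x, SmoothFamAt (fun _ : Unit => T) ((), x)) :
    ContMDiff I (I.prod 𝓘(ℝ, E →L[ℝ] E →L[ℝ] ℝ)) ∞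
      (fun x => Bundle.TotalSpace.mk' (E →L[ℝ] E →L[ℝ] ℝ)
        (E := fun x : M => TangentSpace I x →L[ℝ] TangentSpace I x →L[ℝ] ℝ) x (T x)) := by
  refine contMDiff_bilin_of_apply T fun x₀ u v => ?_
  have h1 : ContDiffWithinAt ℝ ∞ (T.coord x₀) (range I) (extChartAt I x₀ x₀) :=
    FamSmooth.contDiffWithinAt (h x₀) (mem_range_self _)
  have h2 : ContMDiffAt I 𝓘(ℝ, E →L[ℝ] E →L[ℝ] ℝ) ∞ (fun x => T.coord x₀ (extChartAt I x₀ x)) x₀ :=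
    ContMDiffWithinAt.comp (t := range I) x₀ h1.contMDiffWithinAt
      (contMDiffAt_extChartAt (I := I) (n := ∞) (x := x₀)).contMDiffWithinAt
      (fun x _ => mem_range_self _)
  have h3 : ContMDiffAt I 𝓘(ℝ) ∞ (fun x => T.coord x₀ (extChartAt I x₀ x) u v) x₀ :=
    (h2.clm_apply contMDiffAt_const).clm_apply contMDiffAt_const
  refine h3.congr_of_eventuallyEq ?_
  filter_upwards [chart_source_mem_nhds H x₀] with x hx
  exact (TensorField.coord_extChartAt_apply T hx u v).symm

/-- The Riemannian metric given by a smooth, symmetric and positive definite tensor field. -/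
def RiemMetric.ofTensor [FiniteDimensional ℝ E] [IsManifold I ∞ M] (T : TensorField I M)
    (hsymm : ∀ x u v, T x u v = T x v u) (hpos : ∀ x v, v ≠ 0 → 0 < T x v v)
    (h : ∀ x, SmoothFamAt (fun _ : Unit => T) ((), x)) : RiemMetric I M where
  inner := T
  symm := hsymm
  pos := hpos
  isVonNBounded x := isVonNBounded_of_pos x _ (hpos x)
  contMDiff := contMDiff_of_smoothFamAt h

theorem RiemMetric.ext_inner [IsManifold I ∞ M] {g g' : RiemMetric I M} (h : g.inner = g'.inner) :
    g = g' := by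
  cases g; cases g'; congr

theorem RiemMetric.continuous_iff [IsManifold I ∞ M] {g : P → RiemMetric I M} :
    Continuous g ↔ ∀ (p₀ : P) (x : M) (k : ℕ) (K : Set E), IsCompact K →
      K ⊆ (extChartAt I x).target → TendstoUniformlyOn
        (fun p => iteratedFDerivWithin ℝ k ((g p).coord x) (range I))
        (iteratedFDerivWithin ℝ k ((g p₀).coord x) (range I)) (𝓝 p₀) K := by
  simp only [continuous_iInf_rng, continuous_induced_rng]
  constructor
  · intro h p₀ x k K hK hKt
    have h1 := (h x k).tendsto p₀
    exact UniformOnFun.tendsto_iff_tendstoUniformlyOn.1 h1 K ⟨hK, hKt⟩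
  · intro h x k
    refine continuous_iff_continuousAt.2 fun p₀ => ?_
    exact UniformOnFun.tendsto_iff_tendstoUniformlyOn.2 fun K hK => h p₀ x k K hK.1 hK.2

theorem RiemMetric.contDiffWithinAt_coord [FiniteDimensional ℝ E] [IsManifold I ∞ M]
    (g : RiemMetric I M) (x : M) {y : E} (hy : y ∈ (extChartAt I x).target) :
    ContDiffWithinAt ℝ ∞ (g.coord x) (range I) y := by
  have h1 : FamSmooth (range I) (fun _ : Unit => TensorField.coordOn (I := I)
      (extChartAt I x).symm (range I) g.inner) ((), y) :=
    SmoothFamAt.coordOn (g.smoothFamAt_const _) I.uniqueDiffOn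
      (extChartAt_target_subset_range x hy) (contMDiffWithinAt_extChartAt_symm_range x hy)
  exact FamSmooth.contDiffWithinAt h1 (extChartAt_target_subset_range x hy)

/-- Uniform convergence of the derivatives on a compact neighbourhood in the chart, combined with
continuity of the limit, gives joint continuity. -/
theorem RiemMetric.smoothFamAt_of_continuous [FiniteDimensional ℝ E] [IsManifold I ∞ M]
    {g : P → RiemMetric I M} (hg : Continuous g) (z : P × M) :
    SmoothFamAt (fun p => (g p).inner) z := by
  obtain ⟨p₀, x⟩ := z
  have := FiniteDimensional.proper ℝ E
  set y₀ := extChartAt I x x with hy₀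
  have htarget : (extChartAt I x).target ∈ 𝓝[range I] y₀ := extChartAt_target_mem_nhdsWithin x
  refine FamSmooth.of_iteratedFDerivWithin I.uniqueDiffOn (mem_range_self _) ?_ fun k => ?_
  · filter_upwards [(tendsto_snd_fiber (P := P) (p₀, y₀)).eventually htarget] with z' hz'
    exact (g z'.1).contDiffWithinAt_coord x hz'
  · obtain ⟨r, hr, hball⟩ := Metric.mem_nhdsWithin_iff.1 htarget
    let K := Metric.closedBall y₀ (r / 2) ∩ range I
    have hK : IsCompact K := (isCompact_closedBall _ _).inter_right I.isClosed_range
    have hKt : K ⊆ (extChartAt I x).target := fun y hy =>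
      hball ⟨Metric.closedBall_subset_ball (by linarith) hy.1, hy.2⟩
    have hKn : K ∈ 𝓝[range I] y₀ := inter_mem
      (mem_nhdsWithin_of_mem_nhds (Metric.closedBall_mem_nhds _ (by linarith))) self_mem_nhdsWithin
    have hu := RiemMetric.continuous_iff.1 hg p₀ x k K hK hKt
    have hc : ContinuousWithinAt (iteratedFDerivWithin ℝ k ((g p₀).coord x) (range I))
        (range I) y₀ := by
      have h1 := ((g p₀).contDiffWithinAt_coord x (mem_extChartAt_target x)).of_le
        (m := (k : ℕ∞ω)) (by exact_mod_cast le_top)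
      have h2 : FamCk (range I) k (fun _ : Unit => (g p₀).coord x) ((), y₀) :=
        FamCk.of_contDiffWithinAt I.uniqueDiffOn (mem_range_self _) h1
      have h3 := h2.iteratedFDerivWithin I.uniqueDiffOn (mem_range_self _)
      exact h3.comp (f := fun y : E => ((), y)) (t := univ ×ˢ range I)
        (Continuous.prodMk_right ()).continuousWithinAt fun y hy => ⟨trivial, hy⟩
    refine Metric.tendsto_nhds.2 fun ε hε => ?_
    have e1 : ∀ᶠ z' in 𝓝[(univ : Set P) ×ˢ range I] (p₀, y₀), ∀ y ∈ K,
        dist (iteratedFDerivWithin ℝ k ((g p₀).coord x) (range I) y)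
          (iteratedFDerivWithin ℝ k ((g z'.1).coord x) (range I) y) < ε / 2 :=
      ((continuous_fst.tendsto (p₀, y₀)).mono_left nhdsWithin_le_nhds).eventually
        (Metric.tendstoUniformlyOn_iff.1 hu (ε / 2) (half_pos hε))
    have e2 := (tendsto_snd_fiber (P := P) (p₀, y₀)).eventually
      (Metric.tendsto_nhds.1 hc (ε / 2) (half_pos hε))
    filter_upwards [e1, e2, (tendsto_snd_fiber (P := P) (p₀, y₀)).eventually hKn] with z' h1 h2 h3
    have h4 := h1 _ h3
    rw [dist_comm] at h4
    exact (dist_triangle _ (iteratedFDerivWithin ℝ k ((g p₀).coord x) (range I) z'.2) _).trans_lt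
      (lt_of_lt_of_eq (add_lt_add h4 h2) (add_halves ε))

/-- Conversely, joint continuity at every point of a compact set gives uniform convergence on it, by
the tube lemma. -/
theorem RiemMetric.continuous_of_smoothFamAt [FiniteDimensional ℝ E] [IsManifold I ∞ M]
    {g : P → RiemMetric I M} (h : ∀ z, SmoothFamAt (fun p => (g p).inner) z) : Continuous g := by
  refine RiemMetric.continuous_iff.2 fun p₀ x k K hK hKt => ?_
  refine Metric.tendstoUniformlyOn_iff.2 fun ε hε => ?_
  have hmain := hK.eventually_forall_of_forall_eventually (x₀ := p₀)
    -- The guard `y ∈ K` is needed because the tube lemma asks for full neighbourhoods of `y`, while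
    -- the derivatives are controlled only within `range I`.
    (P := fun p y => y ∈ K → dist (iteratedFDerivWithin ℝ k ((g p₀).coord x) (range I) y)
          (iteratedFDerivWithin ℝ k ((g p).coord x) (range I) y) < ε) (by
    intro y hy
    have hyt := hKt hy
    have hyr := extChartAt_target_subset_range x hyt
    have h1 : FamSmooth (range I) (fun p => TensorField.coordOn (I := I)
        (extChartAt I x).symm (range I) (g p).inner) (p₀, y) :=
      SmoothFamAt.coordOn (h _) I.uniqueDiffOn hyr (contMDiffWithinAt_extChartAt_symm_range x hyt)
    have h2 := (h1 k).iteratedFDerivWithin I.uniqueDiffOn hyr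
    have h3 := eventually_nhdsWithin_iff.1 (Metric.tendsto_nhds.1 h2 (ε / 2) (half_pos hε))
    have h4 : Tendsto (fun z' : P × E => (p₀, z'.2)) (𝓝 (p₀, y)) (𝓝 (p₀, y)) := by
      have : Continuous (fun z' : P × E => (p₀, z'.2)) := by fun_prop
      exact this.tendsto (p₀, y)
    filter_upwards [h3, h4.eventually h3] with z' h5 h6 h7
    have h8 := extChartAt_target_subset_range x (hKt h7)
    have h9 := h5 ⟨trivial, h8⟩
    have h10 := h6 ⟨trivial, h8⟩
    rw [dist_comm] at h9
    exact (dist_triangle _ _ _).trans_lt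
      (lt_of_lt_of_eq (add_lt_add h10 h9) (add_halves ε)))
  filter_upwards [hmain] with p hp y hy
  exact hp y hy hy

/-! ### Tensor fields that are metrics satisfying a curvature condition -/

variable {d : ℕ}

/-- The tensor field `T` is positive definite and satisfies the curvature condition `C` at `x`. -/
def TensorField.GoodAt (C : Set (AlgCurvOp d)) (T : TensorField I M) (x : M) : Prop :=
  GoodCoordAt C (range I) (T.coord x) (extChartAt I x x)

/-- The tensor field `T` is smooth near `x` and symmetric. -/
structure TensorField.SymmAt (T : TensorField I M) (x : M) : Prop where
  smooth : SmoothFamAt (fun _ : Unit => T) ((), x)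
  symm : ∀ x u v, T x u v = T x v u

theorem TensorField.SymmAt.symmSmoothAt [IsManifold I ∞ M] {T : TensorField I M} {x₀ : M} {y : E}
    (hy : y ∈ (extChartAt I x₀).target) (h : T.SymmAt ((extChartAt I x₀).symm y)) :
    SymmSmoothAt (range I) (T.coord x₀) y := by
  refine ⟨?_, .of_forall fun x u v => h.symm _ _ _⟩
  have h1 : FamSmooth (range I) (fun _ : Unit => T.coordOn
      (extChartAt I x₀).symm (range I)) ((), y) :=
    SmoothFamAt.coordOn h.smooth I.uniqueDiffOn
      (extChartAt_target_subset_range x₀ hy) (contMDiffWithinAt_extChartAt_symm_range x₀ hy)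
  exact FamSmooth.contDiffWithinAt h1 (extChartAt_target_subset_range x₀ hy)

theorem TensorField.GoodAt.pos [IsManifold I ∞ M] {C : Set (AlgCurvOp d)} {T : TensorField I M}
    {x : M} (h : T.GoodAt C x) (v : TangentSpace I x) (hv : v ≠ 0) : 0 < T x v v := by
  have := h.1 v hv
  exact TensorField.coord_self T x v v ▸ this

theorem RiemMetric.riemann_eq [FiniteDimensional ℝ E] [IsManifold I ∞ M] (g : RiemMetric I M)
    (x : M) (u v w z : E) :
    g.riemann x u v w z = jetCurvature (g.coord x (extChartAt I x x))
      (fderivWithin ℝ (g.coord x) (range I) (extChartAt I x x))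
      (fderivWithin ℝ (fderivWithin ℝ (g.coord x) (range I)) (range I) (extChartAt I x x))
      u v w z := by
  refine Eq.trans ?_ (curvatureEndo_eq_jetCurvature I.uniqueDiffOn
    (mem_range_self _) (I.range_subset_closure_interior (mem_range_self _))
    (g.contDiffWithinAt_coord x (mem_extChartAt_target x))
    (.of_forall fun y u v => g.symm _ _ _) (fun v hv => ?_) u v w z)
  · exact (TensorField.coord_self g.inner x _ _).symm
  · have := TensorField.coord_self g.inner x v v
    exact this ▸ g.pos x v hv

/-- The two sides differ in that one ranges over bases and the other over tuples; an orthonormal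
tuple whose length is the dimension is a basis. -/
theorem RiemMetric.satisfies_iff [FiniteDimensional ℝ E] [IsManifold I ∞ M] (g : RiemMetric I M)
    (hd : Module.finrank ℝ E = d) (C : Set (AlgCurvOp d)) :
    g.Satisfies C ↔ ∀ x, TensorField.GoodAt (I := I) C g.inner x := by
  have hself : ∀ (x : M) (u v : E), g.coord x (extChartAt I x x) u v = g.inner x u v :=
    fun x u v => TensorField.coord_self g.inner x u v
  constructor
  · intro h x
    refine ⟨fun v hv => ?_, fun b hb => ?_⟩
    · have := hself x v v
      exact this ▸ g.pos x v hv
    · have hb' : ∀ i j, g.inner x (b i) (b j) = if i = j then 1 else 0 := fun i j => by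
        rw [← hb i j]; exact (hself x _ _).symm
      have hli : LinearIndependent ℝ b := by
        rw [Fintype.linearIndependent_iff]
        intro c hc i
        have h1 : g.coord x (extChartAt I x x) (∑ j, c j • b j) (b i) = 0 := by
          rw [hc, map_zero]; rfl
        rw [map_sum] at h1
        have h2 : ∑ j, c j * (if j = i then 1 else 0) = (0 : ℝ) := by
          refine Eq.trans ?_ h1
          rw [sum_apply]
          refine Finset.sum_congr rfl fun j _ => ?_
          rw [map_smul, smul_apply, smul_eq_mul, hself x, hb']
        simpa using h2
      -- In dimension zero the empty basis is used; the dimension count serves the other dimensions.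
      let B : Module.Basis (Fin d) ℝ E := by
        cases d with
        | zero =>
          have : Subsingleton E := Module.finrank_zero_iff.1 hd
          exact Module.Basis.empty E
        | succ d => exact basisOfLinearIndependentOfCardEqFinrank hli (by simp [hd])
      have hB : ∀ i, B i = b i := by
        cases d with
        | zero => exact fun i => i.elim0
        | succ d => intro i; simp [B]
      obtain ⟨R, hR, hR'⟩ := h x B (fun i j => by
        refine Eq.trans ?_ (hb' i j)
        exact congrArg₂ (fun a c : E => g.inner x a c) (hB i) (hB j))
      refine ⟨R, hR, fun i j k l => ?_⟩
      refine (hR' i j k l).trans ((g.riemann_eq x _ _ _ _).trans ?_)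
      exact congr (congr (congr (congrArg _ (hB i)) (hB j)) (hB k)) (hB l)
  · intro h x b hb
    obtain ⟨R, hR, hR'⟩ := (h x).2 (fun i => b i) (fun i j => by
      rw [← hb i j]; exact hself x _ _)
    refine ⟨R, hR, fun i j k l => ?_⟩
    exact (hR' i j k l).trans (g.riemann_eq x _ _ _ _).symm

/-- Naturality of curvature conditions, with the field on the target in an arbitrary chart. -/
theorem TensorField.GoodAt.of_pullback_chart [FiniteDimensional ℝ E] [FiniteDimensional ℝ E']
    [IsManifold I ∞ M] [IsManifold I' ∞ M'] {C : Set (AlgCurvOp d)} {T : TensorField I M}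
    {T' : TensorField I' M'} {f : M' → M} {x : M'} {x₀ : M}
    (hf : ContMDiffAt I' I ∞ f x) (hinj : Function.Injective (mfderiv I' I f x))
    (hdim : Module.finrank ℝ E' = Module.finrank ℝ E)
    (hx : f x ∈ (extChartAt I x₀).source) (hT : T.SymmAt (f x))
    (heq : ∀ᶠ x' in 𝓝 x, T' x' = T.pullback (I' := I') f x')
    (h : GoodCoordAt C (range I) (T.coord x₀) (extChartAt I x₀ (f x))) : T'.GoodAt C x := by
  have : IsManifold I 1 M := IsManifold.of_le (n := ∞) (by simp)
  have : IsManifold I' 1 M' := IsManifold.of_le (n := ∞) (by simp)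
  set e := (extChartAt I' x).symm with he
  set y₀ := extChartAt I' x x with hy₀
  have hy₀r : y₀ ∈ range I' := mem_range_self _
  have hex : e y₀ = x := extChartAt_to_inv x
  have hc : Tendsto e (𝓝[range I'] y₀) (𝓝 x) := by
    have := (continuousAt_extChartAt_symm (I := I') x).tendsto
    rw [extChartAt_to_inv] at this
    exact this.mono_left nhdsWithin_le_nhds
  have hcs : ∀ᶠ y in 𝓝[range I'] y₀, f (e y) ∈ (extChartAt I x₀).source :=
    hc.eventually (hf.continuousAt.eventually ((isOpen_extChartAt_source x₀).mem_nhds hx))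
  have hchart : ContMDiffAt I 𝓘(ℝ, E) ∞ (extChartAt I x₀) (f x) :=
    contMDiffAt_extChartAt' (by simpa using hx)
  have hφ : ContDiffWithinAt ℝ ∞ (fun y => extChartAt I x₀ (f (e y))) (range I') y₀ := by
    have h4 : ContMDiffAt I' 𝓘(ℝ, E) ∞ (extChartAt I x₀ ∘ f) (e y₀) := by
      rw [hex]
      exact hchart.comp x hf
    exact contMDiffWithinAt_iff_contDiffWithinAt.1
      (h4.comp_contMDiffWithinAt _ (contMDiffWithinAt_extChartAt_symm_self x))
  have hdφ : ∀ᶠ y in 𝓝[range I'] y₀,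
      DifferentiableWithinAt ℝ (fun y => extChartAt I x₀ (f (e y))) (range I') y := by
    have h1 := (hφ.of_le (m := 1) (by simp)).eventually (by simp)
    rw [insert_eq_of_mem hy₀r] at h1
    exact h1.mono fun x' h => h.differentiableWithinAt (by simp)
  have hdf : ∀ᶠ x' in 𝓝 x, MDifferentiableAt I' I f x' := by
    have h1 : ContMDiffAt I' I 1 f x := hf.of_le (by simp)
    filter_upwards [(contMDiffAt_iff_contMDiffAt_nhds (by simp)).1 h1] with x hx
    exact hx.mdifferentiableAt (by simp)
  have heq' : ∀ᶠ y in 𝓝[range I'] y₀, T'.coord x y =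
      pullbackBilin (T.coord x₀ (extChartAt I x₀ (f (e y))))
        (fderivWithin ℝ (fun y => extChartAt I x₀ (f (e y))) (range I') y) := by
    filter_upwards [eventually_eventually_nhdsWithin.2 hcs, self_mem_nhdsWithin, hdφ,
      hc.eventually heq, hc.eventually hdf, eventually_mdifferentiableWithinAt_extChartAt_symm x]
      with y h5 h6 h7 h8 h9 h10
    have e1 : T'.coord x y = T.coordOn (f ∘ e) (range I') y := by
      rw [← coordOn_pullback I'.uniqueDiffOn h6 h10 h9]
      simp only [coord, TensorField.coordOn]
      rw [← he, h8]
    rw [e1]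
    refine coordOn_comp T I'.uniqueDiffOn h6 ?_ (.of_forall fun y => mem_range_self _) h7 ?_
    · filter_upwards [h5] with y hy
      exact ((extChartAt I x₀).left_inv hy).symm
    · exact mdifferentiableWithinAt_extChartAt_symm' (h5.self_of_nhdsWithin h6)
  refine GoodCoordAt.pullback I.uniqueDiffOn I'.uniqueDiffOn hy₀r
    I'.range_subset_closure_interior hφ (.of_forall fun y => mem_range_self _) ?_ heq' ?_ hdim ?_
  · refine SymmAt.symmSmoothAt ?_ ?_
    · rw [hex]; exact (extChartAt I x₀).map_source hx
    · rw [hex, (extChartAt I x₀).left_inv hx]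
      exact hT
  · have h5 : HasMFDerivWithinAt 𝓘(ℝ, E') 𝓘(ℝ, E) ((extChartAt I x₀ ∘ f) ∘ e) (range I')
        y₀ ((mfderiv I' 𝓘(ℝ, E) (extChartAt I x₀ ∘ f) (e y₀)).comp
          (mfderivWithin 𝓘(ℝ, E') I' e (range I') y₀)) := by
      refine HasMFDerivAt.comp_hasMFDerivWithinAt _ ?_
        (mdifferentiableWithinAt_extChartAt_symm (mem_extChartAt_target x)).hasMFDerivWithinAt
      rw [hex]
      exact ((hchart.comp x hf).mdifferentiableAt (by simp)).hasMFDerivAt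
    have h6 := h5.mfderivWithin (I'.uniqueDiffOn.uniqueMDiffOn _ hy₀r)
    rw [mfderivWithin_eq_fderivWithin] at h6
    have h7 : Function.Injective (mfderiv I' 𝓘(ℝ, E) (extChartAt I x₀ ∘ f) (e y₀)) := by
      rw [hex, mfderiv_comp x (mdifferentiableAt_extChartAt (by simpa using hx))
        (hf.mdifferentiableAt (by simp))]
      obtain ⟨e', he'⟩ := isInvertible_mfderiv_extChartAt (I := I) hx
      rw [← he']
      exact e'.injective.comp hinj
    have h8 : Function.Injective (mfderivWithin 𝓘(ℝ, E') I' e (range I') y₀) := by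
      obtain ⟨e', he'⟩ := isInvertible_mfderivWithin_extChartAt_symm (I := I')
        (mem_extChartAt_target (I := I') x)
      rw [← he']
      exact e'.injective
    intro u v huv
    refine h8 (h7 ?_)
    have h9 : ∀ u, fderivWithin ℝ (fun y => extChartAt I x₀ (f (e y))) (range I') y₀ u =
      mfderiv I' 𝓘(ℝ, E) (extChartAt I x₀ ∘ f) (e y₀)
        (mfderivWithin 𝓘(ℝ, E') I' e (range I') y₀ u) := fun u =>
      congrArg (fun D : E' →L[ℝ] E => D u) h6
    exact (h9 u).symm.trans (huv.trans (h9 v))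
  · rw [hex]
    exact h

/-- Naturality of curvature conditions. -/
theorem TensorField.GoodAt.of_pullback [FiniteDimensional ℝ E] [FiniteDimensional ℝ E']
    [IsManifold I ∞ M] [IsManifold I' ∞ M'] {C : Set (AlgCurvOp d)} {T : TensorField I M}
    {T' : TensorField I' M'} {f : M' → M} {x : M'}
    (hf : ContMDiffAt I' I ∞ f x) (hinj : Function.Injective (mfderiv I' I f x))
    (hdim : Module.finrank ℝ E' = Module.finrank ℝ E) (hT : T.SymmAt (f x))
    (heq : ∀ᶠ x' in 𝓝 x, T' x' = T.pullback (I' := I') f x')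
    (h : T.GoodAt C (f x)) : T'.GoodAt C x :=
  of_pullback_chart hf hinj hdim (mem_extChartAt_source _) hT heq h

/-- Openness of curvature conditions. -/
theorem TensorField.GoodAt.eventually [FiniteDimensional ℝ E] [IsManifold I ∞ M]
    {C : Set (AlgCurvOp d)} (hC : IsOpen C) {T : P → TensorField I M}
    (hT : ∀ z, SmoothFamAt T z) (hsymm : ∀ p x u v, T p x u v = T p x v u) {z : P × M}
    (h : (T z.1).GoodAt C z.2) : ∀ᶠ z' in 𝓝 z, (T z'.1).GoodAt C z'.2 := by
  set x₀ := z.2 with hx₀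
  have hS : ∀ (p : P) (x : M), (T p).SymmAt x := fun p x =>
    ⟨SmoothFamAt.reparam (u := fun _ : Unit => p) continuousAt_const (hT (p, x)), hsymm p⟩
  have hmem := (tendsto_snd_fiber (P := P) (z.1, extChartAt I x₀ x₀)).eventually
    (extChartAt_target_mem_nhdsWithin (I := I) x₀)
  have h1 : ∀ᶠ z' in 𝓝[univ ×ˢ range I] (z.1, extChartAt I x₀ x₀),
      GoodCoordAt C (range I) ((T z'.1).coord x₀) z'.2 := by
    refine GoodCoordAt.eventually hC I.uniqueDiffOn I.range_subset_closure_interior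
      (z := (z.1, extChartAt I x₀ x₀)) (hT z 2) ?_ h
    filter_upwards [hmem] with z' hz'
    exact (hS z'.1 _).symmSmoothAt hz'
  have htend : Tendsto (fun z' : P × M => (z'.1, extChartAt I x₀ z'.2)) (𝓝 z)
      (𝓝[univ ×ˢ range I] (z.1, extChartAt I x₀ x₀)) := by
    refine tendsto_nhdsWithin_iff.2 ⟨?_, .of_forall fun z' => ⟨trivial, mem_range_self _⟩⟩
    exact (continuous_fst.tendsto z).prodMk_nhds
      ((continuousAt_extChartAt (I := I) x₀).tendsto.comp (continuous_snd.tendsto z))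
  have hsrc : ∀ᶠ z' : P × M in 𝓝 z, z'.2 ∈ (extChartAt I x₀).source :=
    (continuous_snd.tendsto z).eventually (extChartAt_source_mem_nhds x₀)
  filter_upwards [htend.eventually h1, hsrc] with z' h2 h3
  -- Openness has been obtained in the chart at `x₀`, whereas `GoodAt` at a nearby point refers to
  -- the chart at that point; naturality under the identity map compares the two.
  refine of_pullback_chart (f := id) (x := z'.2) (x₀ := x₀) contMDiffAt_id ?_ rfl h3 (hS _ _)
    (.of_forall fun x' => ?_) h2
  · rw [mfderiv_id]
    exact fun u v h => h
  · simp only [TensorField.pullback, mfderiv_id]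
    rfl

end MetricFamilies

/-! ### Functoriality and locality of pull-backs -/

section PullbackCalculus

open Set Filter

variable {E : Type} [NormedAddCommGroup E] [NormedSpace ℝ E]
  {H : Type*} [TopologicalSpace H] {I : ModelWithCorners ℝ E H}
  {M : Type*} [TopologicalSpace M] [ChartedSpace H M]
  {E' : Type} [NormedAddCommGroup E'] [NormedSpace ℝ E']
  {H' : Type*} [TopologicalSpace H'] {I' : ModelWithCorners ℝ E' H'}
  {M' : Type*} [TopologicalSpace M'] [ChartedSpace H' M']
  {E'' : Type} [NormedAddCommGroup E''] [NormedSpace ℝ E'']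
  {H'' : Type*} [TopologicalSpace H''] {I'' : ModelWithCorners ℝ E'' H''}
  {M'' : Type*} [TopologicalSpace M''] [ChartedSpace H'' M'']
  {P : Type*} [TopologicalSpace P]

namespace TensorField

theorem pullback_apply (f : M' → M) (T : TensorField I M) (x : M') (u v : TangentSpace I' x) :
    T.pullback (I' := I') f x u v = T (f x) (mfderiv I' I f x u) (mfderiv I' I f x v) := rfl

theorem apply_congr (T : TensorField I M) {x x' : M} (h : x = x') (u v : E) :
    T x u v = T x' u v := by
  subst h; rfl

theorem pullback_comp {T : TensorField I M} {g : M' → M} {f : M'' → M'} {x : M''}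
    (hg : MDifferentiableAt I' I g (f x)) (hf : MDifferentiableAt I'' I' f x) :
    (T.pullback (I' := I') g).pullback (I' := I'') f x = T.pullback (I' := I'') (g ∘ f) x := by
  ext u v
  rw [pullback_apply, pullback_apply, pullback_apply, mfderiv_comp x hg hf]
  rfl

theorem pullback_congr {T : TensorField I M} {f f' : M' → M} {x : M'} (h : f =ᶠ[𝓝 x] f') :
    T.pullback (I' := I') f x = T.pullback (I' := I') f' x := by
  ext u v
  rw [pullback_apply, pullback_apply]
  refine (T.apply_congr h.self_of_nhds _ _).trans ?_
  have h1 : ∀ w, mfderiv I' I f x w = mfderiv I' I f' x w := fun w =>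
    congrArg (fun D : E' →L[ℝ] E => D w) h.mfderiv_eq
  exact congrArg₂ (fun a b : E => T (f' x) a b) (h1 u) (h1 v)

theorem pullback_id (T : TensorField I M) (x : M) : T.pullback (I' := I) id x = T x := by
  ext u v
  rw [pullback_apply, mfderiv_id]
  rfl

/-- The pull-back at a point depends on the field at the image point only. -/
theorem pullback_congr_field {T T' : TensorField I M} {f : M' → M} {x : M'}
    (h : T (f x) = T' (f x)) : T.pullback (I' := I') f x = T'.pullback (I' := I') f x := by
  rw [pullback, h]; rfl

theorem pullback_add (T T' : TensorField I M) (f : M' → M) (x : M') :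
    (T + T').pullback (I' := I') f x = T.pullback (I' := I') f x + T'.pullback (I' := I') f x :=
  rfl

theorem pullback_dsq {ρ : M → ℝ} {f : M' → M} {x : M'} (hρ : MDifferentiableAt I 𝓘(ℝ) ρ (f x))
    (hf : MDifferentiableAt I' I f x) :
    (dsq I ρ).pullback (I' := I') f x = dsq I' (ρ ∘ f) x := by
  ext u v
  rw [pullback_apply, dsq, dsq, mfderiv_comp x hρ hf]
  rfl

theorem dsq_congr {ρ ρ' : M → ℝ} {x : M} (h : mfderiv I 𝓘(ℝ) ρ x = mfderiv I 𝓘(ℝ) ρ' x) :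
    dsq I ρ x = dsq I ρ' x := by
  ext u v
  exact congrArg (fun D : E →L[ℝ] ℝ => D u * D v) h

/-- Locality of a curvature condition is the case of the identity map in naturality. -/
theorem GoodAt.congr [FiniteDimensional ℝ E] [IsManifold I ∞ M] {d : ℕ} {C : Set (AlgCurvOp d)}
    {T T' : TensorField I M} {x : M} (h : T.GoodAt C x) (hT : T.SymmAt x) (he : ∀ᶠ x' in 𝓝 x, T' x' = T x') :
    T'.GoodAt C x := by
  refine GoodAt.of_pullback (f := id) contMDiffAt_id ?_ rfl hT ?_ h
  · rw [mfderiv_id]; exact fun u v h => h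
  · filter_upwards [he] with x' hx'
    rw [hx', pullback_id]

/-- The pull-back of a smooth family of fields along a smooth family of maps is smooth. -/
theorem SmoothFamAt.pullback_family [IsManifold I ∞ M] [IsManifold I' ∞ M']
    {T : P → TensorField I M} {f : P → M' → M} {z : P × M'} (h : SmoothFamAt T (z.1, f z.1 z.2))
    (hc : ContinuousAt (fun z' : P × M' => f z'.1 z'.2) z)
    (hd : ∀ᶠ z' in 𝓝 z, MDifferentiableAt I' I (f z'.1) z'.2)
    (hf : FamSmooth (range I') (fun p y => extChartAt I (f z.1 z.2)
      (f p ((extChartAt I' z.2).symm y))) (z.1, extChartAt I' z.2 z.2)) :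
    SmoothFamAt (fun p => (T p).pullback (I' := I') (f p)) z := by
  have hinv := extChartAt_to_inv (I := I') z.2
  set x₀ := f z.1 z.2 with hx₀
  have h1 := FamSmooth.pullback (S' := range I) (F := fun p => (T p).coord x₀) I'.uniqueDiffOn
    (mem_range_self _) hf (.of_forall fun _ => mem_range_self _) (by
      have : ((z.1, extChartAt I' z.2 z.2).1, extChartAt I x₀ (f (z.1, extChartAt I' z.2 z.2).1
        ((extChartAt I' z.2).symm (z.1, extChartAt I' z.2 z.2).2))) =
          (z.1, extChartAt I x₀ x₀) := by simp [hx₀]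
      rw [this]
      exact h)
  refine h1.congr (mem_range_self _) ?_
  have hsrc : ∀ᶠ z' : P × M' in 𝓝 z, f z'.1 z'.2 ∈ (extChartAt I x₀).source :=
    hc.eventually (extChartAt_source_mem_nhds x₀)
  have hsrc' := (tendsto_extChartAt_symm (I := I') z).eventually hsrc
  filter_upwards [(tendsto_extChartAt_symm z).eventually hd,
    eventually_nhdsWithin_fiber hsrc', eventually_mem_fiber _,
    hf.eventually_differentiable,
    (tendsto_snd_fiber (P := P) (z.1, extChartAt I' z.2 z.2)).eventually
      (eventually_mdifferentiableWithinAt_extChartAt_symm z.2)] with z' h2 h3 h4 h5 h6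
  have e1 := coordOn_pullback (T := T z'.1) I'.uniqueDiffOn h4 h6 h2
  refine e1.trans ?_
  refine coordOn_comp (T z'.1) I'.uniqueDiffOn h4 ?_ (.of_forall fun y => mem_range_self _) h5 ?_
  · filter_upwards [h3] with y hy
    exact ((extChartAt I x₀).left_inv hy).symm
  · exact mdifferentiableWithinAt_extChartAt_symm' (h3.self_of_nhdsWithin h4)

end TensorField

theorem mfderiv_injective_of_leftInverse {f : M' → M} {g : M → M'} {x : M'}
    (hg : MDifferentiableAt I I' g (f x)) (hf : MDifferentiableAt I' I f x)
    (h : g ∘ f =ᶠ[𝓝 x] id) : Function.Injective (mfderiv I' I f x) := by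
  have h3 : (mfderiv I I' g (f x)).comp (mfderiv I' I f x) = ContinuousLinearMap.id ℝ E' := by
    rw [← mfderiv_comp x hg hf]
    exact (h.mfderiv_eq (I := I') (I' := I')).trans mfderiv_id
  intro v w hvw
  have h4 := congrArg (fun L : E' →L[ℝ] E' => L v) h3
  have h5 := congrArg (fun L : E' →L[ℝ] E' => L w) h3
  exact h4.symm.trans ((congrArg (mfderiv I I' g (f x)) hvw).trans h5)

end PullbackCalculus

/-! ### Product fields b + dt² on infinite cylinders -/

section Cylinders

open Set Filter

variable {E : Type} [NormedAddCommGroup E] [NormedSpace ℝ E]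
  {H : Type*} [TopologicalSpace H] {I : ModelWithCorners ℝ E H}
  {M : Type*} [TopologicalSpace M] [ChartedSpace H M]
  {E' : Type} [NormedAddCommGroup E'] [NormedSpace ℝ E']
  {H' : Type*} [TopologicalSpace H'] {I' : ModelWithCorners ℝ E' H'}
  {M' : Type*} [TopologicalSpace M'] [ChartedSpace H' M']
  {X : Type} [NormedAddCommGroup X] [NormedSpace ℝ X]
  {P : Type*} [TopologicalSpace P]

namespace TensorField

/-- The tensor field `b + dt²` on `M × ℝ`. -/
def cylinder (b : TensorField I M) : TensorField (I.prod 𝓘(ℝ, ℝ)) (M × ℝ) :=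
  b.pullback Prod.fst + dsq (I.prod 𝓘(ℝ, ℝ)) Prod.snd

theorem pullback_cylinder (b : TensorField I M) {f : M' → M × ℝ} {x : M'}
    (h1 : MDifferentiableAt I' I (fun x => (f x).1) x)
    (h2 : MDifferentiableAt I' 𝓘(ℝ, ℝ) (fun x => (f x).2) x) :
    b.cylinder.pullback (I' := I') f x =
      b.pullback (I' := I') (fun x => (f x).1) x + dsq I' (fun x => (f x).2) x := by
  have hf : MDifferentiableAt I' (I.prod 𝓘(ℝ, ℝ)) f x := h1.prodMk h2
  rw [cylinder, pullback_add, pullback_comp mdifferentiableAt_fst hf,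
    pullback_dsq mdifferentiableAt_snd hf]
  rfl

theorem _root_.RiemMetric.stab_inner [FiniteDimensional ℝ E] [IsManifold I ∞ M]
    (b : RiemMetric I M) : b.stab.inner = TensorField.pullback (I := I) (I' := I.prod (𝓡∂ 1))
      Prod.fst b.inner + dsq (I.prod (𝓡∂ 1)) (fun q : M × Icc (0 : ℝ) 1 => (q.2 : ℝ)) := rfl

theorem _root_.mdifferentiableAt_snd_coe (q : M × Icc (0 : ℝ) 1) :
    MDifferentiableAt (I.prod (𝓡∂ 1)) 𝓘(ℝ) (fun q : M × Icc (0 : ℝ) 1 => (q.2 : ℝ)) q :=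
  ((contMDiff_subtypeVal_Icc (n := 1) q.2).mdifferentiableAt one_ne_zero).comp q
    (mdifferentiableAt_snd (I := I))

theorem pullback_stab [FiniteDimensional ℝ E] [IsManifold I ∞ M]
    (b : RiemMetric I M) {f : M' → M × Icc (0 : ℝ) 1} {x : M'}
    (hf : MDifferentiableAt I' (I.prod (𝓡∂ 1)) f x) :
    TensorField.pullback (I' := I') f b.stab.inner x =
      TensorField.pullback (I := I) (I' := I') (fun x => (f x).1) b.inner x +
        dsq I' (fun x => ((f x).2 : ℝ)) x := by
  rw [RiemMetric.stab_inner, pullback_add, pullback_comp mdifferentiableAt_fst hf,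
    pullback_dsq (mdifferentiableAt_snd_coe _) hf]
  rfl

theorem SmoothFamAt.cylinder [IsManifold I ∞ M] {b : P → TensorField I M} {z : P × (M × ℝ)}
    (h : SmoothFamAt b (z.1, z.2.1)) : SmoothFamAt (fun p => (b p).cylinder) z := by
  refine SmoothFamAt.add (SmoothFamAt.pullback h contMDiffAt_fst) (SmoothFamAt.dsq
    (SmoothFunFamAt.of_contMDiffAt (ψ := Prod.snd) contMDiffAt_snd) (.of_forall fun z' => ?_))
  exact mdifferentiableAt_snd

theorem coordOn_add (κ : X → M) (S : Set X) (T T' : TensorField I M) (y : X) :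
    (T + T').coordOn κ S y = T.coordOn κ S y + T'.coordOn κ S y := rfl

end TensorField

/-- The map `(x, t) ↦ (x, t + a)` from `M × ℝ` to `M × [0,1]`, with `t + a` projected to `[0,1]`. -/
def projCyl (a : ℝ) (z : M × ℝ) : M × Icc (0 : ℝ) 1 :=
  (z.1, projIcc 0 1 zero_le_one (z.2 + a))

/-- The projection to [0, 1] has a corner at the end 0, so at height zero only one-sided smoothness
is available. -/
theorem contMDiffWithinAt_projCyl (a : ℝ) {z : M × ℝ} (h : 0 ≤ z.2 + a) (h' : z.2 + a < 1) :
    ContMDiffWithinAt (I.prod 𝓘(ℝ, ℝ)) (I.prod (𝓡∂ 1)) ∞ (projCyl a : M × ℝ → _)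
      {z | 0 ≤ z.2 + a} z := by
  refine contMDiffWithinAt_fst.prodMk ?_
  have h1 : ContMDiffWithinAt 𝓘(ℝ, ℝ) (𝓡∂ 1) ∞ (projIcc (0 : ℝ) 1 zero_le_one) (Icc 0 1)
      (z.2 + a) := contMDiffOn_projIcc (x := (0 : ℝ)) (y := 1) (n := ∞) _ ⟨h, h'.le⟩
  have h2 : ContMDiffWithinAt (I.prod 𝓘(ℝ, ℝ)) 𝓘(ℝ, ℝ) ∞ (fun z : M × ℝ => z.2 + a)
      {z | z.2 + a ∈ Icc (0 : ℝ) 1} z := (contMDiff_snd.add contMDiff_const).contMDiffAt.contMDiffWithinAt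
  have h3 := h1.comp z h2 fun z hz => hz
  refine h3.mono_of_mem_nhdsWithin ?_
  have h4 : ∀ᶠ z' : M × ℝ in 𝓝 z, z'.2 + a < 1 := by
    have : ContinuousAt (fun z' : M × ℝ => z'.2 + a) z := by fun_prop
    exact this.eventually (eventually_lt_nhds h')
  filter_upwards [self_mem_nhdsWithin, mem_nhdsWithin_of_mem_nhds h4] with z' h5 h6
  exact ⟨h5, h6.le⟩

theorem eventually_pos_add (a : ℝ) {z : M × ℝ} (h : 0 < z.2 + a) :
    ∀ᶠ z' : M × ℝ in 𝓝 z, 0 < z'.2 + a := by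
  have : ContinuousAt (fun z' : M × ℝ => z'.2 + a) z := by fun_prop
  exact this.eventually (eventually_gt_nhds h)

theorem eventually_add_lt_one (a : ℝ) {z : M × ℝ} (h : z.2 + a < 1) :
    ∀ᶠ z' : M × ℝ in 𝓝 z, z'.2 + a < 1 := by
  have : ContinuousAt (fun z' : M × ℝ => z'.2 + a) z := by fun_prop
  exact this.eventually (eventually_lt_nhds h)

theorem contMDiffAt_projCyl (a : ℝ) {z : M × ℝ} (h : 0 < z.2 + a) (h' : z.2 + a < 1) :
    ContMDiffAt (I.prod 𝓘(ℝ, ℝ)) (I.prod (𝓡∂ 1)) ∞ (projCyl a : M × ℝ → _) z :=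
  (contMDiffWithinAt_projCyl a h.le h').contMDiffAt
    ((eventually_pos_add a h).mono fun _ h => h.le)

theorem coe_projCyl_snd {a : ℝ} {z : M × ℝ} (h : 0 ≤ z.2 + a) (h' : z.2 + a ≤ 1) :
    ((projCyl a z).2 : ℝ) = z.2 + a := by
  simp only [projCyl]
  rw [projIcc_of_mem zero_le_one ⟨h, h'⟩]

theorem eventually_coe_projCyl_snd {a : ℝ} {z : M × ℝ} (h : 0 < z.2 + a) (h' : z.2 + a < 1) :
    ∀ᶠ z' in 𝓝 z, ((projCyl a z').2 : ℝ) = z'.2 + a := by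
  filter_upwards [eventually_pos_add a h, eventually_add_lt_one a h'] with z' h1 h2
  exact coe_projCyl_snd h1.le h2.le

theorem TensorField.dsq_add_const (a : ℝ) {x : M} {ρ ρ' : M → ℝ}
    (hρ : MDifferentiableAt I 𝓘(ℝ, ℝ) ρ x) (h : ∀ᶠ x' in 𝓝 x, ρ' x' = ρ x' + a) :
    TensorField.dsq I ρ' x = TensorField.dsq I ρ x := by
  refine TensorField.dsq_congr ?_
  have h1 : ρ' =ᶠ[𝓝 x] fun x' => ρ x' + a := h
  refine (h1.mfderiv_eq (I := I) (I' := 𝓘(ℝ, ℝ))).trans ?_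
  have h2 := HasMFDerivAt.add hρ.hasMFDerivAt
    (hasMFDerivAt_const a x (I := I) (I' := 𝓘(ℝ, ℝ)))
  exact h2.mfderiv.trans (add_zero _)

theorem pullback_projCyl_stab [FiniteDimensional ℝ E] [IsManifold I ∞ M] (b : RiemMetric I M)
    {a : ℝ} {z : M × ℝ} (h : 0 < z.2 + a) (h' : z.2 + a < 1) :
    TensorField.pullback (I' := I.prod 𝓘(ℝ, ℝ)) (projCyl a) b.stab.inner z =
      TensorField.cylinder (I := I) b.inner z := by
  rw [TensorField.pullback_stab b ((contMDiffAt_projCyl a h h').mdifferentiableAt (by simp)),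
    TensorField.dsq_add_const a mdifferentiableAt_snd (eventually_coe_projCyl_snd h h')]
  rfl

theorem mfderiv_projCyl_injective [IsManifold I ∞ M] {a : ℝ} {z : M × ℝ} (h : 0 < z.2 + a)
    (h' : z.2 + a < 1) : Function.Injective (mfderiv (I.prod 𝓘(ℝ, ℝ)) (I.prod (𝓡∂ 1))
      (projCyl a : M × ℝ → _) z) := by
  have h1 : MDifferentiableAt (I.prod (𝓡∂ 1)) (I.prod 𝓘(ℝ, ℝ))
      (fun q : M × Icc (0 : ℝ) 1 => (q.1, (q.2 : ℝ) + (-a))) (projCyl a z) := by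
    have h2 : ContMDiff (I.prod (𝓡∂ 1)) 𝓘(ℝ, ℝ) ∞
      (fun q : M × Icc (0 : ℝ) 1 => (q.2 : ℝ)) := contMDiff_subtypeVal_Icc.comp contMDiff_snd
    exact (contMDiff_fst.prodMk (h2.add contMDiff_const)).contMDiffAt.mdifferentiableAt
      (n := ∞) (by simp)
  refine mfderiv_injective_of_leftInverse h1
    ((contMDiffAt_projCyl a h h').mdifferentiableAt (by simp)) ?_
  filter_upwards [eventually_coe_projCyl_snd h h'] with z' h3
  refine Prod.ext rfl ?_
  simp [h3]

/-- If the metric `b + dt²` on `M × [0,1]` satisfies a curvature condition, then so does the metric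
`b + dt²` on `M × ℝ`. -/
theorem TensorField.GoodAt.cylinder [FiniteDimensional ℝ E] [IsManifold I ∞ M] {d : ℕ}
    {C : Set (AlgCurvOp d)} {b : RiemMetric I M} 
    (h : ∀ q, TensorField.GoodAt (I := I.prod (𝓡∂ 1)) C b.stab.inner q) (z : M × ℝ) :
    (TensorField.cylinder (I := I) b.inner).GoodAt C z := by
  -- The translation moves the given height to the midpoint of [0, 1], where the projection is
  -- locally a diffeomorphism; b + dt² is invariant under it.
  have h1 : 0 < z.2 + (1 / 2 - z.2) := by linarith
  have h2 : z.2 + (1 / 2 - z.2) < 1 := by linarith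
  refine GoodAt.of_pullback (contMDiffAt_projCyl _ h1 h2) (mfderiv_projCyl_injective h1 h2) ?_ ?_ ?_
    (h (projCyl _ z))
  · simp
  · exact ⟨b.stab.smoothFamAt_const _, b.stab.symm⟩
  · filter_upwards [eventually_pos_add _ h1, eventually_add_lt_one _ h2] with z' h3 h4
    exact (pullback_projCyl_stab b h3 h4).symm

end Cylinders

/-! ### Collar coordinates and metrics of product form -/

namespace Collar

open Set Filter TensorField

variable {n : ℕ}
  {N : Type u} [TopologicalSpace N] [ChartedSpace (EuclideanSpace ℝ (Fin n)) N]
  {M : Type u} [TopologicalSpace M] [ChartedSpace (EuclideanHalfSpace (n + 1)) M]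
  {P : Type*} [TopologicalSpace P]
  {X : Type} [NormedAddCommGroup X] [NormedSpace ℝ X]

/-- The projection of a collar to the boundary. -/
def proj (c : Collar n N M) (x : M) : N := (c.toMap.symm x).1

/-- The interval coordinate of a collar. -/
def height (c : Collar n N M) (x : M) : ℝ := (c.toMap.symm x).2

/-- The collar as a map on `N × ℝ`. -/
def extend (c : Collar n N M) (z : N × ℝ) : M := c.toMap (projCyl 0 z)

theorem height_nonneg (c : Collar n N M) (x : M) : 0 ≤ c.height x := (c.toMap.symm x).2.2.1

theorem height_lt_one (c : Collar n N M) {x : M} (hx : x ∈ c.toMap.target) : c.height x < 1 := by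
  have := c.toMap.map_target hx
  rw [c.source_eq] at this
  exact this

theorem projCyl_mem_source (c : Collar n N M) {z : N × ℝ} (hz : z.2 < 1) :
    projCyl 0 z ∈ c.toMap.source := by
  rw [c.source_eq]
  simp only [projCyl, add_zero, mem_ofPred_eq, coe_projIcc]
  simp [hz]

theorem extend_mem_target (c : Collar n N M) {z : N × ℝ} (hz : z.2 < 1) :
    c.extend z ∈ c.toMap.target := c.toMap.map_source (c.projCyl_mem_source hz)

theorem symm_extend (c : Collar n N M) {z : N × ℝ} (hz : z.2 < 1) :
    c.toMap.symm (c.extend z) = projCyl 0 z := c.toMap.left_inv (c.projCyl_mem_source hz)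

theorem extend_proj_height (c : Collar n N M) {x : M} (hx : x ∈ c.toMap.target) :
    c.extend (c.proj x, c.height x) = x := by
  have : projCyl 0 (c.proj x, c.height x) = c.toMap.symm x := by
    refine Prod.ext rfl ?_
    simp only [projCyl, add_zero, height]
    exact projIcc_val zero_le_one _
  rw [extend, this, c.toMap.right_inv hx]

theorem proj_extend (c : Collar n N M) {z : N × ℝ} (hz : z.2 < 1) : c.proj (c.extend z) = z.1 := by
  rw [proj, c.symm_extend hz]; rfl

theorem height_extend (c : Collar n N M) {z : N × ℝ} (h : 0 ≤ z.2) (hz : z.2 < 1) :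
    c.height (c.extend z) = z.2 := by
  rw [height, c.symm_extend hz, coe_projCyl_snd (by simpa) (by linarith), add_zero]

theorem incl_mem_target (c : Collar n N M) (y : N) : c.incl y ∈ c.toMap.target :=
  c.toMap.map_source (c.mem_source y)

theorem proj_incl (c : Collar n N M) (y : N) : c.proj (c.incl y) = y :=
  congrArg Prod.fst (c.toMap.left_inv (c.mem_source y))

theorem height_incl (c : Collar n N M) (y : N) : c.height (c.incl y) = 0 :=
  congrArg (fun q : N × Icc (0 : ℝ) 1 => (q.2 : ℝ)) (c.toMap.left_inv (c.mem_source y))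

theorem eventually_mem_target (c : Collar n N M) {x : M} (hx : x ∈ c.toMap.target) :
    ∀ᶠ x' in 𝓝 x, x' ∈ c.toMap.target := c.toMap.open_target.mem_nhds hx

theorem contMDiffAt_symm (c : Collar n N M) {x : M} (hx : x ∈ c.toMap.target) :
    ContMDiffAt (𝓡∂ (n + 1)) ((𝓡 n).prod (𝓡∂ 1)) ∞ c.toMap.symm x :=
  c.contMDiffOn_symm.contMDiffAt (c.eventually_mem_target hx)

theorem contMDiffAt_toMap (c : Collar n N M) {q : N × Icc (0 : ℝ) 1} (hq : q ∈ c.toMap.source) :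
    ContMDiffAt ((𝓡 n).prod (𝓡∂ 1)) (𝓡∂ (n + 1)) ∞ c.toMap q :=
  c.contMDiffOn_toMap.contMDiffAt (c.toMap.open_source.mem_nhds hq)

theorem contMDiffAt_proj (c : Collar n N M) {x : M} (hx : x ∈ c.toMap.target) :
    ContMDiffAt (𝓡∂ (n + 1)) (𝓡 n) ∞ c.proj x := (c.contMDiffAt_symm hx).fst

theorem contMDiffAt_height (c : Collar n N M) {x : M} (hx : x ∈ c.toMap.target) :
    ContMDiffAt (𝓡∂ (n + 1)) 𝓘(ℝ, ℝ) ∞ c.height x :=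
  contMDiff_subtypeVal_Icc.contMDiffAt.comp x (c.contMDiffAt_symm hx).snd

theorem contMDiffWithinAt_extend (c : Collar n N M) {z : N × ℝ} (h : 0 ≤ z.2) (hz : z.2 < 1) :
    ContMDiffWithinAt ((𝓡 n).prod 𝓘(ℝ, ℝ)) (𝓡∂ (n + 1)) ∞ c.extend {z | 0 ≤ z.2} z := by
  have h1 := contMDiffWithinAt_projCyl (I := 𝓡 n) (M := N) (z := z) 0 (by simpa) (by simpa)
  simp only [add_zero] at h1
  exact (c.contMDiffAt_toMap (c.projCyl_mem_source hz)).comp_contMDiffWithinAt z h1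

theorem contMDiffAt_extend (c : Collar n N M) {z : N × ℝ} (h : 0 < z.2) (hz : z.2 < 1) :
    ContMDiffAt ((𝓡 n).prod 𝓘(ℝ, ℝ)) (𝓡∂ (n + 1)) ∞ c.extend z :=
  (c.contMDiffAt_toMap (c.projCyl_mem_source hz)).comp z
    (contMDiffAt_projCyl 0 (by simpa) (by simpa))

theorem mfderiv_extend_injective (c : Collar n N M) {z : N × ℝ} (h : 0 < z.2) (hz : z.2 < 1) :
    Function.Injective (mfderiv ((𝓡 n).prod 𝓘(ℝ, ℝ)) (𝓡∂ (n + 1)) c.extend z) := by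
  have hx := c.extend_mem_target hz
  refine mfderiv_injective_of_leftInverse (g := fun x => (c.proj x, c.height x))
    (((c.contMDiffAt_proj hx).prodMk (c.contMDiffAt_height hx)).mdifferentiableAt (by simp))
    ((c.contMDiffAt_extend h hz).mdifferentiableAt (by simp)) ?_
  have h1 := eventually_pos_add (z := z) 0 (by simpa)
  have h2 := eventually_add_lt_one (z := z) 0 (by simpa)
  simp only [add_zero] at h1 h2
  filter_upwards [h1, h2] with z' h3 h4
  exact Prod.ext (c.proj_extend h4) (c.height_extend h3.le h4)

/-- `proj` and `height` are the two components of the inverse collar, which is an immersion, and a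
tangent vector of N × [0, 1] is determined by its two components. -/
theorem eq_zero_of_mfderiv_proj_height [IsManifold (𝓡 n) ∞ N] [IsManifold (𝓡∂ (n + 1)) ∞ M]
    (c : Collar n N M) {x : M} (hx : x ∈ c.toMap.target)
    {v : TangentSpace (𝓡∂ (n + 1)) x} (h1 : mfderiv (𝓡∂ (n + 1)) (𝓡 n) c.proj x v = 0)
    (h2 : mfderiv (𝓡∂ (n + 1)) 𝓘(ℝ, ℝ) c.height x v = 0) : v = 0 := by
  have hs := (c.contMDiffAt_symm hx).mdifferentiableAt (by simp)
  have hsrc := c.toMap.map_target hx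
  have hinj : Function.Injective
      (mfderiv (𝓡∂ (n + 1)) ((𝓡 n).prod (𝓡∂ 1)) c.toMap.symm x) := by
    refine mfderiv_injective_of_leftInverse
      ((c.contMDiffAt_toMap hsrc).mdifferentiableAt (by simp)) hs ?_
    filter_upwards [c.eventually_mem_target hx] with x' hx'
    exact c.toMap.right_inv hx'
  refine hinj (Eq.trans ?_ (map_zero _).symm)
  refine eq_zero_of_intervalForm _ _ ?_ ?_
  · have h3 := mfderiv_comp x (mdifferentiableAt_fst (I := 𝓡 n) (I' := 𝓡∂ 1)) hs
    exact (congrArg (fun L => L v) h3).symm.trans h1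
  · have h3 := mfderiv_comp x (mdifferentiableAt_snd_coe (I := 𝓡 n) (c.toMap.symm x)) hs
    exact (congrArg (fun L => L v) h3).symm.trans h2

variable [IsManifold (𝓡 n) ∞ N] [IsManifold (𝓡∂ (n + 1)) ∞ M]

theorem res_inner (c : Collar n N M) (g : RiemMetric (𝓡∂ (n + 1)) M) :
    (c.res g).inner = TensorField.pullback (I := 𝓡∂ (n + 1)) (I' := 𝓡 n) c.incl g.inner := rfl

theorem mem_metrics_iff (c : Collar n N M) (g : RiemMetric (𝓡∂ (n + 1)) M) :
    g ∈ c.metrics ↔ ∃ ε : ℝ, 0 < ε ∧ ∀ q : N × Icc (0 : ℝ) 1, (q.2 : ℝ) < ε →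
      TensorField.pullback (I := 𝓡∂ (n + 1)) (I' := (𝓡 n).prod (𝓡∂ 1)) c.toMap g.inner q =
        (c.res g).stab.inner q := Iff.rfl

/-- `g` is of product form on the part of the collar of height less than `ε`. -/
def IsProductBelow (c : Collar n N M) (g : RiemMetric (𝓡∂ (n + 1)) M) (ε : ℝ) : Prop :=
  ∀ q : N × Icc (0 : ℝ) 1, (q.2 : ℝ) < ε →
    TensorField.pullback (I := 𝓡∂ (n + 1)) (I' := (𝓡 n).prod (𝓡∂ 1)) c.toMap g.inner q =
      (c.res g).stab.inner q

/-- This form includes height zero, where `extend` has only one-sided derivatives; hence derivatives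
within `S` in place of a pull-back. -/
theorem IsProductBelow.coordOn_extend {c : Collar n N M} {g : RiemMetric (𝓡∂ (n + 1)) M} {ε : ℝ}
    (hg : c.IsProductBelow g ε) {κ : X → N × ℝ} {S : Set X} {y : X} (hS : UniqueDiffOn ℝ S)
    (hy : y ∈ S) (hκ : MDifferentiableWithinAt 𝓘(ℝ, X) ((𝓡 n).prod 𝓘(ℝ, ℝ)) κ S y)
    (hpos : ∀ x ∈ S, 0 ≤ (κ x).2) (h1 : (κ y).2 < 1) (hε : (κ y).2 < ε) :
    TensorField.coordOn (I := 𝓡∂ (n + 1)) (c.extend ∘ κ) S g.inner y =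
      (TensorField.cylinder (I := 𝓡 n) (c.res g).inner).coordOn κ S y := by
  have hpos' := hpos y hy
  have hcoe : ((projCyl 0 (κ y)).2 : ℝ) = (κ y).2 := by
    rw [coe_projCyl_snd (by simpa) (by linarith), add_zero]
  have hd : MDifferentiableWithinAt 𝓘(ℝ, X) ((𝓡 n).prod (𝓡∂ 1)) (projCyl 0 ∘ κ) S y := by
    have h2 := contMDiffWithinAt_projCyl (I := 𝓡 n) (M := N) (z := κ y) 0 (by simpa) (by simpa)
    simp only [add_zero] at h2
    exact (h2.mdifferentiableWithinAt (by simp)).comp y hκ hpos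
  have e1 := coordOn_pullback (T := g.inner) hS hy hd
    ((c.contMDiffAt_toMap (c.projCyl_mem_source h1)).mdifferentiableAt (by simp))
  have e2 : (TensorField.pullback (I := 𝓡∂ (n + 1)) (I' := (𝓡 n).prod (𝓡∂ 1)) c.toMap
      g.inner).coordOn (projCyl 0 ∘ κ) S y =
      TensorField.coordOn (I := (𝓡 n).prod (𝓡∂ 1)) (projCyl 0 ∘ κ) S (c.res g).stab.inner y := by
    have := hg (projCyl 0 (κ y)) (by rw [hcoe]; exact hε)
    simp only [TensorField.coordOn, Function.comp_apply]
    rw [this]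
  refine e1.symm.trans (e2.trans ?_)
  rw [RiemMetric.stab_inner, coordOn_add, cylinder, coordOn_add,
    coordOn_pullback hS hy hd mdifferentiableAt_fst,
    coordOn_pullback hS hy hκ mdifferentiableAt_fst,
    coordOn_dsq hS hy hd (mdifferentiableAt_snd_coe _), coordOn_dsq hS hy hκ mdifferentiableAt_snd]
  congr 2
  have hlt : ∀ᶠ x in 𝓝[S] y, (κ x).2 < 1 :=
    (continuous_snd.continuousAt.comp_continuousWithinAt hκ.continuousWithinAt).eventually
      (eventually_lt_nhds h1)
  refine Filter.EventuallyEq.fderivWithin_eq ?_ ?_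
  · filter_upwards [hlt, self_mem_nhdsWithin] with x hx hxS
    have hx0 := hpos x hxS
    exact (coe_projCyl_snd (by simpa) (by linarith)).trans (add_zero _)
  · exact hcoe

theorem IsProductBelow.pullback_extend {c : Collar n N M} {g : RiemMetric (𝓡∂ (n + 1)) M} {ε : ℝ}
    (hg : c.IsProductBelow g ε) {z : N × ℝ} (hpos : 0 < z.2) (h1 : z.2 < 1) (hε : z.2 < ε) :
    TensorField.pullback (I := 𝓡∂ (n + 1)) (I' := (𝓡 n).prod 𝓘(ℝ, ℝ)) c.extend g.inner z =
      TensorField.cylinder (I := 𝓡 n) (c.res g).inner z := by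
  have hp : 0 < z.2 + 0 := by simpa
  have hp' : z.2 + 0 < 1 := by simpa
  have e1 := pullback_comp (T := g.inner)
    ((c.contMDiffAt_toMap (c.projCyl_mem_source h1)).mdifferentiableAt (by simp))
    ((contMDiffAt_projCyl (I := 𝓡 n) 0 hp hp').mdifferentiableAt (by simp))
  refine e1.symm.trans ?_
  rw [← pullback_projCyl_stab _ hp hp']
  refine pullback_congr_field (hg _ ?_)
  rw [coe_projCyl_snd hp.le hp'.le, add_zero]
  exact hε

theorem IsProductBelow.inner_eq {c : Collar n N M} {g : RiemMetric (𝓡∂ (n + 1)) M} {ε : ℝ}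
    (hg : c.IsProductBelow g ε) {x : M} (hx : x ∈ c.toMap.target) (hε : c.height x < ε) :
    g.inner x = TensorField.pullback (I := 𝓡 n) (I' := 𝓡∂ (n + 1)) c.proj (c.res g).inner x +
      dsq (𝓡∂ (n + 1)) c.height x := by
  have hs := (c.contMDiffAt_symm hx).mdifferentiableAt (by simp)
  have hsrc := c.toMap.map_target hx
  have e0 := (pullback_id (I := 𝓡∂ (n + 1)) g.inner x).symm
  have e1 : TensorField.pullback (I := 𝓡∂ (n + 1)) (I' := 𝓡∂ (n + 1)) id g.inner x =
      TensorField.pullback (I := 𝓡∂ (n + 1)) (I' := 𝓡∂ (n + 1)) (c.toMap ∘ c.toMap.symm)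
        g.inner x := by
    refine pullback_congr ?_
    filter_upwards [c.eventually_mem_target hx] with x' hx'
    exact (c.toMap.right_inv hx').symm
  rw [e0, e1, ← pullback_comp ((c.contMDiffAt_toMap hsrc).mdifferentiableAt (by simp)) hs]
  exact (pullback_congr_field (hg _ hε)).trans (pullback_stab _ hs)

end Collar

/-! ### Extending a metric beyond the boundary by a cylinder -/

namespace Collar

open Set Filter TensorField

variable {n : ℕ}
  {N : Type u} [TopologicalSpace N] [ChartedSpace (EuclideanSpace ℝ (Fin n)) N]
  {M : Type u} [TopologicalSpace M] [ChartedSpace (EuclideanHalfSpace (n + 1)) M]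
  {P : Type*} [TopologicalSpace P]
  [IsManifold (𝓡 n) ∞ N] [IsManifold (𝓡∂ (n + 1)) ∞ M]

theorem _root_.TensorField.coordOn_of_mem_nhds {E : Type} [NormedAddCommGroup E] [NormedSpace ℝ E]
    {H : Type*} [TopologicalSpace H] {I : ModelWithCorners ℝ E H}
    {M : Type*} [TopologicalSpace M] [ChartedSpace H M]
    {X : Type} [NormedAddCommGroup X] [NormedSpace ℝ X] (T : TensorField I M) (κ : X → M)
    {S : Set X} {y : X} (h : S ∈ 𝓝 y) : T.coordOn κ S y = T.coordOn κ univ y := by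
  simp only [TensorField.coordOn]
  rw [mfderivWithin_of_mem_nhds h, mfderivWithin_univ]

/-- The field on `N × ℝ` that is the pull-back of `g` along the collar for `t > 0`, and of product
form for `t ≤ 0`. -/
def extTensor (c : Collar n N M) (g : RiemMetric (𝓡∂ (n + 1)) M) :
    TensorField ((𝓡 n).prod 𝓘(ℝ, ℝ)) (N × ℝ) := fun z =>
  if 0 < z.2 then TensorField.pullback (I := 𝓡∂ (n + 1)) (I' := (𝓡 n).prod 𝓘(ℝ, ℝ)) c.extend g.inner z
  else TensorField.cylinder (I := 𝓡 n) (c.res g).inner z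

theorem extTensor_of_pos (c : Collar n N M) (g : RiemMetric (𝓡∂ (n + 1)) M) {z : N × ℝ}
    (h : 0 < z.2) : c.extTensor g z =
      TensorField.pullback (I := 𝓡∂ (n + 1)) (I' := (𝓡 n).prod 𝓘(ℝ, ℝ)) c.extend g.inner z :=
  if_pos h

theorem extTensor_of_nonpos (c : Collar n N M) (g : RiemMetric (𝓡∂ (n + 1)) M) {z : N × ℝ}
    (h : z.2 ≤ 0) :
    c.extTensor g z = TensorField.cylinder (I := 𝓡 n) (c.res g).inner z :=
  if_neg h.not_gt

theorem IsProductBelow.extTensor {c : Collar n N M} {g : RiemMetric (𝓡∂ (n + 1)) M} {ε : ℝ}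
    (hg : c.IsProductBelow g ε) {z : N × ℝ} (h1 : z.2 < 1) (hε : z.2 < ε) :
    c.extTensor g z = TensorField.cylinder (I := 𝓡 n) (c.res g).inner z := by
  by_cases h : 0 < z.2
  · rw [extTensor_of_pos _ _ h, hg.pullback_extend h h1 hε]
  · exact extTensor_of_nonpos _ _ (not_lt.1 h)

theorem extTensor_symm (c : Collar n N M) (g : RiemMetric (𝓡∂ (n + 1)) M) (z : N × ℝ)
    (u v : TangentSpace ((𝓡 n).prod 𝓘(ℝ, ℝ)) z) :
    c.extTensor g z u v = c.extTensor g z v u := by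
  by_cases h : 0 < z.2
  · rw [extTensor_of_pos _ _ h]
    exact g.symm _ _ _
  · rw [extTensor_of_nonpos _ _ (not_lt.1 h)]
    exact congrArg₂ (· + ·) ((c.res g).symm _ _ _) (mul_comm _ _)

theorem smoothFamAt_res (c : Collar n N M) {h : P → RiemMetric (𝓡∂ (n + 1)) M}
    (hh : Continuous h) (z : P × N) : SmoothFamAt (I := 𝓡 n) (fun p => (c.res (h p)).inner) z :=
  SmoothFamAt.pullback (RiemMetric.smoothFamAt_of_continuous hh _) c.contMDiff_incl.contMDiffAt

theorem continuous_res (c : Collar n N M) : Continuous c.res :=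
  RiemMetric.continuous_of_smoothFamAt fun z => c.smoothFamAt_res continuous_id z

/-- The width of the product collar of `h p` may tend to zero as `p` varies, so the extended family
need not be a family of cylinders near height 0. On the closed half-space, however, the difference
between the metric and its product model is a continuous smooth family, each member of which
vanishes near height 0. Its extension by zero, added to the cylinder, is the extended field. -/
theorem smoothFamAt_extTensor_zero (c : Collar n N M) {h : P → RiemMetric (𝓡∂ (n + 1)) M}
    (hh : Continuous h) (hm : ∀ p, h p ∈ c.metrics) (p : P) (y₀ : N) :
    SmoothFamAt (fun p => c.extTensor (h p)) (p, ((y₀, 0) : N × ℝ)) := by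
  classical
  set x₀ : N × ℝ := (y₀, 0) with hx₀
  set κ := (extChartAt ((𝓡 n).prod 𝓘(ℝ, ℝ)) x₀).symm with hκ
  set w₀ := extChartAt ((𝓡 n).prod 𝓘(ℝ, ℝ)) x₀ x₀ with hw₀
  have hrange : range ((𝓡 n).prod 𝓘(ℝ, ℝ)) = univ := ModelWithCorners.range_eq_univ _
  have hκ2 : ∀ w, (κ w).2 = w.2 := fun w => rfl
  have hκw : κ w₀ = x₀ := extChartAt_to_inv x₀
  have hw2 : w₀.2 = 0 := by rw [← hκ2, hκw]
  let S : Set (EuclideanSpace ℝ (Fin n) × ℝ) := univ ×ˢ Ici 0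
  let O : Set (EuclideanSpace ℝ (Fin n) × ℝ) := univ ×ˢ Ioi 0
  have hS : UniqueDiffOn ℝ S := uniqueDiffOn_univ.prod (uniqueDiffOn_Ici 0)
  have hO : IsOpen O := isOpen_univ.prod isOpen_Ioi
  have hOS : O ⊆ S := fun w hw => ⟨hw.1, (show (0 : ℝ) < w.2 from hw.2).le⟩
  have hcl : closure O = S := by
    simp only [O, S, closure_prod_eq, closure_univ, closure_Ioi]
  have hfr : ∀ w ∈ frontier O, w.2 = 0 := fun w hw => by
    rw [hO.frontier_eq, hcl] at hw
    exact le_antisymm (not_lt.1 fun h => hw.2 ⟨trivial, h⟩) hw.1.2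
  have hwS : w₀ ∈ S := ⟨trivial, hw2.ge⟩
  let cyl : P → TensorField ((𝓡 n).prod 𝓘(ℝ, ℝ)) (N × ℝ) := fun p =>
    TensorField.cylinder (I := 𝓡 n) (c.res (h p)).inner
  have hcyl : ∀ z, SmoothFamAt cyl z := fun z => SmoothFamAt.cylinder (c.smoothFamAt_res hh _)
  have hκs : ContMDiffWithinAt 𝓘(ℝ, EuclideanSpace ℝ (Fin n) × ℝ) ((𝓡 n).prod 𝓘(ℝ, ℝ)) ∞ κ S w₀ :=
    (contMDiffWithinAt_extChartAt_symm_self x₀).mono (by rw [hrange]; exact subset_univ _)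
  have hκd : ∀ᶠ w in 𝓝 w₀, MDifferentiableAt 𝓘(ℝ, EuclideanSpace ℝ (Fin n) × ℝ)
      ((𝓡 n).prod 𝓘(ℝ, ℝ)) κ w := by
    have := eventually_mdifferentiableWithinAt_extChartAt_symm (I := (𝓡 n).prod 𝓘(ℝ, ℝ)) x₀
    rw [hrange, nhdsWithin_univ] at this
    exact this.mono fun w hw => mdifferentiableWithinAt_univ.1 hw
  have hlt : ∀ᶠ w : EuclideanSpace ℝ (Fin n) × ℝ in 𝓝 w₀, w.2 < 1 :=
    continuous_snd.continuousAt.eventually (eventually_lt_nhds (by rw [hw2]; exact one_pos))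
  have htend : Tendsto Prod.snd (𝓝 (p, w₀)) (𝓝 w₀) := continuous_snd.tendsto (p, w₀)
  -- The metric minus its product model, on the closed half-space of nonnegative heights.
  let F : P → EuclideanSpace ℝ (Fin n) × ℝ → _ := fun p w =>
    TensorField.coordOn (I := 𝓡∂ (n + 1)) (c.extend ∘ κ) S (h p).inner w +
      (-1 : ℝ) • (cyl p).coordOn κ S w
  have hF : FamSmooth S F (p, w₀) := by
    intro k
    refine FamCk.add hS hwS ?_ ?_
    · refine SmoothFamAt.coordOn (z := (p, w₀)) (RiemMetric.smoothFamAt_of_continuous hh _) hS hwS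
        ?_ k
      refine ContMDiffWithinAt.comp (t := {z | 0 ≤ z.2}) w₀ ?_ hκs fun w hw => ?_
      · rw [hκw]; exact c.contMDiffWithinAt_extend le_rfl one_pos
      · exact hw.2.trans_eq (hκ2 w).symm
    · exact FamCk.clm hS hwS ((-1 : ℝ) • ContinuousLinearMap.id ℝ _)
        (SmoothFamAt.coordOn (z := (p, w₀)) (hcyl _) hS hwS hκs k)
  have hE : FamSmooth univ (fun p w => if w ∈ O then F p w else 0) (p, w₀) := by
    intro k
    refine FamCk.extend_zero hO hOS hcl.subset (hF k) (hcl ▸ hwS) ?_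
    filter_upwards [htend.eventually (eventually_eventually_nhds.2 hκd)] with z' h1 h2
    -- This `ε` depends on the parameter; `FamCk.extend_zero` asks for no uniformity.
    obtain ⟨ε, hε, hprod⟩ := hm z'.1
    have h3 : ∀ᶠ w : EuclideanSpace ℝ (Fin n) × ℝ in 𝓝 z'.2, w.2 < min ε 1 :=
      continuous_snd.continuousAt.eventually
        (eventually_lt_nhds (by rw [hfr _ h2]; exact lt_min hε one_pos))
    filter_upwards [mem_nhdsWithin_of_mem_nhds h1, mem_nhdsWithin_of_mem_nhds h3,
      self_mem_nhdsWithin] with w h4 h5 h6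
    have e := IsProductBelow.coordOn_extend (c := c) (g := h z'.1) hprod hS h6
      h4.mdifferentiableWithinAt (fun x hx => (hκ2 x).symm ▸ hx.2)
      ((hκ2 w).symm ▸ h5.trans_le (min_le_right _ _))
      ((hκ2 w).symm ▸ h5.trans_le (min_le_left _ _))
    simp only [F]
    rw [e, neg_one_smul]
    exact add_neg_cancel _
  have hmain : FamSmooth univ (fun p w => (cyl p).coordOn κ univ w +
      (if w ∈ O then F p w else 0)) (p, w₀) := by
    intro k
    have h1 : FamSmooth _ _ _ := hcyl (p, x₀)
    simp only [coord] at h1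
    rw [hrange] at h1
    exact FamCk.add uniqueDiffOn_univ (mem_univ _) (h1 k) (hE k)
  unfold SmoothFamAt
  simp only [coord]
  rw [hrange]
  refine hmain.congr (mem_univ _) ?_
  rw [univ_prod_univ, nhdsWithin_univ]
  filter_upwards [htend.eventually hκd, htend.eventually hlt] with z' h1 h2
  by_cases h3 : z'.2 ∈ O
  · have h4 : (0 : ℝ) < (κ z'.2).2 := (hκ2 z'.2).symm ▸ h3.2
    have h5 : (κ z'.2).2 < 1 := (hκ2 z'.2).symm ▸ h2
    have hSn : S ∈ 𝓝 z'.2 := mem_of_superset (hO.mem_nhds h3) hOS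
    have e1 := coordOn_pullback (T := (h z'.1).inner) hS (hOS h3)
      h1.mdifferentiableWithinAt ((c.contMDiffAt_extend h4 h5).mdifferentiableAt (by simp))
    simp only [if_pos h3, F]
    rw [← e1, coordOn_of_mem_nhds _ _ hSn, coordOn_of_mem_nhds _ _ hSn, neg_one_smul]
    refine Eq.trans ?_ (add_neg_cancel_comm_assoc _ _).symm
    simp only [TensorField.coordOn]
    rw [c.extTensor_of_pos _ h4]
  · have h4 : (κ z'.2).2 ≤ 0 := (hκ2 z'.2).symm ▸ not_lt.1 fun h => h3 ⟨trivial, h⟩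
    simp only [if_neg h3, add_zero]
    simp only [TensorField.coordOn]
    rw [c.extTensor_of_nonpos _ h4]

theorem smoothFamAt_extTensor (c : Collar n N M) {h : P → RiemMetric (𝓡∂ (n + 1)) M}
    (hh : Continuous h) (hm : ∀ p, h p ∈ c.metrics) {z : P × (N × ℝ)} (hz : z.2.2 < 1) :
    SmoothFamAt (fun p => c.extTensor (h p)) z := by
  have hsnd : Continuous fun z : P × (N × ℝ) => z.2.2 := by fun_prop
  rcases lt_trichotomy z.2.2 0 with h0 | h0 | h0
  · refine SmoothFamAt.congr (SmoothFamAt.cylinder (c.smoothFamAt_res hh _)) ?_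
    filter_upwards [hsnd.continuousAt.eventually (eventually_lt_nhds h0)] with z' h1
    exact c.extTensor_of_nonpos _ h1.le
  · obtain ⟨p, y, t⟩ := z
    obtain rfl : t = 0 := h0
    exact c.smoothFamAt_extTensor_zero hh hm p y
  · refine SmoothFamAt.congr (SmoothFamAt.pullback (RiemMetric.smoothFamAt_of_continuous hh _)
      (c.contMDiffAt_extend h0 hz)) ?_
    filter_upwards [hsnd.continuousAt.eventually (eventually_gt_nhds h0)] with z' h1
    exact c.extTensor_of_pos _ h1

end Collar

/-! ### Stretching collars -/

/-- A smooth function equal to `1` for `t ≤ a` and to `0` for `t ≥ a + 1 / 4`. -/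
def rampDown (a t : ℝ) : ℝ := 1 - Real.smoothTransition (4 * (t - a))

theorem rampDown_of_le {a t : ℝ} (h : t ≤ a) : rampDown a t = 1 := by
  rw [rampDown, Real.smoothTransition.zero_of_nonpos (by linarith), sub_zero]

theorem rampDown_of_ge {a t : ℝ} (h : a + 1 / 4 ≤ t) : rampDown a t = 0 := by
  rw [rampDown, Real.smoothTransition.one_of_one_le (by linarith), sub_self]

theorem rampDown_nonneg (a t : ℝ) : 0 ≤ rampDown a t :=
  sub_nonneg.2 (Real.smoothTransition.le_one _)

theorem rampDown_le_one (a t : ℝ) : rampDown a t ≤ 1 :=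
  sub_le_self _ (Real.smoothTransition.nonneg _)

theorem rampDown_antitone (a : ℝ) : Antitone (rampDown a) := fun _ _ h =>
  sub_le_sub_left (Real.smoothTransition.monotone (by linarith)) _

theorem contDiff_rampDown (a : ℝ) : ContDiff ℝ ∞ (rampDown a) :=
  contDiff_const.sub (Real.smoothTransition.contDiff.comp
    (contDiff_const.mul (contDiff_id.sub contDiff_const)))

/-- A diffeomorphism that stretches the interval `[0, 1]` to `[-s / 2, 1]`. -/
def stretch (s r : ℝ) : ℝ := r - s / 2 * rampDown (1 / 4) r

theorem stretch_of_le {s r : ℝ} (h : r ≤ 1 / 4) : stretch s r = r - s / 2 := by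
  rw [stretch, rampDown_of_le h, mul_one]

theorem stretch_of_ge {s r : ℝ} (h : 1 / 2 ≤ r) : stretch s r = r := by
  rw [stretch, rampDown_of_ge (by linarith), mul_zero, sub_zero]

theorem stretch_zero (r : ℝ) : stretch 0 r = r := by simp [stretch]

theorem stretch_le {s : ℝ} (hs : 0 ≤ s) (r : ℝ) : stretch s r ≤ r :=
  sub_le_self _ (mul_nonneg (by linarith) (rampDown_nonneg _ _))

theorem le_stretch {s : ℝ} (hs : 0 ≤ s) (r : ℝ) : r - s / 2 ≤ stretch s r :=
  sub_le_sub_left (mul_le_of_le_one_right (by linarith) (rampDown_le_one _ _)) _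

theorem contDiff_stretch (s : ℝ) : ContDiff ℝ ∞ (stretch s) :=
  contDiff_id.sub (contDiff_const.mul (contDiff_rampDown _))

/-- Subtracting a multiple of a decreasing ramp can only increase the slope, which is therefore at
least 1. -/
theorem deriv_stretch_pos {s : ℝ} (hs : 0 ≤ s) (r : ℝ) : 0 < deriv (stretch s) r := by
  have h1 : DifferentiableAt ℝ (rampDown (1 / 4)) r :=
    ((contDiff_rampDown _).differentiable (by simp)) r
  have h2 : deriv (rampDown (1 / 4)) r ≤ 0 := (rampDown_antitone _).deriv_nonpos
  have h3 : HasDerivAt (stretch s) (1 - s / 2 * deriv (rampDown (1 / 4)) r) r :=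
    (hasDerivAt_id r).sub (h1.hasDerivAt.const_mul _)
  rw [h3.deriv]
  nlinarith

section

open Set Filter

variable {E : Type} [NormedAddCommGroup E] [NormedSpace ℝ E]
  {H : Type*} [TopologicalSpace H] {I : ModelWithCorners ℝ E H}
  {M : Type*} [TopologicalSpace M] [ChartedSpace H M]
  {P : Type*} [TopologicalSpace P]

theorem SmoothFunFamAt.contDiff_comp {φ : ℝ → ℝ} (hφ : ContDiff ℝ ∞ φ) {ψ : P → M → ℝ} {z : P × M}
    (h : SmoothFunFamAt I ψ z) : SmoothFunFamAt I (fun p x => φ (ψ p x)) z := fun k =>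
  FamCk.comp (F := fun _ => φ) (S := univ) I.uniqueDiffOn (mem_range_self _) (h k)
    (.of_forall fun _ => mem_univ _)
    (FamSmooth.of_contDiffWithinAt uniqueDiffOn_univ (mem_univ _) hφ.contDiffAt.contDiffWithinAt k)

end

/-! ### Interpolation between two boundary metrics -/

namespace TensorField

open Set Filter

variable {E : Type} [NormedAddCommGroup E] [NormedSpace ℝ E]
  {H : Type*} [TopologicalSpace H] {I : ModelWithCorners ℝ E H}
  {M : Type*} [TopologicalSpace M] [ChartedSpace H M]
  {P : Type*} [TopologicalSpace P]

/-- The field `χ(t + s / 2) (b' - b)` on `M × ℝ`, where `χ` is a cut-off function. -/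
def blend (b b' : TensorField I M) (s : ℝ) : TensorField (I.prod 𝓘(ℝ, ℝ)) (M × ℝ) := fun z =>
  rampDown (1 / 8) (z.2 + s / 2) • b'.pullback (I' := I.prod 𝓘(ℝ, ℝ)) Prod.fst z +
    (-1 * rampDown (1 / 8) (z.2 + s / 2)) • b.pullback (I' := I.prod 𝓘(ℝ, ℝ)) Prod.fst z

theorem blend_self (b : TensorField I M) (s : ℝ) (z : M × ℝ) : b.blend b s z = 0 := by
  rw [blend, ← add_smul]
  simp

theorem cylinder_add_blend_self (b : TensorField I M) (s : ℝ) :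
    (fun z => b.cylinder z + b.blend b s z) = b.cylinder :=
  funext fun z => by rw [blend_self, add_zero]

/-- The ramp ends at 1/8 + 1/4 = 3/8. For s = 1 this is height -1/8, so the interpolation is
confined to the attached cylinder, which is the decisive case. -/
theorem blend_of_ge (b b' : TensorField I M) {s : ℝ} {z : M × ℝ} (h : 3 / 8 ≤ z.2 + s / 2) :
    b.blend b' s z = 0 := by
  rw [blend, rampDown_of_ge (by linarith)]
  simp

theorem cylinder_add_blend_of_le (b b' : TensorField I M) {s : ℝ} {z : M × ℝ}
    (h : z.2 + s / 2 ≤ 1 / 8) : b.cylinder z + b.blend b' s z = b'.cylinder z := by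
  rw [blend, rampDown_of_le h]
  simp only [cylinder, Pi.add_apply]
  module

theorem SmoothFamAt.blend [IsManifold I ∞ M] {b b' : P → TensorField I M} {s : P → ℝ}
    {z : P × (M × ℝ)} (h : SmoothFamAt b (z.1, z.2.1)) (h' : SmoothFamAt b' (z.1, z.2.1))
    (hs : ContinuousAt s z.1) : SmoothFamAt (fun p => (b p).blend (b' p) (s p)) z := by
  have h1 : SmoothFunFamAt (I.prod 𝓘(ℝ, ℝ))
      (fun p (z : M × ℝ) => rampDown (1 / 8) (z.2 + s p / 2)) z :=
    SmoothFunFamAt.contDiff_comp (contDiff_rampDown _) (SmoothFunFamAt.add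
      (SmoothFunFamAt.of_contMDiffAt (ψ := Prod.snd) contMDiffAt_snd)
      (SmoothFunFamAt.of_param (hs.div_const 2)))
  exact SmoothFamAt.add (SmoothFamAt.smul h1 (SmoothFamAt.pullback h' contMDiffAt_fst))
    (SmoothFamAt.smul (SmoothFunFamAt.mul (SmoothFunFamAt.of_param continuousAt_const) h1)
      (SmoothFamAt.pullback h contMDiffAt_fst))

theorem blend_symm {b b' : TensorField I M} (h : ∀ x u v, b x u v = b x v u)
    (h' : ∀ x u v, b' x u v = b' x v u) (s : ℝ) (z : M × ℝ)
    (u v : TangentSpace (I.prod 𝓘(ℝ, ℝ)) z) : b.blend b' s z u v = b.blend b' s z v u :=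
  congrArg₂ (fun a a' => rampDown (1 / 8) (z.2 + s / 2) * a +
    (-1 * rampDown (1 / 8) (z.2 + s / 2)) * a') (h' _ _ _) (h _ _ _)

theorem cylinder_symm {b : TensorField I M} (h : ∀ x u v, b x u v = b x v u) (z : M × ℝ)
    (u v : TangentSpace (I.prod 𝓘(ℝ, ℝ)) z) : b.cylinder z u v = b.cylinder z v u :=
  congrArg₂ (· + ·) (h _ _ _) (mul_comm _ _)

end TensorField

/-! ### The stretched collar -/

namespace Collar

open Set Filter TensorField

variable {n : ℕ}
  {N : Type u} [TopologicalSpace N] [ChartedSpace (EuclideanSpace ℝ (Fin n)) N]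
  {M : Type u} [TopologicalSpace M] [ChartedSpace (EuclideanHalfSpace (n + 1)) M]
  {P : Type*} [TopologicalSpace P]

/-- The map from the collar to `N × ℝ` that stretches the collar. -/
def stretchMap (c : Collar n N M) (s : ℝ) (x : M) : N × ℝ := (c.proj x, stretch s (c.height x))

theorem contMDiffAt_stretchMap (c : Collar n N M) (s : ℝ) {x : M} (hx : x ∈ c.toMap.target) :
    ContMDiffAt (𝓡∂ (n + 1)) ((𝓡 n).prod 𝓘(ℝ, ℝ)) ∞ (c.stretchMap s) x :=
  (c.contMDiffAt_proj hx).prodMk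
    ((contDiff_stretch s).contMDiff.contMDiffAt.comp x (c.contMDiffAt_height hx))

variable [IsManifold (𝓡 n) ∞ N] [IsManifold (𝓡∂ (n + 1)) ∞ M]

/-- A vector in the kernel has vanishing boundary component, and vanishing height component because
the stretching function has positive slope. -/
theorem mfderiv_stretchMap_injective (c : Collar n N M) {s : ℝ} (hs : 0 ≤ s) {x : M}
    (hx : x ∈ c.toMap.target) : Function.Injective
      (mfderiv (𝓡∂ (n + 1)) ((𝓡 n).prod 𝓘(ℝ, ℝ)) (c.stretchMap s) x) := by
  have hd := (c.contMDiffAt_stretchMap s hx).mdifferentiableAt (by simp)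
  have hh := (c.contMDiffAt_height hx).mdifferentiableAt (by simp)
  refine (injective_iff_map_eq_zero _).2 fun v hv => c.eq_zero_of_mfderiv_proj_height hx ?_ ?_
  · have h3 := mfderiv_comp x (mdifferentiableAt_fst (I := 𝓡 n) (I' := 𝓘(ℝ, ℝ))) hd
    refine (congrArg (fun L => L v) h3).trans ?_
    exact (congrArg (mfderiv ((𝓡 n).prod 𝓘(ℝ, ℝ)) (𝓡 n) Prod.fst (c.stretchMap s x)) hv).trans
      (map_zero _)
  · have h3 := mfderiv_comp x (mdifferentiableAt_snd (I := 𝓡 n) (I' := 𝓘(ℝ, ℝ))) hd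
    have h4 : mfderiv (𝓡∂ (n + 1)) 𝓘(ℝ, ℝ) (Prod.snd ∘ c.stretchMap s) x v = 0 :=
      (congrArg (fun L => L v) h3).trans
        ((congrArg (mfderiv ((𝓡 n).prod 𝓘(ℝ, ℝ)) 𝓘(ℝ, ℝ) Prod.snd (c.stretchMap s x)) hv).trans
          (map_zero _))
    have h5 : HasMFDerivAt 𝓘(ℝ, ℝ) 𝓘(ℝ, ℝ) (stretch s) (c.height x)
        (fderiv ℝ (stretch s) (c.height x)) :=
      (((contDiff_stretch s).differentiable (by simp)) _).hasFDerivAt.hasMFDerivAt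
    have h6 := (h5.comp x hh.hasMFDerivAt).mfderiv
    have h7 : fderiv ℝ (stretch s) (c.height x)
        (mfderiv (𝓡∂ (n + 1)) 𝓘(ℝ, ℝ) c.height x v) = 0 :=
      (congrArg (fun L => L v) h6).symm.trans h4
    have key : ∀ w : ℝ, fderiv ℝ (stretch s) (c.height x) w = 0 → w = 0 := fun w hw => by
      rw [fderiv_eq_smul_deriv, smul_eq_mul] at hw
      exact (mul_eq_zero.1 hw).resolve_right (deriv_stretch_pos hs _).ne'
    exact key _ h7

end Collar

open Set Filter in
theorem FamSmooth.prodMk {P : Type*} [TopologicalSpace P]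
    {E V W : Type} [NormedAddCommGroup E] [NormedSpace ℝ E] [NormedAddCommGroup V] [NormedSpace ℝ V]
    [NormedAddCommGroup W] [NormedSpace ℝ W] {S : Set E} {z : P × E} (hS : UniqueDiffOn ℝ S)
    (hz : z.2 ∈ S) {F : P → E → V} {G : P → E → W} (hF : FamSmooth S F z) (hG : FamSmooth S G z) :
    FamSmooth S (fun p y => (F p y, G p y)) z := fun k =>
  (FamCk.add hS hz (FamCk.clm hS hz (ContinuousLinearMap.inl ℝ V W) (hF k))
    (FamCk.clm hS hz (ContinuousLinearMap.inr ℝ V W) (hG k))).congr hz (.of_forall fun _ => by simp)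

/-! ### Deformed metrics: values near the boundary, away from it, and continuity -/

namespace Collar

open Set Filter TensorField

variable {n : ℕ}
  {N : Type u} [TopologicalSpace N] [ChartedSpace (EuclideanSpace ℝ (Fin n)) N]
  {M : Type u} [TopologicalSpace M] [ChartedSpace (EuclideanHalfSpace (n + 1)) M]
  {P : Type*} [TopologicalSpace P]
  [IsManifold (𝓡 n) ∞ N] [IsManifold (𝓡∂ (n + 1)) ∞ M]

/-- The field on `N × ℝ` of which the deformed metrics are pull-backs on the collar. -/
def modelTensor (c : Collar n N M) (g : RiemMetric (𝓡∂ (n + 1)) M) (b : RiemMetric (𝓡 n) N)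
    (s : ℝ) : TensorField ((𝓡 n).prod 𝓘(ℝ, ℝ)) (N × ℝ) :=
  fun z => c.extTensor g z + TensorField.blend (I := 𝓡 n) (c.res g).inner b.inner s z

open Classical in
/-- The deformation of `g` that stretches the collar by `s / 2` and changes the metric on the
boundary to `b`. -/
def deform (c : Collar n N M) (g : RiemMetric (𝓡∂ (n + 1)) M) (b : RiemMetric (𝓡 n) N) (s : ℝ) :
    TensorField (𝓡∂ (n + 1)) M := fun x =>
  if x ∈ c.toMap.target then
    (c.modelTensor g b s).pullback (I' := 𝓡∂ (n + 1)) (c.stretchMap s) x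
  else g.inner x

variable (c : Collar n N M) (g : RiemMetric (𝓡∂ (n + 1)) M) (b : RiemMetric (𝓡 n) N)

theorem deform_of_mem (s : ℝ) {x : M} (hx : x ∈ c.toMap.target) :
    c.deform g b s x = (c.modelTensor g b s).pullback (I' := 𝓡∂ (n + 1)) (c.stretchMap s) x :=
  if_pos hx

theorem modelTensor_symm (s : ℝ) (z : N × ℝ) (u v : TangentSpace ((𝓡 n).prod 𝓘(ℝ, ℝ)) z) :
    c.modelTensor g b s z u v = c.modelTensor g b s z v u :=
  congrArg₂ (· + ·) (c.extTensor_symm g z u v) (blend_symm (c.res g).symm b.symm s z u v)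

theorem deform_symm (s : ℝ) (x : M) (u v : TangentSpace (𝓡∂ (n + 1)) x) :
    c.deform g b s x u v = c.deform g b s x v u := by
  by_cases hx : x ∈ c.toMap.target
  · rw [c.deform_of_mem g b s hx]
    exact c.modelTensor_symm g b s _ _ _
  · rw [deform, if_neg hx]
    exact g.symm x u v

theorem smoothFamAt_modelTensor {h : P → RiemMetric (𝓡∂ (n + 1)) M} {b : P → RiemMetric (𝓡 n) N}
    {s : P → ℝ} (hh : Continuous h) (hm : ∀ p, h p ∈ c.metrics) (hb : Continuous b)
    (hs : Continuous s) {z : P × (N × ℝ)} (hz : z.2.2 < 1) :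
    SmoothFamAt (fun p => c.modelTensor (h p) (b p) (s p)) z :=
  SmoothFamAt.add (c.smoothFamAt_extTensor hh hm hz)
    (SmoothFamAt.blend (c.smoothFamAt_res hh _) (RiemMetric.smoothFamAt_of_continuous hb _)
      hs.continuousAt)

theorem eventually_lt_height {a : ℝ} {x : M} (hx : x ∈ c.toMap.target) (h : a < c.height x) :
    ∀ᶠ x' in 𝓝 x, a < c.height x' :=
  (c.contMDiffAt_height hx).continuousAt.eventually (eventually_gt_nhds h)

theorem eventually_height_lt {a : ℝ} {x : M} (hx : x ∈ c.toMap.target) (h : c.height x < a) :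
    ∀ᶠ x' in 𝓝 x, c.height x' < a :=
  (c.contMDiffAt_height hx).continuousAt.eventually (eventually_lt_nhds h)

/-- Where the stretching is locally the identity, `extend` undoes `stretchMap`, so pulling back
twice returns `g`. Agreement near `x` is required because pull-backs involve derivatives. -/
theorem deform_eq_of_pos {s : ℝ} {x : M} (hx : x ∈ c.toMap.target) (h : 0 < c.height x)
    (hs : ∀ᶠ x' in 𝓝 x, stretch s (c.height x') = c.height x')
    (hbl : TensorField.blend (I := 𝓡 n) (c.res g).inner b.inner s (c.stretchMap s x) = 0) :
    c.deform g b s x = g.inner x := by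
  have e1 : (c.stretchMap s x).2 = c.height x := hs.self_of_nhds
  have h1 : 0 < (c.stretchMap s x).2 := e1 ▸ h
  have h2 : (c.stretchMap s x).2 < 1 := e1 ▸ c.height_lt_one hx
  rw [c.deform_of_mem g b s hx]
  have e2 : c.modelTensor g b s (c.stretchMap s x) =
      TensorField.pullback (I := 𝓡∂ (n + 1)) (I' := (𝓡 n).prod 𝓘(ℝ, ℝ)) c.extend g.inner
        (c.stretchMap s x) := by
    rw [modelTensor, hbl, add_zero, c.extTensor_of_pos g h1]
  rw [pullback_congr_field e2, pullback_comp
    ((c.contMDiffAt_extend h1 h2).mdifferentiableAt (by simp))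
    ((c.contMDiffAt_stretchMap s hx).mdifferentiableAt (by simp))]
  refine (pullback_congr ?_).trans (pullback_id (I := 𝓡∂ (n + 1)) g.inner x)
  filter_upwards [hs, c.eventually_mem_target hx] with x' h3 h4
  have : c.stretchMap s x' = (c.proj x', c.height x') := Prod.ext rfl h3
  rw [Function.comp_apply, this, c.extend_proj_height h4, id]

theorem deform_eq_of_half_lt {s : ℝ} (hs : 0 ≤ s) {x : M} (hx : x ∈ c.toMap.target)
    (h : 1 / 2 < c.height x) : c.deform g b s x = g.inner x := by
  have h1 : ∀ᶠ x' in 𝓝 x, stretch s (c.height x') = c.height x' := by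
    filter_upwards [c.eventually_lt_height hx h] with x' hx'
    exact stretch_of_ge hx'.le
  refine c.deform_eq_of_pos g b hx (by linarith) h1 (blend_of_ge _ _ ?_)
  have : (c.stretchMap s x).2 = c.height x := h1.self_of_nhds
  linarith

/-- At heights below 1/8 the stretching is a translation and the cut-off is 1; below `ε` the field
being modified is still the cylinder over the old boundary metric. The translation does not affect
dt². -/
theorem deform_eq_of_lt {ε s : ℝ} (hg : c.IsProductBelow g ε) (hs : 0 ≤ s) {x : M}
    (hx : x ∈ c.toMap.target) (h : c.height x < 1 / 8) (hε : c.height x < ε) :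
    c.deform g b s x = TensorField.pullback (I := 𝓡 n) (I' := 𝓡∂ (n + 1)) c.proj b.inner x +
      dsq (𝓡∂ (n + 1)) c.height x := by
  have e0 : (c.stretchMap s x).2 = c.height x - s / 2 := stretch_of_le (by linarith)
  have e1 : c.modelTensor g b s (c.stretchMap s x) =
      TensorField.cylinder (I := 𝓡 n) b.inner (c.stretchMap s x) := by
    rw [modelTensor, hg.extTensor (by linarith) (by linarith), cylinder_add_blend_of_le]
    linarith
  have hh := (c.contMDiffAt_height hx).mdifferentiableAt (by simp)
  rw [c.deform_of_mem g b s hx, pullback_congr_field e1, pullback_cylinder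
    (f := c.stretchMap s) b.inner ((c.contMDiffAt_proj hx).mdifferentiableAt (by simp))
    ((c.contMDiffAt_stretchMap s hx).snd.mdifferentiableAt (by simp))]
  congr 1
  refine dsq_add_const (-(s / 2)) hh ?_
  filter_upwards [c.eventually_height_lt hx h] with x' hx'
  exact stretch_of_le (by linarith)

theorem deform_zero (hg : g ∈ c.metrics) (x : M) : c.deform g (c.res g) 0 x = g.inner x := by
  by_cases hx : x ∈ c.toMap.target
  -- On the boundary `extend` is not available as a two-sided smooth map, so the product form is
  -- used there instead.
  · rcases (c.height_nonneg x).eq_or_lt with h0 | h0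
    · obtain ⟨ε, hε, hprod⟩ := hg
      rw [c.deform_eq_of_lt g _ hprod le_rfl hx (by rw [← h0]; norm_num) (by rw [← h0]; exact hε)]
      exact (IsProductBelow.inner_eq (c := c) hprod hx (by rw [← h0]; exact hε)).symm
    · exact c.deform_eq_of_pos g _ hx h0 (.of_forall fun _ => stretch_zero _) (blend_self _ _ _)
  · rw [deform, if_neg hx]

/-- The part of the collar of height at most 1/2 is compact, hence closed in `M`, and outside of it
no deformation changes the metric. One neighbourhood therefore serves all `g`, `b` and `s`. -/
theorem eventually_deform_eq [CompactSpace N] [T2Space M] {x : M} (hx : x ∉ c.toMap.target) :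
    ∀ᶠ x' in 𝓝 x, ∀ (g : RiemMetric (𝓡∂ (n + 1)) M) (b : RiemMetric (𝓡 n) N) (s : ℝ), 0 ≤ s →
      c.deform g b s x' = g.inner x' := by
  let K : Set (N × Icc (0 : ℝ) 1) := {q | (q.2 : ℝ) ≤ 1 / 2}
  have hKs : K ⊆ c.toMap.source := fun q hq => by
    rw [c.source_eq]
    have : (q.2 : ℝ) ≤ 1 / 2 := hq
    show (q.2 : ℝ) < 1
    linarith
  have hK : IsCompact K := (isClosed_le (by fun_prop) continuous_const).isCompact
  have hK' : IsClosed (c.toMap '' K) := (hK.image_of_continuousOn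
    (c.toMap.continuousOn.mono hKs)).isClosed
  have hxK : x ∉ c.toMap '' K := by
    rintro ⟨q, hq, rfl⟩
    exact hx (c.toMap.map_source (hKs hq))
  filter_upwards [hK'.isOpen_compl.mem_nhds hxK] with x' hx' g b s hs
  by_cases h : x' ∈ c.toMap.target
  · refine c.deform_eq_of_half_lt g b hs h (not_le.1 fun h1 => hx' ?_)
    exact ⟨c.toMap.symm x', h1, c.toMap.right_inv h⟩
  · rw [deform, if_neg h]

theorem smoothFamAt_deform [CompactSpace N] [T2Space M] {h : P → RiemMetric (𝓡∂ (n + 1)) M}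
    {b : P → RiemMetric (𝓡 n) N} {s : P → ℝ} (hh : Continuous h) (hm : ∀ p, h p ∈ c.metrics)
    (hb : Continuous b) (hs : Continuous s) (hs0 : ∀ p, 0 ≤ s p) (z : P × M) :
    SmoothFamAt (fun p => c.deform (h p) (b p) (s p)) z := by
  by_cases hx : z.2 ∈ c.toMap.target
  · have hmem : ∀ᶠ z' : P × M in 𝓝 z, z'.2 ∈ c.toMap.target :=
      continuous_snd.continuousAt.eventually (c.eventually_mem_target hx)
    have hproj : ContinuousAt (fun z' : P × M => c.proj z'.2) z :=
      ContinuousAt.comp (f := Prod.snd) (c.contMDiffAt_proj hx).continuousAt continuousAt_snd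
    have hheight : ContinuousAt (fun z' : P × M => c.height z'.2) z :=
      ContinuousAt.comp (f := Prod.snd) (c.contMDiffAt_height hx).continuousAt continuousAt_snd
    have hs' : ContinuousAt (fun z' : P × M => s z'.1) z := (hs.comp continuous_fst).continuousAt
    refine SmoothFamAt.congr (SmoothFamAt.pullback_family (I := (𝓡 n).prod 𝓘(ℝ, ℝ))
      (T := fun p => c.modelTensor (h p) (b p) (s p)) (f := fun p => c.stretchMap (s p)) ?_ ?_ ?_ ?_) ?_
    · exact c.smoothFamAt_modelTensor hh hm hb hs
        ((stretch_le (hs0 _) _).trans_lt (c.height_lt_one hx))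
    · refine hproj.prodMk (hheight.sub ((hs'.div_const 2).mul ?_))
      exact (contDiff_rampDown (1 / 4)).continuous.continuousAt.comp hheight
    · filter_upwards [hmem] with z' hz'
      exact (c.contMDiffAt_stretchMap _ hz').mdifferentiableAt (by simp)
    · refine FamSmooth.prodMk (F := fun _ y => extChartAt (𝓡 n) (c.proj z.2)
        (c.proj ((extChartAt (𝓡∂ (n + 1)) z.2).symm y))) (ModelWithCorners.uniqueDiffOn _)
        (mem_range_self _) ?_ ?_
      · refine FamSmooth.of_contDiffWithinAt (ModelWithCorners.uniqueDiffOn _)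
          (mem_range_self _) ?_
        have h1 : ContMDiffAt (𝓡∂ (n + 1)) 𝓘(ℝ, EuclideanSpace ℝ (Fin n)) ∞
            (extChartAt (𝓡 n) (c.proj z.2) ∘ c.proj) z.2 :=
          contMDiffAt_extChartAt.comp z.2 (c.contMDiffAt_proj hx)
        have h2 : ContMDiffAt (𝓡∂ (n + 1)) 𝓘(ℝ, EuclideanSpace ℝ (Fin n)) ∞
            (extChartAt (𝓡 n) (c.proj z.2) ∘ c.proj) ((extChartAt (𝓡∂ (n + 1)) z.2).symm
              (extChartAt (𝓡∂ (n + 1)) z.2 z.2)) := by rwa [extChartAt_to_inv]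
        exact contMDiffWithinAt_iff_contDiffWithinAt.1
          (h2.comp_contMDiffWithinAt _ (contMDiffWithinAt_extChartAt_symm_self z.2))
      · have h1 : SmoothFunFamAt (𝓡∂ (n + 1)) (fun _ : P => c.height) z :=
          SmoothFunFamAt.of_contMDiffAt (c.contMDiffAt_height hx)
        have h2 := SmoothFunFamAt.add h1 (SmoothFunFamAt.mul
          (SmoothFunFamAt.of_param (I := 𝓡∂ (n + 1)) (M := M) (σ := fun p => -(s p / 2)) (z := z)
            (by fun_prop))
          (SmoothFunFamAt.contDiff_comp (contDiff_rampDown (1 / 4)) h1))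
        -- The height component of the stretching depends on the parameter only through the factor
        -- `s p / 2`, so it is built from sums and products of known families.
        refine FamSmooth.congr h2 (mem_range_self _) (.of_forall fun z' => ?_)
        show stretch _ _ = _
        simp only [stretch]
        ring
    · filter_upwards [hmem] with z' hz'
      exact c.deform_of_mem _ _ _ hz'
  · refine SmoothFamAt.congr (RiemMetric.smoothFamAt_of_continuous hh z) ?_
    have := (continuous_snd.tendsto z).eventually (c.eventually_deform_eq hx)
    filter_upwards [this] with z' hz'
    exact hz' _ _ _ (hs0 _)

end Collar

/-! ### Curvature and boundary behaviour of deformed metrics -/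

namespace Collar

open Set Filter TensorField

variable {n : ℕ}
  {N : Type u} [TopologicalSpace N] [ChartedSpace (EuclideanSpace ℝ (Fin n)) N]
  {M : Type u} [TopologicalSpace M] [ChartedSpace (EuclideanHalfSpace (n + 1)) M]
  [IsManifold (𝓡 n) ∞ N] [IsManifold (𝓡∂ (n + 1)) ∞ M]
  (c : Collar n N M) {g : RiemMetric (𝓡∂ (n + 1)) M} {b : RiemMetric (𝓡 n) N}
  {d : ℕ} {C : Set (AlgCurvOp d)}

theorem symmAt_modelTensor (hg : g ∈ c.metrics) (s : ℝ) {z : N × ℝ} (hz : z.2 < 1) :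
    (c.modelTensor g b s).SymmAt z :=
  ⟨c.smoothFamAt_modelTensor (P := Unit) (h := fun _ => g) (b := fun _ => b) (s := fun _ => s)
    continuous_const (fun _ => hg) continuous_const continuous_const hz,
    c.modelTensor_symm g b s⟩

/-- At nonpositive heights the product collar of `g` provides a neighbourhood on which only boundary
metrics enter, and `hgood` applies. At positive heights either alternative in `hs` kills the
interpolation term, full stretching or an unchanged boundary metric, and the field is a pull-back of
`g`. -/
theorem modelTensor_goodAt (hg : g ∈ c.metrics)
    (hC : ∀ x, TensorField.GoodAt (I := 𝓡∂ (n + 1)) C g.inner x) {s : ℝ}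
    (hs : s = 1 ∨ b = c.res g)
    (hgood : ∀ z : N × ℝ, z.2 ∈ Icc (-(1 / 2)) 0 → TensorField.GoodAt C (fun z =>
      TensorField.cylinder (I := 𝓡 n) (c.res g).inner z +
        TensorField.blend (I := 𝓡 n) (c.res g).inner b.inner s z) z) {z : N × ℝ}
    (hz : -(1 / 2) ≤ z.2) (hz1 : z.2 < 1) : (c.modelTensor g b s).GoodAt C z := by
  rcases le_or_gt z.2 0 with h0 | h0
  · obtain ⟨ε, hε, hprod⟩ := hg
    refine GoodAt.congr (hgood z ⟨hz, h0⟩) ⟨?_, fun z u v => ?_⟩ ?_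
    · exact SmoothFamAt.add (SmoothFamAt.cylinder ((c.res g).smoothFamAt_const _))
        (SmoothFamAt.blend ((c.res g).smoothFamAt_const _) (b.smoothFamAt_const _)
          continuousAt_const)
    · exact congrArg₂ (· + ·) (cylinder_symm (c.res g).symm z u v)
        (blend_symm (c.res g).symm b.symm s z u v)
    · filter_upwards [continuousAt_snd.eventually (eventually_lt_nhds (h0.trans_lt hε)),
        continuousAt_snd.eventually (eventually_lt_nhds hz1)] with z' h1 h2
      rw [modelTensor, IsProductBelow.extTensor (c := c) hprod h2 h1]
  · refine GoodAt.of_pullback (c.contMDiffAt_extend h0 hz1) (c.mfderiv_extend_injective h0 hz1)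
      (by simp) ⟨g.smoothFamAt_const _, g.symm⟩ ?_ (hC _)
    filter_upwards [continuousAt_snd.eventually (eventually_gt_nhds h0)] with z' h1
    rw [modelTensor, c.extTensor_of_pos g h1]
    have h1' : (0 : ℝ) < z'.2 := h1
    have : TensorField.blend (I := 𝓡 n) (c.res g).inner b.inner s z' = 0 := by
      rcases hs with rfl | rfl
      · exact blend_of_ge _ _ (by linarith)
      · exact blend_self _ _ _
    rw [this, add_zero]

theorem deform_goodAt [CompactSpace N] [T2Space M] (hg : g ∈ c.metrics)
    (hC : ∀ x, TensorField.GoodAt (I := 𝓡∂ (n + 1)) C g.inner x) {s : ℝ} (hs0 : 0 ≤ s)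
    (hs1 : s ≤ 1) (hs : s = 1 ∨ b = c.res g)
    (hgood : ∀ z : N × ℝ, z.2 ∈ Icc (-(1 / 2)) 0 → TensorField.GoodAt C (fun z =>
      TensorField.cylinder (I := 𝓡 n) (c.res g).inner z +
        TensorField.blend (I := 𝓡 n) (c.res g).inner b.inner s z) z) (x : M) :
    (c.deform g b s).GoodAt C x := by
  by_cases hx : x ∈ c.toMap.target
  · have h1 : (c.stretchMap s x).2 < 1 := (stretch_le hs0 _).trans_lt (c.height_lt_one hx)
    have h2 : -(1 / 2) ≤ (c.stretchMap s x).2 :=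
      le_trans (by linarith [c.height_nonneg x]) (le_stretch hs0 (c.height x))
    refine GoodAt.of_pullback (c.contMDiffAt_stretchMap s hx)
      (c.mfderiv_stretchMap_injective hs0 hx) (by simp) (c.symmAt_modelTensor hg s h1) ?_
      (c.modelTensor_goodAt hg hC hs hgood h2 h1)
    filter_upwards [c.eventually_mem_target hx] with x' hx'
    exact c.deform_of_mem g b s hx'
  · refine GoodAt.congr (hC x) ⟨g.smoothFamAt_const _, g.symm⟩ ?_
    filter_upwards [c.eventually_deform_eq hx] with x' hx'
    exact hx' g b s hs0

/-- On the boundary, `proj` restricts to the identity and `height` to a constant, so only `b`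
survives in the product form. -/
theorem res_eq_of_inner_eq_deform {L : RiemMetric (𝓡∂ (n + 1)) M} (hg : g ∈ c.metrics) {s : ℝ}
    (hs : 0 ≤ s) (hL : L.inner = c.deform g b s) : c.res L = b := by
  obtain ⟨ε, hε, hprod⟩ := hg
  refine RiemMetric.ext_inner (funext fun y => ?_)
  have hmem := c.incl_mem_target y
  have h0 := c.height_incl y
  have hi := (c.contMDiff_incl y).mdifferentiableAt (by simp)
  have hp := (c.contMDiffAt_proj hmem).mdifferentiableAt (by simp)
  have hh := (c.contMDiffAt_height hmem).mdifferentiableAt (by simp)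
  have e : L.inner (c.incl y) =
      (TensorField.pullback (I := 𝓡 n) (I' := 𝓡∂ (n + 1)) c.proj b.inner +
        dsq (𝓡∂ (n + 1)) c.height) (c.incl y) := by
    rw [hL, c.deform_eq_of_lt g b hprod hs hmem (by rw [h0]; norm_num) (by rw [h0]; exact hε)]
    rfl
  rw [res_inner, pullback_congr_field e, pullback_add, pullback_comp hp hi, pullback_dsq hh hi]
  have e1 : c.proj ∘ c.incl = id := funext c.proj_incl
  have e2 : c.height ∘ c.incl = fun _ => 0 := funext c.height_incl
  rw [e1, e2]
  refine (congrArg₂ (· + ·) (pullback_id (I := 𝓡 n) b.inner y) ?_).trans (add_zero _)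
  ext u v
  simp only [dsq, mfderiv_const]
  exact mul_zero _

theorem mem_metrics_of_inner_eq_deform {L : RiemMetric (𝓡∂ (n + 1)) M} (hg : g ∈ c.metrics)
    {s : ℝ} (hs : 0 ≤ s) (hL : L.inner = c.deform g b s) : L ∈ c.metrics := by
  have hres := c.res_eq_of_inner_eq_deform hg hs hL
  obtain ⟨ε, hε, hprod⟩ := hg
  -- Both bounds come from `deform_eq_of_lt`: `ε` from the product collar of `g`, and 1/8 from the
  -- place where the cut-off stops being 1.
  refine (c.mem_metrics_iff L).2 ⟨min ε (1 / 8), lt_min hε (by norm_num), fun q hq => ?_⟩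
  have hq1 : (q.2 : ℝ) < 1 / 8 := hq.trans_le (min_le_right _ _)
  have hsrc : q ∈ c.toMap.source := by
    rw [c.source_eq]
    exact hq1.trans (by norm_num)
  have hmem := c.toMap.map_source hsrc
  have hh' : c.height (c.toMap q) = q.2 := by rw [height, c.toMap.left_inv hsrc]
  have hi := (c.contMDiffAt_toMap hsrc).mdifferentiableAt (by simp)
  have hp := (c.contMDiffAt_proj hmem).mdifferentiableAt (by simp)
  have hh := (c.contMDiffAt_height hmem).mdifferentiableAt (by simp)
  have e : L.inner (c.toMap q) =
      (TensorField.pullback (I := 𝓡 n) (I' := 𝓡∂ (n + 1)) c.proj b.inner +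
        dsq (𝓡∂ (n + 1)) c.height) (c.toMap q) := by
    rw [hL, c.deform_eq_of_lt g b hprod hs hmem (by rw [hh']; exact hq1)
      (by rw [hh']; exact hq.trans_le (min_le_left _ _))]
    rfl
  rw [hres, pullback_congr_field e, pullback_add, pullback_comp hp hi, pullback_dsq hh hi,
    RiemMetric.stab_inner]
  have hev : ∀ᶠ q' in 𝓝 q, q' ∈ c.toMap.source := c.toMap.open_source.mem_nhds hsrc
  refine congrArg₂ (· + ·) (pullback_congr ?_) (dsq_congr (Filter.EventuallyEq.mfderiv_eq ?_))
  · filter_upwards [hev] with q' hq'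
    simp [proj, c.toMap.left_inv hq']
  · filter_upwards [hev] with q' hq'
    simp [height, c.toMap.left_inv hq']

end Collar

/-! ### Concatenation of short lifts -/

open Set Filter in
/-- Lifts over short time intervals of uniform length can be composed. -/
theorem exists_lift_of_short_lifts {A X Y : Type*} [TopologicalSpace A] [TopologicalSpace X]
    {p : X → Y} {γ : A × ℝ → Y} {δ : ℝ} (hδ : 0 < δ)
    (hstep : ∀ τ ∈ Icc (0 : ℝ) 1, ∀ h : A → X, Continuous h → (∀ a, p (h a) = γ (a, τ)) →
      ∃ L : A × ℝ → X, Continuous L ∧ (∀ a, L (a, τ) = h a) ∧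
        ∀ a, ∀ t ∈ Icc τ (τ + δ), p (L (a, t)) = γ (a, t))
    {h : A → X} (hh : Continuous h) (h0 : ∀ a, p (h a) = γ (a, 0)) :
    ∃ L : A × ℝ → X, Continuous L ∧ (∀ a, L (a, 0) = h a) ∧
      ∀ a, ∀ t ∈ Icc (0 : ℝ) 1, p (L (a, t)) = γ (a, t) := by
  -- The maps are defined and continuous for all real times but need to cover `γ` only up to time `j
  -- * δ`, truncated at 1; a new piece thus only has to agree with the old one at the junction.
  have key : ∀ j : ℕ, ∃ L : A × ℝ → X, Continuous L ∧ (∀ a, L (a, 0) = h a) ∧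
      ∀ a, ∀ t ∈ Icc (0 : ℝ) (min 1 (j * δ)), p (L (a, t)) = γ (a, t) := by
    intro j
    induction j with
    | zero =>
      refine ⟨fun z => h z.1, hh.comp continuous_fst, fun a => rfl, fun a t ht => ?_⟩
      have h1 : t ≤ 0 := ht.2.trans (by simp)
      obtain rfl : t = 0 := le_antisymm h1 ht.1
      exact h0 a
    | succ j ih =>
      obtain ⟨L, hL, hL0, hLp⟩ := ih
      set τ := min 1 (j * δ) with hτ
      have hτ0 : 0 ≤ τ := le_min zero_le_one (by positivity)
      obtain ⟨L', hL', hL'0, hL'p⟩ := hstep τ ⟨hτ0, min_le_left _ _⟩ (fun a => L (a, τ))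
        (by fun_prop) (fun a => hLp a τ ⟨hτ0, le_rfl⟩)
      refine ⟨fun z => if z.2 ≤ τ then L z else L' z, ?_, fun a => ?_, fun a t ht => ?_⟩
      · refine hL.if_le hL' continuous_snd continuous_const fun z hz => ?_
        have : z = (z.1, τ) := Prod.ext rfl hz
        rw [this, hL'0]
      · simp only [if_pos hτ0, hL0]
      · by_cases h1 : t ≤ τ
        · simp only [if_pos h1]
          exact hLp a t ⟨ht.1, h1⟩
        · simp only [if_neg h1]
          refine hL'p a t ⟨(not_le.1 h1).le, ht.2.trans ?_⟩
          rcases min_cases 1 (j * δ) with h2 | h2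
          · rw [hτ, h2.1]
            exact (min_le_left _ _).trans (by linarith)
          · rw [hτ, h2.1]
            refine (min_le_right _ _).trans ?_
            push_cast
            linarith
  obtain ⟨j, hj⟩ := exists_nat_ge (1 / δ)
  obtain ⟨L, hL, hL0, hLp⟩ := key j
  refine ⟨L, hL, hL0, fun a t ht => hLp a t ⟨ht.1, le_min ht.2 (ht.2.trans ?_)⟩⟩
  rwa [div_le_iff₀ hδ] at hj

/-! ### The two compactness estimates -/

namespace Collar

open Set Filter TensorField

variable {n : ℕ}
  {N : Type u} [TopologicalSpace N] [ChartedSpace (EuclideanSpace ℝ (Fin n)) N]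
  {M : Type u} [TopologicalSpace M] [ChartedSpace (EuclideanHalfSpace (n + 1)) M]
  [IsManifold (𝓡 n) ∞ N] [IsManifold (𝓡∂ (n + 1)) ∞ M]
  {d : ℕ} {C : Set (AlgCurvOp d)}

/-- For `e = 0` the interpolation is between equal metrics, so the field is a good cylinder;
openness and compactness of the parameters and of N × [-1/2, 0] do the rest. No metric on `M`
occurs, which is why the resulting time step is the same for all lifts. -/
theorem _root_.eventually_cylinder_add_blend_goodAt [CompactSpace N] (hC : IsOpen C)
    {B : Type*} [TopologicalSpace B] [CompactSpace B] {β : ℝ × B → RiemMetric (𝓡 n) N}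
    (hβ : Continuous β) (hgood : ∀ (p : B) (q : N × Icc (0 : ℝ) 1),
      TensorField.GoodAt (I := (𝓡 n).prod (𝓡∂ 1)) C (β (0, p)).stab.inner q) :
    ∀ᶠ e in 𝓝 (0 : ℝ), ∀ (p : B) (z : N × ℝ), z.2 ∈ Icc (-(1 / 2)) 0 →
      TensorField.GoodAt C (fun z => TensorField.cylinder (I := 𝓡 n) (β (0, p)).inner z +
        TensorField.blend (I := 𝓡 n) (β (0, p)).inner (β (e, p)).inner 1 z) z := by
  let T : ℝ × B → TensorField ((𝓡 n).prod 𝓘(ℝ, ℝ)) (N × ℝ) := fun p z =>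
    TensorField.cylinder (I := 𝓡 n) (β (0, p.2)).inner z +
      TensorField.blend (I := 𝓡 n) (β (0, p.2)).inner (β p).inner 1 z
  have hβ0 : Continuous fun p : ℝ × B => β (0, p.2) := by fun_prop
  have hT : ∀ z, SmoothFamAt T z := fun z =>
    SmoothFamAt.add (SmoothFamAt.cylinder (RiemMetric.smoothFamAt_of_continuous hβ0 _))
      (SmoothFamAt.blend (RiemMetric.smoothFamAt_of_continuous hβ0 _)
        (RiemMetric.smoothFamAt_of_continuous hβ _) continuousAt_const)
  have hsymm : ∀ p z u v, T p z u v = T p z v u := fun p z u v =>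
    congrArg₂ (· + ·) (cylinder_symm (β (0, p.2)).symm z u v)
      (blend_symm (β (0, p.2)).symm (β p).symm 1 z u v)
  have h1 := IsCompact.eventually_forall_of_forall_eventually (x₀ := (0 : ℝ))
    (K := (univ ×ˢ (univ ×ˢ Icc (-(1 / 2)) 0) : Set (B × (N × ℝ))))
    (P := fun e y => (T (e, y.1)).GoodAt C y.2)
    (isCompact_univ.prod (isCompact_univ.prod isCompact_Icc)) (fun y _ => by
      have h2 : (T (0, y.1)).GoodAt C y.2 := by
        have : T (0, y.1) = TensorField.cylinder (I := 𝓡 n) (β (0, y.1)).inner :=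
          cylinder_add_blend_self _ _
        rw [this]
        exact GoodAt.cylinder (hgood y.1) y.2
      have h3 := GoodAt.eventually hC hT hsymm (z := ((0, y.1), y.2)) h2
      have h4 : Continuous fun w : ℝ × (B × (N × ℝ)) => ((w.1, w.2.1), w.2.2) := by fun_prop
      exact (h4.tendsto (0, y)).eventually h3)
  filter_upwards [h1] with e he p z hz
  exact he (p, z) ⟨trivial, trivial, hz⟩

/-- For `e = 0` the deformation only stretches the collar, which preserves the condition for every
`s`. The time obtained by compactness depends on `h`, and is used only to switch the stretching on.
-/
theorem eventually_deform_goodAt [CompactSpace N] [CompactSpace M] [T2Space M]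
    (c : Collar n N M) (hC : IsOpen C)
    {A : Type*} [TopologicalSpace A] [CompactSpace A] {h : A → RiemMetric (𝓡∂ (n + 1)) M}
    (hh : Continuous h) (hm : ∀ a, h a ∈ c.metrics)
    (hhC : ∀ a x, TensorField.GoodAt (I := 𝓡∂ (n + 1)) C (h a).inner x)
    {β : ℝ × A → RiemMetric (𝓡 n) N} (hβ : Continuous β) (h0 : ∀ a, β (0, a) = c.res (h a))
    (hgood : ∀ (a : A) (q : N × Icc (0 : ℝ) 1),
      TensorField.GoodAt (I := (𝓡 n).prod (𝓡∂ 1)) C (c.res (h a)).stab.inner q) :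
    ∀ᶠ e in 𝓝 (0 : ℝ), ∀ a, ∀ s ∈ Icc (0 : ℝ) 1, ∀ x,
      (c.deform (h a) (β (e, a)) s).GoodAt C x := by
  let T : ℝ × (A × Icc (0 : ℝ) 1) → TensorField (𝓡∂ (n + 1)) M := fun p =>
    c.deform (h p.2.1) (β (p.1, p.2.1)) p.2.2
  have hT : ∀ z, SmoothFamAt T z := fun z =>
    c.smoothFamAt_deform (h := fun p : ℝ × (A × Icc (0 : ℝ) 1) => h p.2.1)
      (b := fun p => β (p.1, p.2.1)) (s := fun p => p.2.2) (by fun_prop) (fun p => hm _)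
      (by fun_prop) (by fun_prop) (fun p => p.2.2.2.1) z
  have hsymm : ∀ p z u v, T p z u v = T p z v u := fun p => c.deform_symm _ _ _
  have h1 := IsCompact.eventually_forall_of_forall_eventually (x₀ := (0 : ℝ))
    (K := (univ : Set ((A × Icc (0 : ℝ) 1) × M)))
    (P := fun e y => (T (e, y.1)).GoodAt C y.2) isCompact_univ (fun y _ => by
      have h2 : (T (0, y.1)).GoodAt C y.2 := by
        refine c.deform_goodAt (hm _) (hhC _) y.1.2.2.1 y.1.2.2.2 (.inr (h0 _)) ?_ _
        intro z _
        rw [h0, cylinder_add_blend_self]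
        exact GoodAt.cylinder (hgood _) z
      have h3 := GoodAt.eventually hC hT hsymm (z := ((0, y.1), y.2)) h2
      have h4 : Continuous fun w : ℝ × ((A × Icc (0 : ℝ) 1) × M) => ((w.1, w.2.1), w.2.2) := by
        fun_prop
      exact (h4.tendsto (0, y)).eventually h3)
  filter_upwards [h1] with e he a s hs x
  exact he ((a, ⟨s, hs⟩), x) trivial

end Collar

/-! ### Deformations as Riemannian metrics -/

namespace Collar

open TensorField

variable {n : ℕ}
  {N : Type u} [TopologicalSpace N] [ChartedSpace (EuclideanSpace ℝ (Fin n)) N]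
  {M : Type u} [TopologicalSpace M] [ChartedSpace (EuclideanHalfSpace (n + 1)) M]
  [IsManifold (𝓡 n) ∞ N] [IsManifold (𝓡∂ (n + 1)) ∞ M]

/-- A positive definite deformation as a Riemannian metric. -/
def deformMetric [CompactSpace N] [T2Space M] (c : Collar n N M) {g : RiemMetric (𝓡∂ (n + 1)) M}
    (hg : g ∈ c.metrics) (b : RiemMetric (𝓡 n) N) {s : ℝ} (hs : 0 ≤ s)
    (hpos : ∀ (x : M) (v : TangentSpace (𝓡∂ (n + 1)) x), v ≠ 0 → 0 < c.deform g b s x v v) :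
    RiemMetric (𝓡∂ (n + 1)) M :=
  RiemMetric.ofTensor (c.deform g b s) (c.deform_symm g b s) hpos
    (fun x => c.smoothFamAt_deform (P := Unit) (h := fun _ => g) (b := fun _ => b)
      (s := fun _ => s) continuous_const (fun _ => hg) continuous_const continuous_const
      (fun _ => hs) ((), x))

theorem deformMetric_inner [CompactSpace N] [T2Space M] (c : Collar n N M)
    {g : RiemMetric (𝓡∂ (n + 1)) M} (hg : g ∈ c.metrics) (b : RiemMetric (𝓡 n) N) {s : ℝ}
    (hs : 0 ≤ s)
    (hpos : ∀ (x : M) (v : TangentSpace (𝓡∂ (n + 1)) x), v ≠ 0 → 0 < c.deform g b s x v v) :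
    (c.deformMetric hg b hs hpos).inner = c.deform g b s := rfl

end Collar

/-! ### Lifting over short time intervals -/

namespace CurvatureConditions

open Set Filter TensorField

variable {n : ℕ}
  {N : Type u} [TopologicalSpace N] [ChartedSpace (EuclideanSpace ℝ (Fin n)) N]
  {M : Type u} [TopologicalSpace M] [ChartedSpace (EuclideanHalfSpace (n + 1)) M]
  [IsManifold (𝓡 n) ∞ N] [IsManifold (𝓡∂ (n + 1)) ∞ M]
  {C : CurvatureConditions} {c : Collar n N M}

theorem StabPreserves.goodAt [T2Space N] [CompactSpace N] (hstab : C.StabPreserves.{u})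
    {b : RiemMetric (𝓡 n) N} (hb : b ∈ C.closedMetrics n N) (q : N × Icc (0 : ℝ) 1) :
    TensorField.GoodAt (I := (𝓡 n).prod (𝓡∂ 1)) (C.cond (n + 1)) b.stab.inner q :=
  (RiemMetric.satisfies_iff b.stab (by simp) _).1 (hstab n N b hb).2.2 q

theorem goodAt_of_mem_collaredMetrics {g : RiemMetric (𝓡∂ (n + 1)) M}
    (hg : g ∈ C.collaredMetrics c) (x : M) :
    TensorField.GoodAt (I := 𝓡∂ (n + 1)) (C.cond (n + 1)) g.inner x :=
  (RiemMetric.satisfies_iff g (by simp) _).1 hg.2.2 x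

/-- A family of deformations of metrics in `R_C(M)` is a family in `R_C(M)` as soon as it satisfies
the curvature condition. -/
theorem exists_deformation [CompactSpace N] [T2Space M] {Q : Type*} [TopologicalSpace Q]
    {h : Q → RiemMetric (𝓡∂ (n + 1)) M} (hh : Continuous h) (hm : ∀ q, h q ∈ C.collaredMetrics c)
    {β : Q → RiemMetric (𝓡 n) N} (hβ : Continuous β) {s : Q → ℝ} (hs : Continuous s)
    (hs0 : ∀ q, 0 ≤ s q)
    (hgood : ∀ q x, (c.deform (h q) (β q) (s q)).GoodAt (C.cond (n + 1)) x) :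
    ∃ L : Q → RiemMetric (𝓡∂ (n + 1)) M, Continuous L ∧ (∀ q, L q ∈ C.collaredMetrics c) ∧
      (∀ q, c.res (L q) = β q) ∧ ∀ q, (L q).inner = c.deform (h q) (β q) (s q) := by
  have hsm := fun z => c.smoothFamAt_deform hh (fun q => (hm q).1) hβ hs hs0 z
  let L : Q → RiemMetric (𝓡∂ (n + 1)) M := fun q =>
    c.deformMetric (hm q).1 (β q) (hs0 q) (fun x v hv => (hgood q x).pos v hv)
  have hL : ∀ q, (L q).inner = c.deform (h q) (β q) (s q) := fun q =>
    c.deformMetric_inner _ _ _ _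
  clear_value L
  refine ⟨L, RiemMetric.continuous_of_smoothFamAt fun z => ?_, fun q => ⟨?_, (hm q).2.1, ?_⟩,
    fun q => ?_, hL⟩
  · simp only [hL]
    exact hsm z
  · exact c.mem_metrics_of_inner_eq_deform (hm q).1 (hs0 q) (hL q)
  · refine (RiemMetric.satisfies_iff (L q) (by simp) _).2 ?_
    rw [hL]
    exact hgood q
  · exact c.res_eq_of_inner_eq_deform (hm q).1 (hs0 q) (hL q)

/-- Lifting of paths over time intervals on which the metric on the boundary is nearly constant. -/
theorem exists_short_lift [T2Space N] [CompactSpace N] [T2Space M] [CompactSpace M]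
    (hC : IsOpen (C.cond (n + 1))) (hstab : C.StabPreserves.{u}) {A : Type*} [TopologicalSpace A]
    [CompactSpace A] {γ : A × ℝ → RiemMetric (𝓡 n) N} (hγ : Continuous γ)
    (hγC : ∀ z, γ z ∈ C.closedMetrics n N) {δ τ : ℝ} (hδ : 0 ≤ δ)
    (hblend : ∀ e ∈ Icc 0 δ, ∀ (a : A) (z : N × ℝ), z.2 ∈ Icc (-(1 / 2)) 0 →
      TensorField.GoodAt (C.cond (n + 1)) (fun z =>
        TensorField.cylinder (I := 𝓡 n) (γ (a, τ)).inner z +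
          TensorField.blend (I := 𝓡 n) (γ (a, τ)).inner (γ (a, τ + e)).inner 1 z) z)
    {h : A → RiemMetric (𝓡∂ (n + 1)) M} (hh : Continuous h) (hm : ∀ a, h a ∈ C.collaredMetrics c)
    (h0 : ∀ a, c.res (h a) = γ (a, τ)) :
    ∃ L : A × ℝ → RiemMetric (𝓡∂ (n + 1)) M, Continuous L ∧ (∀ z, L z ∈ C.collaredMetrics c) ∧
      (∀ a, L (a, τ) = h a) ∧ ∀ a, ∀ t ∈ Icc τ (τ + δ), c.res (L (a, t)) = γ (a, t) := by
  have hev := c.eventually_deform_goodAt hC hh (fun a => (hm a).1)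
    (fun a => goodAt_of_mem_collaredMetrics (hm a)) (β := fun p => γ (p.2, τ + p.1))
    (by fun_prop) (fun a => by simp [h0]) (fun a => hstab.goodAt (by rw [h0]; exact hγC _))
  obtain ⟨t₀, ht₀, hball⟩ := Metric.eventually_nhds_iff.1 hev
  -- The time elapsed since `τ`, clamped to [0, δ] so that the lift is defined and good for all real
  -- times.
  let e : A × ℝ → ℝ := fun z => max 0 (min (z.2 - τ) δ)
  have he : Continuous e := by fun_prop
  have he0 : ∀ z, 0 ≤ e z := fun z => le_max_left _ _
  have heδ : ∀ z, e z ≤ δ := fun z => max_le hδ (min_le_right _ _)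
  obtain ⟨L, hL, hLm, hLres, hLinner⟩ := exists_deformation (C := C) (c := c)
    (h := fun z : A × ℝ => h z.1) (β := fun z => γ (z.1, τ + e z))
    -- The stretching starts at 0, so that the lift starts at `h`, and is complete by time `t₀ / 2`,
    -- before the estimate valid for all `s` expires at `t₀`.
    (s := fun z => min 1 (e z / (t₀ / 2))) (by fun_prop) (fun z => hm _) (by fun_prop)
    (by fun_prop) (fun z => le_min zero_le_one (div_nonneg (he0 z) (by positivity))) (by
      intro z x
      have hs0 : 0 ≤ min 1 (e z / (t₀ / 2)) :=
        le_min zero_le_one (div_nonneg (he0 z) (by positivity))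
      by_cases h1 : e z < t₀
      · refine hball ?_ z.1 _ ⟨hs0, min_le_left _ _⟩ x
        rw [Real.dist_eq, sub_zero, abs_of_nonneg (he0 z)]
        exact h1
      -- From here on the collar is fully stretched, so the estimate `hblend`, which does not
      -- involve `h`, applies.
      · have h2 : min 1 (e z / (t₀ / 2)) = 1 := by
          refine min_eq_left ?_
          rw [le_div_iff₀ (by positivity)]
          linarith [not_lt.1 h1]
        refine c.deform_goodAt (hm _).1 (goodAt_of_mem_collaredMetrics (hm _)) hs0
          (min_le_left _ _) (.inl h2) (fun w hw => ?_) x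
        rw [h2, h0]
        exact hblend (e z) ⟨he0 z, heδ z⟩ z.1 w hw)
  refine ⟨L, hL, hLm, fun a => ?_, fun a t ht => ?_⟩
  · have h1 : e (a, τ) = 0 := by simp [e, hδ]
    refine RiemMetric.ext_inner ?_
    -- At time `τ` both the stretching and the change of the boundary metric are zero.
    rw [hLinner, h1, add_zero, ← h0, zero_div, min_eq_right zero_le_one]
    exact funext (c.deform_zero _ (hm a).1)
  · have h1 : τ + e (a, t) = t := by
      simp only [e]
      rw [min_eq_left (by linarith [ht.2]), max_eq_right (by linarith [ht.1])]
      ring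
    rw [hLres, h1]

end CurvatureConditions

end

/-! ### The homotopy lifting property -/

theorem mainTheorem7 (C : CurvatureConditions) (hopen : C.Open)
    (hstab : C.StabPreserves.{u}) (hres : C.ResPreserves.{u}) : C.Fibrant.{u} := by
  intro n N _ _ _ _ _ _ M _ _ _ _ _ c
  have hmaps := hres n N M c
  refine ⟨hmaps, c.continuous_res.restrict hmaps, fun k h G hG => ?_⟩
  -- The cube is nonempty, so a lifting problem provides a metric in R_C(M), and with it the bound
  -- `C.dmin ≤ n + 1`.
  have hC : IsOpen (C.cond (n + 1)) := hopen _ (h 0).2.2.1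
  let γ : (Fin k → unitInterval) × ℝ → C.closedMetrics n N := fun z =>
    G (z.1, Set.projIcc 0 1 zero_le_one z.2)
  have hγ : Continuous γ := by fun_prop
  -- The starting time is one of the compact parameters, so a single step length works for all
  -- starting times in [0, 1].
  have hev := eventually_cylinder_add_blend_goodAt hC (B := (Fin k → unitInterval) × unitInterval)
    (β := fun p => (γ (p.2.1, (p.2.2 : ℝ) + p.1)).1) (by fun_prop)
    (fun p => hstab.goodAt (γ _).2)
  obtain ⟨δ, hδ, hball⟩ := Metric.eventually_nhds_iff.1 hev
  obtain ⟨L, hL, hL0, hLγ⟩ := exists_lift_of_short_lifts (p := hmaps.restrict) (γ := γ)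
    -- Half of `δ`, because the estimate holds on an open ball and the time intervals are closed.
    (half_pos hδ) (fun τ hτ h' hh' h0' => by
      obtain ⟨L, hL, hLm, hL0, hLγ⟩ := CurvatureConditions.exists_short_lift (C := C) (c := c)
        (γ := fun z => (γ z).1) hC hstab (by fun_prop) (fun z => (γ z).2) (half_pos hδ).le
        (fun e he a z hz => by
          have h1 := hball (y := e) (by
            rw [Real.dist_eq, sub_zero, abs_of_nonneg he.1]
            linarith [he.2]) (a, ⟨τ, hτ⟩) z hz
          simpa only [add_zero] using h1)
        (h := fun a => (h' a).1) (by fun_prop) (fun a => (h' a).2)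
        (fun a => congrArg Subtype.val (h0' a))
      exact ⟨fun z => ⟨L z, hLm z⟩, by fun_prop, fun a => Subtype.ext (hL0 a),
        fun a t ht => Subtype.ext (hLγ a t ht)⟩)
    h.continuous (fun a => by rw [← hG a]; simp [γ])
  refine ⟨⟨fun z => L (z.1, z.2), by fun_prop⟩, fun a => hL0 a, fun z => ?_⟩
  refine (hLγ z.1 z.2 z.2.2).trans ?_
  simp only [γ]
  rw [Set.projIcc_val]
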